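/- Let $W\in\mathbb Q^{m\times n}$, $w\in\mathbb Q^m$ and $p\in\{0,1,\dots,n\}$, and put $$\mathcal A:=\{x\in\mathbb R^n : Wx=w\},\qquad \mathcal S:=\mathcal A\cap(\mathbb Z^p\times\mathbb R^{n-p}).$$ Let $B\in\mathbb Q^{m\times(n-p)}$ be the matrix formed by the last $n-p$ columns of $W$, and let $n':=n-\operatorname{rank}(W)$ and $p':=p-\operatorname{rank}(W)+\operatorname{rank}(B)$. There is an algorithm which, given $m,n,p,W,w$, runs in time polynomial in $n$ plus the bit size of $W$ and $w$ (bit operations being counted), decides whether $\mathcal S$ is empty, and, if $\mathcal S\neq\emptyset$, finds $\bar x\in\mathbb Z^p\times\mathbb Q^{n-p}$ and a matrix $M\in\mathbb Q^{n\times n'}$ of full rank $n'$ such that the map $\tau:\mathbb R^{n'}\to\mathbb R^n$, $\tau(x')=\bar x+Mx'$, satisfies $$\mathcal A=\tau(\mathbb R^{n'}),\qquad \mathcal S=\tau\bigl(\mathbb Z^{p'}\times\mathbb R^{n'-p'}\bigr).$$ Furthermore, if $\mathcal A\neq\emptyset$ and there are a nonzero $d\in\mathbb R^n$ with $d_{p+1}=\dots=d_n=0$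 and a $\beta\in\mathbb R$ such that $d^{\mathsf T}x=\beta$ for all $x\in\mathcal A$, then $p'\le p-1$. -/

import Mathlib

/-! ### Machine model: random access machine with logarithmic cost

The memory consists of arrays of integers, `s x i` being the content of cell `i` of array `x`;
a program names finitely many arrays, and array cells can be addressed indirectly.
Programs are built from assignments, sequencing, branching and loops.  Every elementary operation is
charged the number of bit operations it needs, in terms of the binary lengths of all the numbers
and addresses involved. -/

namespace RAM

/-- Binary length of an integer, with one bit for the sign. -/
def bits (z : ℤ) : ℕ := 1 + Nat.size z.natAbs

/-- Memory of the machine. -/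
abbrev Mem : Type := ℕ → ℤ → ℤ

/-- Arithmetic expressions.  `read x i` is the content of cell `i` of array `x`. -/
inductive AExp : Type
  | const (c : ℤ)
  | read (x : ℕ) (i : AExp)
  | add (a b : AExp)
  | sub (a b : AExp)
  | mul (a b : AExp)
  | div (a b : AExp)

/-- Value of an expression; `div` is integer division with remainder (and `a / 0 = 0`). -/
def AExp.eval (s : Mem) : AExp → ℤ
  | .const c => c
  | .read x i => s x (i.eval s)
  | .add a b => a.eval s + b.eval s
  | .sub a b => a.eval s - b.eval s
  | .mul a b => a.eval s * b.eval s
  | .div a b => a.eval s / b.eval s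

/-- Number of bit operations charged for evaluating an expression. -/
def AExp.cost (s : Mem) : AExp → ℕ
  | .const c => bits c
  | .read x i => i.cost s + bits (i.eval s) + bits (s x (i.eval s))
  | .add a b => a.cost s + b.cost s + (bits (a.eval s) + bits (b.eval s))
  | .sub a b => a.cost s + b.cost s + (bits (a.eval s) + bits (b.eval s))
  | .mul a b => a.cost s + b.cost s + bits (a.eval s) * bits (b.eval s)
  | .div a b => a.cost s + b.cost s + bits (a.eval s) * bits (b.eval s)

/-- Programs.  `assign x i e` writes `e` into cell `i` of array `x`; branching and loops
test whether an expression is positive. -/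
inductive Prog : Type
  | skip
  | assign (x : ℕ) (i e : AExp)
  | seq (c₁ c₂ : Prog)
  | ifPos (e : AExp) (c₁ c₂ : Prog)
  | whilePos (e : AExp) (c : Prog)

/-- The memory `s` with cell `i` of array `x` overwritten by `v`. -/
def Mem.write (s : Mem) (x : ℕ) (i v : ℤ) : Mem :=
  Function.update s x (Function.update (s x) i v)

/-- `Runs c s s' t`: started in memory `s`, the program `c` halts in memory `s'`, and the total
cost of this run is `t`. -/
inductive Runs : Prog → Mem → Mem → ℕ → Prop
  | skip (s : Mem) : Runs .skip s s 1
  | assign (x : ℕ) (i e : AExp) (s : Mem) :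
      Runs (.assign x i e) s (s.write x (i.eval s) (e.eval s))
        (1 + i.cost s + e.cost s + bits (i.eval s) + bits (e.eval s))
  | seq {c₁ c₂ : Prog} {s s' s'' : Mem} {t₁ t₂ : ℕ} (h₁ : Runs c₁ s s' t₁)
      (h₂ : Runs c₂ s' s'' t₂) : Runs (.seq c₁ c₂) s s'' (t₁ + t₂)
  | ifTrue {e : AExp} {c₁ c₂ : Prog} {s s' : Mem} {t : ℕ} (he : 0 < e.eval s)
      (h : Runs c₁ s s' t) : Runs (.ifPos e c₁ c₂) s s' (1 + e.cost s + t)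
  | ifFalse {e : AExp} {c₁ c₂ : Prog} {s s' : Mem} {t : ℕ} (he : ¬ 0 < e.eval s)
      (h : Runs c₂ s s' t) : Runs (.ifPos e c₁ c₂) s s' (1 + e.cost s + t)
  | whileDone {e : AExp} {c : Prog} {s : Mem} (he : ¬ 0 < e.eval s) :
      Runs (.whilePos e c) s s (1 + e.cost s)
  | whileStep {e : AExp} {c : Prog} {s s' s'' : Mem} {t₁ t₂ : ℕ} (he : 0 < e.eval s)
      (h₁ : Runs c s s' t₁) (h₂ : Runs (.whilePos e c) s' s'' t₂) :
      Runs (.whilePos e c) s s'' (1 + e.cost s + t₁ + t₂)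

/-- Initial memory for the input `l`: array `0` holds the entries of `l`, cell `0` of array `1`
holds the length of `l`, and all other cells contain `0`. -/
def inputMem (l : List ℤ) : Mem := fun x i =>
  if x = 0 ∧ 0 ≤ i then l.getD i.toNat 0
  else if x = 1 ∧ i = 0 then (l.length : ℤ)
  else 0

/-- The memory `s` holds the output `l`, under the same convention; what the remaining cells
contain is irrelevant. -/
def HoldsOutput (s : Mem) (l : List ℤ) : Prop :=
  s 1 0 = (l.length : ℤ) ∧ ∀ i : ℕ, i < l.length → s 0 (i : ℤ) = l.getD i 0

/-- There is a polynomial time algorithm which, for every object `a`, given the encoding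
`input a`, halts with output `output a`.  The running time is measured in terms of `size a`. -/
def PolyTimeComputable {α : Type} (size : α → ℕ) (input output : α → List ℤ) : Prop :=
  ∃ (c : Prog) (P : Polynomial ℕ), ∀ a : α, ∃ (s : Mem) (t : ℕ),
    Runs c (inputMem (input a)) s t ∧ HoldsOutput s (output a) ∧ t ≤ P.eval (size a)

end RAM

/-! ### Sizes and encodings of rational data -/

/-- Rationals are given by numerator and denominator in lowest terms. -/
def encodeRat (q : ℚ) : List ℤ := [q.num, (q.den : ℤ)]

/-- Entries in order. -/
def encodeVec {n : ℕ} (v : Fin n → ℚ) : List ℤ := (List.ofFn v).flatMap encodeRat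

/-- Entries row by row. -/
def encodeMat {m n : ℕ} (M : Matrix (Fin m) (Fin n) ℚ) : List ℤ :=
  (List.ofFn fun i => M i).flatMap encodeVec

/-- Bit size `1 + ⌈log₂ (|a| + 1)⌉ + ⌈log₂ (b + 1)⌉` of a rational `a / b` in lowest terms. -/
def ratSize (q : ℚ) : ℕ := 1 + Nat.size q.num.natAbs + Nat.size q.den

/-- Bit size of a rational vector. -/
def vecSize {n : ℕ} (v : Fin n → ℚ) : ℕ := n + ∑ i, ratSize (v i)

/-- Bit size of a rational matrix. -/
def matSize {m n : ℕ} (M : Matrix (Fin m) (Fin n) ℚ) : ℕ := m * n + ∑ i, ∑ j, ratSize (M i j)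

/-! ### Mixed integer linear systems -/

/-- The set `ℤ^p × ℝ^(n-p)`, as a subset of `ℝ^n`. -/
def mixedInt (n p : ℕ) : Set (Fin n → ℝ) :=
  {x | ∀ j : Fin n, (j : ℕ) < p → ∃ z : ℤ, x j = (z : ℝ)}

/-- A rational system `W x = w` with `m` equations in `n` variables, the first `p` of which are
required to be integer. -/
structure MixedSystem : Type where
  m : ℕ
  n : ℕ
  p : ℕ
  p_le : p ≤ n
  W : Matrix (Fin m) (Fin n) ℚ
  w : Fin m → ℚ

namespace MixedSystem

/-- Encoding as a sequence of integers. -/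
def encode (I : MixedSystem) : List ℤ :=
  [(I.m : ℤ), (I.n : ℤ), (I.p : ℤ)] ++ encodeMat I.W ++ encodeVec I.w

/-- Bit size.  The summand `n` (one bit per variable, telling whether it is an integer variable)
only matters for systems without equations. -/
def size (I : MixedSystem) : ℕ := I.n + matSize I.W + vecSize I.w

/-- The affine space `{x ∈ ℝ^n : W x = w}`. -/
def affineSet (I : MixedSystem) : Set (Fin I.n → ℝ) :=
  {x | (I.W.map (fun q : ℚ => (q : ℝ))).mulVec x = fun i => (I.w i : ℝ)}

/-- Its mixed integer points. -/
def mixedSet (I : MixedSystem) : Set (Fin I.n → ℝ) := I.affineSet ∩ mixedInt I.n I.p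

/-- The matrix `B` formed by the last `n - p` columns of `W`. -/
def B (I : MixedSystem) : Matrix (Fin I.m) {j : Fin I.n // I.p ≤ (j : ℕ)} ℚ :=
  I.W.submatrix id Subtype.val

/-- `n' = n - rank W`. -/
noncomputable def n' (I : MixedSystem) : ℕ := I.n - I.W.rank

/-- `p' = p - rank W + rank B`, see `cast_p'`. -/
noncomputable def p' (I : MixedSystem) : ℕ := I.p + I.B.rank - I.W.rank

theorem cast_n' (I : MixedSystem) : (I.n' : ℤ) = (I.n : ℤ) - (I.W.rank : ℤ) := by
  have h : I.W.rank ≤ I.n := by simpa using I.W.rank_le_width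
  simp only [n']
  omega

theorem rank_W_le (I : MixedSystem) : I.W.rank ≤ I.p + I.B.rank := by
  rw [Matrix.rank_eq_finrank_span_cols, Matrix.rank_eq_finrank_span_cols]
  let c : Fin I.p → (Fin I.m → ℚ) := fun j => I.W.col (Fin.castLE I.p_le j)
  have h : Submodule.span ℚ (Set.range I.W.col) ≤
      Submodule.span ℚ (Set.range c) ⊔ Submodule.span ℚ (Set.range I.B.col) := by
    rw [Submodule.span_le]
    rintro _ ⟨j, rfl⟩
    by_cases hj : (j : ℕ) < I.p
    · exact Submodule.mem_sup_left (Submodule.subset_span ⟨⟨j, hj⟩, rfl⟩)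
    · exact Submodule.mem_sup_right (Submodule.subset_span ⟨⟨j, not_lt.mp hj⟩, rfl⟩)
  have h1 := Submodule.finrank_mono h
  have h2 := Submodule.finrank_add_le_finrank_add_finrank (Submodule.span ℚ (Set.range c))
    (Submodule.span ℚ (Set.range I.B.col))
  have h3 := finrank_range_le_card (R := ℚ) c
  rw [Set.finrank, Fintype.card_fin] at h3
  omega

theorem cast_p' (I : MixedSystem) :
    (I.p' : ℤ) = (I.p : ℤ) - (I.W.rank : ℤ) + (I.B.rank : ℤ) := by
  have h := I.rank_W_le
  simp only [p']
  omega

end MixedSystem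

/-- The data of an affine map `τ : ℝ^k → ℝ^n`, `τ x' = x̄ + M x'`, with rational `x̄` and `M`. -/
structure RatAffineMap (n k : ℕ) : Type where
  xbar : Fin n → ℚ
  M : Matrix (Fin n) (Fin k) ℚ

namespace RatAffineMap

/-- The map `τ : ℝ^k → ℝ^n`. -/
def toFun {n k : ℕ} (T : RatAffineMap n k) (x : Fin k → ℝ) : Fin n → ℝ :=
  fun i => (T.xbar i : ℝ) + (T.M.map (fun q : ℚ => (q : ℝ))).mulVec x i

/-- Encoding of the answer of the algorithm: `0` for "empty", and `1`, the number `k`,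
the vector `x̄` and the matrix `M` otherwise. -/
def encodeOption {n k : ℕ} : Option (RatAffineMap n k) → List ℤ
  | none => [0]
  | some T => [1, (k : ℤ)] ++ encodeVec T.xbar ++ encodeMat T.M

end RatAffineMap

/-! Multiply the system by the product of all denominators and eliminate without leaving the
integers. Every tableau (`red`) consists of Cramer determinants of the current basis matrix, whose
determinant is `pivDet`. The exchange relation `Matrix.det_mul_cramer_updateCol` shows that a pivot
step amounts to a 2×2 determinant divided exactly by the previous determinant. All tableau entries
are therefore at most `m! * H ^ m`, where `H` bounds the scaled input (`abs_red_le`), so their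
lengths stay polynomial.

The columns are processed from right to left, so continuous variables are made pivots before integer
ones. A row whose pivot lies in column `q` then vanishes to the right of `q` (`ElimState.ech`), so
an integer pivot variable depends on free integer variables only. Rank-nullity for `W` and for `B`
shows that there are `n'` free columns, `p'` of them integer (`Tableau.eq_n'`, `Tableau.eq_p'`).

Put `D = |pivDet|`. A solution is mixed integer exactly if its free integer variables are integers
satisfying one congruence modulo `D` for each row with an integer pivot (`Tableau.solve_int_iff`).
The congruences are added one at a time, while maintaining a particular solution and an upper
triangular basis of the lattice of homogeneous solutions (`ColState.step`, `CongState.step_ok`,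
`CongState.step_fail`). The lattice contains `D` times every unit vector, so reduction modulo `D`
keeps all numbers small. Coordinates with respect to this basis, together with the free continuous
variables, give `τ` (`Tableau.affineSet_eq`, `Tableau.mixedSet_eq`).

The running time is handled by the predicate `WP`: if no memory cell exceeds `M` and no loop makes
more than `L` rounds, then the cost is at most `Prog.time`, for a fixed program a polynomial in `L`
and the length of `M`.

For the last claim (`MixedSystem.p'_le`): if `p'` were at least `p`, then `B` and `W` would have the
same column span. A change of a single integer variable could then be compensated by continuous
variables alone, and this would change the value of `d` on the affine space. -/

namespace RAM

/-! ### Bounds for binary lengths -/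

theorem one_le_bits (z : ℤ) : 1 ≤ bits z := by simp [bits]

theorem bits_le_iff {z : ℤ} {k : ℕ} : bits z ≤ k + 1 ↔ z.natAbs < 2 ^ k := by
  rw [bits, add_comm, Nat.add_le_add_iff_right, Nat.size_le]

theorem natAbs_lt_two_pow_bits (z : ℤ) : z.natAbs < 2 ^ (bits z - 1) := by
  rw [← bits_le_iff]
  have := one_le_bits z
  omega

theorem bits_mono {a b : ℤ} (h : |a| ≤ |b|) : bits a ≤ bits b := by
  have h' : a.natAbs ≤ b.natAbs := by
    rw [Int.abs_eq_natAbs, Int.abs_eq_natAbs] at h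
    exact_mod_cast h
  simpa [bits] using Nat.size_le_size h'

theorem bits_add_le (a b : ℤ) : bits (a + b) ≤ bits a + bits b := by
  have ha := natAbs_lt_two_pow_bits a
  have hb := natAbs_lt_two_pow_bits b
  have h1 := one_le_bits a
  have h2 := one_le_bits b
  obtain ⟨k, hk⟩ : ∃ k, bits a + bits b = k + 1 := ⟨bits a + bits b - 1, by omega⟩
  rw [hk, bits_le_iff]
  have hp : (2 : ℕ) ^ k = 2 * (2 ^ (bits a - 1) * 2 ^ (bits b - 1)) := by
    rw [← pow_add, ← pow_succ']
    congr 1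
    omega
  have hA : 1 ≤ 2 ^ (bits a - 1) := Nat.one_le_two_pow
  have hB : 1 ≤ 2 ^ (bits b - 1) := Nat.one_le_two_pow
  have := Int.natAbs_add_le a b
  rw [hp]
  nlinarith

theorem bits_neg (a : ℤ) : bits (-a) = bits a := by simp [bits]

theorem bits_sub_le (a b : ℤ) : bits (a - b) ≤ bits a + bits b := by
  rw [sub_eq_add_neg, ← bits_neg b]
  exact bits_add_le _ _

theorem bits_mul_le (a b : ℤ) : bits (a * b) ≤ bits a + bits b := by
  have ha := natAbs_lt_two_pow_bits a
  have hb := natAbs_lt_two_pow_bits b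
  have h1 := one_le_bits a
  have h2 := one_le_bits b
  obtain ⟨k, hk⟩ : ∃ k, bits a + bits b = k + 1 := ⟨bits a + bits b - 1, by omega⟩
  rw [hk, bits_le_iff, Int.natAbs_mul]
  have hp : (2 : ℕ) ^ k = 2 * (2 ^ (bits a - 1) * 2 ^ (bits b - 1)) := by
    rw [← pow_add, ← pow_succ']
    congr 1
    omega
  have := Nat.mul_lt_mul'' ha hb
  omega

theorem bits_div_le (a b : ℤ) : bits (a / b) ≤ bits a := by
  have h := Int.natAbs_ediv_le_natAbs a b
  simpa [bits] using Nat.size_le_size h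

/-! ### Expressions -/

namespace AExp

instance : Add AExp := ⟨.add⟩
instance : Sub AExp := ⟨.sub⟩
instance : Mul AExp := ⟨.mul⟩
instance : Div AExp := ⟨.div⟩

/-- The content of cell `0` of array `x`. -/
abbrev var (x : ℕ) : AExp := .read x (.const 0)

/-- The remainder of `a` modulo `b`. -/
def modE (a b : AExp) : AExp := a - b * (a / b)

/-- The address `(i + j)² + i` of the entry `(i, j)` of a two-dimensional array. -/
def addrE (i j : AExp) : AExp := (i + j) * (i + j) + i

/-- The entry `(i, j)` of the two-dimensional array `x`. -/
def read₂ (x : ℕ) (i j : AExp) : AExp := .read x (addrE i j)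

variable (s : Mem)

@[simp] theorem eval_const (c : ℤ) : (AExp.const c).eval s = c := rfl
@[simp] theorem eval_read (x : ℕ) (i : AExp) : (AExp.read x i).eval s = s x (i.eval s) := rfl
@[simp] theorem eval_add (a b : AExp) : (a + b).eval s = a.eval s + b.eval s := rfl
@[simp] theorem eval_sub (a b : AExp) : (a - b).eval s = a.eval s - b.eval s := rfl
@[simp] theorem eval_mul (a b : AExp) : (a * b).eval s = a.eval s * b.eval s := rfl
@[simp] theorem eval_div (a b : AExp) : (a / b).eval s = a.eval s / b.eval s := rfl
@[simp] theorem eval_modE (a b : AExp) : (modE a b).eval s = a.eval s % b.eval s := by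
  simp [modE, Int.emod_def]

/-- Size of an expression, bounding the length of its value. -/
def sz : AExp → ℕ
  | const c => bits c
  | read _ i => 1 + sz i
  | add a b => sz a + sz b
  | sub a b => sz a + sz b
  | mul a b => sz a + sz b
  | div a b => sz a + sz b

/-- Coefficient of the quadratic bound for the evaluation cost of an expression. -/
def ck : AExp → ℕ
  | const c => bits c
  | read _ i => ck i + sz i + 1
  | add a b => ck a + ck b + (sz a + sz b)
  | sub a b => ck a + ck b + (sz a + sz b)
  | mul a b => ck a + ck b + sz a * sz b
  | div a b => ck a + ck b + sz a * sz b

end AExp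

/-- All memory cells contain numbers of absolute value at most `M`. -/
def Mem.Bdd (M : ℤ) (s : Mem) : Prop := ∀ x i, |s x i| ≤ M

theorem Mem.Bdd.bits_le {M : ℤ} {s : Mem} (h : s.Bdd M) (x : ℕ) (i : ℤ) :
    bits (s x i) ≤ bits M :=
  bits_mono ((h x i).trans (le_abs_self M))

theorem AExp.bits_eval_le {M : ℤ} {s : Mem} (h : s.Bdd M) (e : AExp) :
    bits (e.eval s) ≤ e.sz * bits M := by
  have hM := one_le_bits M
  induction e with
  | const c => exact Nat.le_mul_of_pos_right _ hM
  | read x i ih =>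
    refine (h.bits_le _ _).trans ?_
    simp only [sz]
    nlinarith
  | add a b iha ihb => exact (bits_add_le _ _).trans (by simp only [sz]; nlinarith)
  | sub a b iha ihb => exact (bits_sub_le _ _).trans (by simp only [sz]; nlinarith)
  | mul a b iha ihb => exact (bits_mul_le _ _).trans (by simp only [sz]; nlinarith)
  | div a b iha ihb => exact (bits_div_le _ _).trans (by simp only [sz]; nlinarith)

/-- The length of every value is at most a constant times `bits M`, the constant depending on the
expression only. A single operation multiplies at most two lengths, so a quadratic bound suffices.
-/
theorem AExp.cost_le {M : ℤ} {s : Mem} (h : s.Bdd M) (e : AExp) :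
    e.cost s ≤ e.ck * bits M ^ 2 := by
  have hM := one_le_bits M
  have hM2 : bits M ≤ bits M ^ 2 := Nat.le_self_pow (by norm_num) _
  have key (a : AExp) : bits (a.eval s) ≤ a.sz * bits M ^ 2 :=
    (a.bits_eval_le h).trans (Nat.mul_le_mul_left _ hM2)
  have keymul (a b : AExp) : bits (a.eval s) * bits (b.eval s) ≤ a.sz * b.sz * bits M ^ 2 := by
    refine (Nat.mul_le_mul (a.bits_eval_le h) (b.bits_eval_le h)).trans (le_of_eq ?_)
    ring
  induction e with
  | const c => exact Nat.le_mul_of_pos_right _ (by positivity)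
  | read x i ih =>
    have h1 := key i
    have h2 := h.bits_le x (i.eval s)
    simp only [cost, ck]
    linarith
  | add a b iha ihb =>
    have h1 := key a
    have h2 := key b
    simp only [cost, ck]
    linarith
  | sub a b iha ihb =>
    have h1 := key a
    have h2 := key b
    simp only [cost, ck]
    linarith
  | mul a b iha ihb =>
    have h1 := keymul a b
    simp only [cost, ck]
    linarith
  | div a b iha ihb =>
    have h1 := keymul a b
    simp only [cost, ck]
    linarith

/-! ### Writing to the memory -/

theorem Mem.write_apply (s : Mem) (x : ℕ) (i v : ℤ) (y : ℕ) (j : ℤ) :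
    s.write x i v y j = if y = x ∧ j = i then v else s y j := by
  by_cases h : y = x
  · subst h
    simp [Mem.write, Function.update_apply]
  · simp [Mem.write, h]

theorem Mem.write_ne (s : Mem) {x : ℕ} (i v : ℤ) {y : ℕ} (h : y ≠ x) :
    s.write x i v y = s y := by
  simp [Mem.write, h]

/-! ### Programs -/

namespace Prog

/-- The arrays to which a program writes. -/
def mods : Prog → List ℕ
  | skip => []
  | assign x _ _ => [x]
  | seq c₁ c₂ => c₁.mods ++ c₂.mods
  | ifPos _ c₁ c₂ => c₁.mods ++ c₂.mods
  | whilePos _ c => c.mods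

/-- Time bound for a program all of whose loops make at most `L` steps, on a memory with numbers of
length at most `b`. -/
def time (L b : ℕ) : Prog → ℕ
  | skip => 1
  | assign _ i e => (1 + i.ck + e.ck + i.sz + e.sz) * b ^ 2
  | seq c₁ c₂ => c₁.time L b + c₂.time L b
  | ifPos e c₁ c₂ => (1 + e.ck) * b ^ 2 + c₁.time L b + c₂.time L b
  | whilePos e c => (L + 1) * ((1 + e.ck) * b ^ 2) + L * c.time L b

/-- Assignment to cell `0` of array `x`. -/
abbrev set (x : ℕ) (e : AExp) : Prog := .assign x (.const 0) e

/-- Execute `c` for all values of the variable `v` from `0` up to (excluding) the value of `e`. -/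
def forTo (v : ℕ) (e : AExp) (c : Prog) : Prog :=
  .seq (.set v (.const 0))
    (.whilePos (e - .var v) (.seq c (.set v (.var v + .const 1))))

end Prog

/-- The frame rule. It allows specifications to mention only what a program changes; for concrete
programs, membership in `mods` is settled by `decide`. -/
theorem Runs.frame {c : Prog} {s s' : Mem} {t : ℕ} (h : Runs c s s' t) :
    ∀ x, x ∉ c.mods → s' x = s x := by
  induction h with
  | skip s => simp
  | assign x i e s =>
    intro y hy
    exact Mem.write_ne _ _ _ (by simpa [Prog.mods] using hy)
  | seq h₁ h₂ ih₁ ih₂ =>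
    intro y hy
    simp only [Prog.mods, List.mem_append, not_or] at hy
    rw [ih₂ y hy.2, ih₁ y hy.1]
  | ifTrue he h ih =>
    intro y hy
    simp only [Prog.mods, List.mem_append, not_or] at hy
    exact ih y hy.1
  | ifFalse he h ih =>
    intro y hy
    simp only [Prog.mods, List.mem_append, not_or] at hy
    exact ih y hy.2
  | whileDone he => simp
  | whileStep he h₁ h₂ ih₁ ih₂ =>
    intro y hy
    rw [ih₂ y hy, ih₁ y hy]

/-- Started in the memory `s`, the program `c` halts within its time bound, with a memory satisfying
`Q`, if all numbers in `s` are bounded by `M`; the bound `M` is never exceeded. -/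
def WP (L : ℕ) (M : ℤ) (c : Prog) (s : Mem) (Q : Mem → Prop) : Prop :=
  s.Bdd M → ∃ s' t, Runs c s s' t ∧ t ≤ c.time L (bits M) ∧ s'.Bdd M ∧ Q s'

namespace WP

variable {L : ℕ} {M : ℤ} {c c₁ c₂ : Prog} {s : Mem} {Q Q' : Mem → Prop}

/-- The weakening step also supplies the frame condition, so postconditions need not list the
unchanged arrays. -/
theorem mono (h : WP L M c s Q) (hQ : ∀ s', (∀ x, x ∉ c.mods → s' x = s x) → Q s' → Q' s') :
    WP L M c s Q' := by
  intro hs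
  obtain ⟨s', t, hr, ht, hb, hq⟩ := h hs
  exact ⟨s', t, hr, ht, hb, hQ s' hr.frame hq⟩

theorem of_bdd (h : s.Bdd M → WP L M c s Q) : WP L M c s Q := fun hs => h hs hs

theorem skip (h : Q s) : WP L M .skip s Q :=
  fun hs => ⟨s, 1, .skip s, le_rfl, hs, h⟩

theorem assign {x : ℕ} {i e : AExp} (he : |e.eval s| ≤ M)
    (h : Q (s.write x (i.eval s) (e.eval s))) : WP L M (.assign x i e) s Q := by
  intro hs
  refine ⟨_, _, .assign x i e s, ?_, ?_, h⟩
  · have h1 := i.cost_le hs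
    have h2 := e.cost_le hs
    have hM := one_le_bits M
    have hM2 : bits M ≤ bits M ^ 2 := Nat.le_self_pow (by norm_num) _
    have h3 := (i.bits_eval_le hs).trans (Nat.mul_le_mul_left _ hM2)
    have h4 := (e.bits_eval_le hs).trans (Nat.mul_le_mul_left _ hM2)
    simp only [Prog.time]
    nlinarith
  · intro y j
    rw [Mem.write_apply]
    split_ifs
    · exact he
    · exact hs y j

theorem seq (h : WP L M c₁ s (fun s' => WP L M c₂ s' Q)) : WP L M (.seq c₁ c₂) s Q := by
  intro hs
  obtain ⟨s₁, t₁, hr₁, ht₁, hb₁, hq₁⟩ := h hs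
  obtain ⟨s₂, t₂, hr₂, ht₂, hb₂, hq₂⟩ := hq₁ hb₁
  exact ⟨s₂, _, .seq hr₁ hr₂, Nat.add_le_add ht₁ ht₂, hb₂, hq₂⟩

theorem ifPos {e : AExp} (h₁ : 0 < e.eval s → WP L M c₁ s Q) (h₂ : e.eval s ≤ 0 → WP L M c₂ s Q) :
    WP L M (.ifPos e c₁ c₂) s Q := by
  intro hs
  have hc := e.cost_le hs
  have hM : 1 ≤ bits M ^ 2 := Nat.one_le_pow _ _ (one_le_bits M)
  by_cases he : 0 < e.eval s
  · obtain ⟨s₁, t₁, hr₁, ht₁, hb₁, hq₁⟩ := h₁ he hs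
    refine ⟨s₁, _, .ifTrue he hr₁, ?_, hb₁, hq₁⟩
    simp only [Prog.time]
    linarith [Nat.zero_le (c₂.time L (bits M))]
  · obtain ⟨s₁, t₁, hr₁, ht₁, hb₁, hq₁⟩ := h₂ (not_lt.mp he) hs
    refine ⟨s₁, _, .ifFalse he hr₁, ?_, hb₁, hq₁⟩
    simp only [Prog.time]
    linarith [Nat.zero_le (c₁.time L (bits M))]

/-- In the invariant `I k`, the number `k` bounds the number of remaining rounds. -/
theorem whilePos {e : AExp} (I : ℕ → Mem → Prop)
    (hstep : ∀ k s', (∀ x, x ∉ c.mods → s' x = s x) → I k s' → 0 < e.eval s' →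
      ∃ k', k = k' + 1 ∧ WP L M c s' (I k'))
    (hdone : ∀ k s', (∀ x, x ∉ c.mods → s' x = s x) → I k s' → e.eval s' ≤ 0 → Q s')
    (k : ℕ) (hk : k ≤ L) (h : I k s) : WP L M (.whilePos e c) s Q := by
  intro hs
  have hM : 1 ≤ bits M ^ 2 := Nat.one_le_pow _ _ (one_le_bits M)
  -- With `k` rounds left there are at most `k + 1` tests and `k` executions of the body. For `k =
  -- 0` a positive test contradicts `hstep`.
  have key : ∀ k s', I k s' → s'.Bdd M → (∀ x, x ∉ c.mods → s' x = s x) →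
      ∃ s'' t, Runs (.whilePos e c) s' s'' t ∧
      t ≤ (k + 1) * ((1 + e.ck) * bits M ^ 2) + k * c.time L (bits M) ∧ s''.Bdd M ∧ Q s'' := by
    intro k
    induction k with
    | zero =>
      intro s' hI hb hf
      have hc := e.cost_le hb
      by_cases he : 0 < e.eval s'
      · obtain ⟨k', hk', -⟩ := hstep 0 s' hf hI he
        omega
      · exact ⟨s', _, .whileDone he, by linarith, hb, hdone _ _ hf hI (not_lt.mp he)⟩
    | succ k ih =>
      intro s' hI hb hf
      have hc := e.cost_le hb
      by_cases he : 0 < e.eval s'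
      · obtain ⟨k', hk', hw⟩ := hstep _ s' hf hI he
        obtain rfl : k = k' := by omega
        obtain ⟨s₁, t₁, hr₁, ht₁, hb₁, hq₁⟩ := hw hb
        obtain ⟨s₂, t₂, hr₂, ht₂, hb₂, hq₂⟩ := ih s₁ hq₁ hb₁
          (fun x hx => (hr₁.frame x hx).trans (hf x hx))
        refine ⟨s₂, _, .whileStep he hr₁ hr₂, ?_, hb₂, hq₂⟩
        linarith
      · refine ⟨s', _, .whileDone he, ?_, hb, hdone _ _ hf hI (not_lt.mp he)⟩
        have : 0 ≤ (k + 1) * ((1 + e.ck) * bits M ^ 2) + (k + 1) * c.time L (bits M) :=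
          Nat.zero_le _
        linarith
  obtain ⟨s'', t, hr, ht, hb, hq⟩ := key k s h hs (fun _ _ => rfl)
  refine ⟨s'', t, hr, ht.trans ?_, hb, hq⟩
  simp only [Prog.time]
  gcongr

/-- The loop bound is evaluated again before each round, so `he` asks for its value in every memory
that the loop can reach. The invariant is stated after the counter has been written; hence the body
has to leave the counter alone and to establish the invariant for the memory with the counter
already increased. The counter ends at `n`, which is why `n ≤ M` is needed. -/
theorem forTo {v : ℕ} {e : AExp} (n : ℕ) (I : ℕ → Mem → Prop) (hn : n ≤ L) (hM : (n : ℤ) ≤ M)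
    (he : ∀ s' : Mem, (∀ x, x ≠ v → x ∉ c.mods → s' x = s x) → e.eval s' = n)
    (h0 : I 0 (s.write v 0 0))
    (hstep : ∀ i < n, ∀ s' : Mem, (∀ x, x ≠ v → x ∉ c.mods → s' x = s x) → s' v 0 = i → I i s' →
      WP L M c s' (fun s'' => s'' v 0 = i ∧ I (i + 1) (s''.write v 0 ((i : ℤ) + 1))))
    (hQ : ∀ s' : Mem, (∀ x, x ≠ v → x ∉ c.mods → s' x = s x) → s' v 0 = n → I n s' → Q s') :
    WP L M (.forTo v e c) s Q := by
  have hmods : ∀ x, x ∉ (Prog.seq c (.set v (.var v + .const 1))).mods ↔ x ∉ c.mods ∧ x ≠ v := by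
    intro x
    simp [Prog.mods]
  refine seq (assign (by simp; omega) ?_)
  refine whilePos (fun k s' => ∃ i ≤ n, k + i = n ∧ s' v 0 = i ∧ I i s') ?_ ?_ n hn ?_
  · rintro k s' hf ⟨i, hi, hki, hv, hI⟩ hpos
    have hf' : ∀ x, x ≠ v → x ∉ c.mods → s' x = s x := fun x hx hxc => by
      rw [hf x ((hmods x).2 ⟨hxc, hx⟩), Mem.write_ne _ _ _ hx]
    have := he s' hf'
    simp only [AExp.eval_sub, AExp.eval_read, AExp.eval_const, this, hv] at hpos
    refine ⟨k - 1, by omega, seq ((hstep i (by omega) s' hf' hv hI).mono ?_)⟩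
    rintro s'' - ⟨hv'', hI''⟩
    refine assign ?_ ⟨i + 1, by omega, by omega, ?_, ?_⟩
    · simp only [AExp.eval_add, AExp.eval_read, AExp.eval_const, hv'', abs_le]
      omega
    · simp [Mem.write_apply, hv'']
    · simpa [hv''] using hI''
  · rintro k s' hf ⟨i, hi, hki, hv, hI⟩ hpos
    have hf' : ∀ x, x ≠ v → x ∉ c.mods → s' x = s x := fun x hx hxc => by
      rw [hf x ((hmods x).2 ⟨hxc, hx⟩), Mem.write_ne _ _ _ hx]
    have := he s' hf'
    simp only [AExp.eval_sub, AExp.eval_read, AExp.eval_const, this, hv] at hpos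
    obtain rfl : i = n := by omega
    exact hQ s' hf' hv hI
  · exact ⟨0, by omega, by omega, by simp [Mem.write_apply], by simpa using h0⟩

end WP

/-! ### Two-dimensional arrays -/

/-- The address of the entry `(i, j)` of a two-dimensional array. -/
def addr (i j : ℕ) : ℤ := ((i : ℤ) + j) * (i + j) + i

-- With `t = i + j`, the address lies between `t²` and `t² + t`, hence strictly below `(t + 1)²`. So
-- it determines `t`, and then `i`.
@[simp] theorem addr_inj {i j i' j' : ℕ} : addr i j = addr i' j' ↔ i = i' ∧ j = j' := by
  refine ⟨fun h => ?_, fun h => by rw [h.1, h.2]⟩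
  have h' : (i + j) * (i + j) + i = (i' + j') * (i' + j') + i' := by
    rw [addr, addr] at h
    exact_mod_cast h
  have hs : i + j = i' + j' := by
    rcases lt_trichotomy (i + j) (i' + j') with hl | he | hl
    · have : (i + j + 1) * (i + j + 1) ≤ (i' + j') * (i' + j') := Nat.mul_le_mul hl hl
      nlinarith
    · exact he
    · have : (i' + j' + 1) * (i' + j' + 1) ≤ (i + j) * (i + j) := Nat.mul_le_mul hl hl
      nlinarith
  rw [hs] at h'
  omega

theorem AExp.eval_addrE {s : Mem} {i j : AExp} {a b : ℕ} (hi : i.eval s = a) (hj : j.eval s = b) :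
    (addrE i j).eval s = addr a b := by
  simp [addrE, addr, hi, hj]

theorem AExp.eval_read₂ {s : Mem} {x : ℕ} {i j : AExp} {a b : ℕ} (hi : i.eval s = a)
    (hj : j.eval s = b) : (read₂ x i j).eval s = s x (addr a b) := by
  rw [read₂, eval_read, eval_addrE hi hj]

end RAM

/-! ### Fraction-free elimination -/

section Elimination

open Matrix

/-- The exchange relation for Cramer determinants. -/
theorem Matrix.det_mul_cramer_updateCol {ι R : Type*} [Fintype ι] [DecidableEq ι] [CommRing R]
    (E : Matrix ι ι R) (a b : ι → R) {i r : ι} (h : r ≠ i) :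
    E.det * cramer (E.updateCol i a) b r =
      cramer E a i * cramer E b r - cramer E a r * cramer E b i := by
  -- The column `k` of `E` now occurs both in position `k` and in position `r`.
  have hcol : ∀ k : ι, k ≠ r → k ≠ i → cramer (E.updateCol i a) (fun k' => E k' k) r = 0 := by
    intro k hk hki
    rw [cramer_apply]
    refine det_zero_of_column_eq (i := r) (j := k) hk.symm fun k' => ?_
    rw [updateCol_self, updateCol_ne hk, updateCol_ne hki]
  have hself : cramer (E.updateCol i a) (fun k' => E k' r) r = cramer E a i := by
    rw [cramer_apply, cramer_apply]
    congr 1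
    ext k' l
    by_cases hl : l = r
    · subst hl
      rw [updateCol_self, updateCol_ne h]
    · rw [updateCol_ne hl]
  -- The matrix is `E.updateCol r a` with the columns `i` and `r` exchanged, whence the sign.
  have hswap : cramer (E.updateCol i a) (fun k' => E k' i) r = - cramer E a r := by
    rw [cramer_apply, cramer_apply]
    have := det_permute' (Equiv.swap i r) (E.updateCol r a)
    rw [Equiv.Perm.sign_swap h.symm] at this
    simp only [Units.val_neg, Units.val_one, Int.cast_neg, Int.cast_one, neg_mul, one_mul] at this
    rw [← this]
    congr 1
    ext k' l
    rw [submatrix_apply, id]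
    by_cases hl : l = r
    · subst hl
      rw [updateCol_self, Equiv.swap_apply_right, updateCol_ne h.symm]
    · by_cases hli : l = i
      · subst hli
        rw [updateCol_ne hl, updateCol_self, Equiv.swap_apply_left, updateCol_self]
      · rw [updateCol_ne hl, updateCol_ne hli, Equiv.swap_apply_of_ne_of_ne hli hl, updateCol_ne hl]
  -- Cramer's rule writes `E.det • b` as a combination of the columns of `E`. After applying the
  -- Cramer map of the updated matrix, only the terms for `r` and `i` survive.
  have hb : E.det • b = ∑ k, cramer E b k • fun k' => E k' k := by
    rw [← mulVec_cramer]
    ext k'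
    simp [mulVec, dotProduct, mul_comm]
  have := congrFun (congrArg (cramer (E.updateCol i a)) hb) r
  rw [map_smul, map_sum, Pi.smul_apply, smul_eq_mul, Finset.sum_apply] at this
  rw [this, Finset.sum_eq_add r i h]
  · rw [map_smul, map_smul, Pi.smul_apply, Pi.smul_apply, hself, hswap]
    simp only [smul_eq_mul]
    ring
  · rintro k - ⟨hkr, hki⟩
    rw [map_smul, Pi.smul_apply, hcol k hkr hki, smul_zero]
  · simp
  · simp

/-- The column `l` of `A`, cut off after `m` entries. -/
def colVec (m : ℕ) (A : ℕ → ℕ → ℤ) (l : ℕ) : Fin m → ℤ := fun r => A r l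

/-- The basis matrix belonging to the pivots `rp`: if `rp i = q + 1`, then the pivot of row `i` is in
column `q`; there is no pivot in row `i` if `rp i = 0`. -/
def pivMat (m : ℕ) (A : ℕ → ℕ → ℤ) (rp : ℕ → ℕ) : Matrix (Fin m) (Fin m) ℤ :=
  Matrix.of fun r i => if rp i = 0 then (if r = i then 1 else 0) else A r (rp i - 1)

/-- The determinant of the basis matrix. -/
def pivDet (m : ℕ) (A : ℕ → ℕ → ℤ) (rp : ℕ → ℕ) : ℤ := (pivMat m A rp).det

/-- The tableau of `A` with respect to the basis matrix, multiplied by the determinant. -/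
def red (m : ℕ) (A : ℕ → ℕ → ℤ) (rp : ℕ → ℕ) (i l : ℕ) : ℤ :=
  if h : i < m then cramer (pivMat m A rp) (colVec m A l) ⟨i, h⟩ else 0

variable {m : ℕ} {A : ℕ → ℕ → ℤ} {rp : ℕ → ℕ}

theorem red_of_lt {i : ℕ} (h : i < m) (l : ℕ) :
    red m A rp i l = cramer (pivMat m A rp) (colVec m A l) ⟨i, h⟩ := dif_pos h

theorem pivMat_update {i : ℕ} (h : i < m) (j : ℕ) :
    pivMat m A (Function.update rp i (j + 1)) = (pivMat m A rp).updateCol ⟨i, h⟩ (colVec m A j) := by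
  ext r k
  by_cases hk : k = ⟨i, h⟩
  · subst hk
    simp [pivMat, colVec]
  · have : (k : ℕ) ≠ i := fun hh => hk (Fin.ext hh)
    simp [pivMat, updateCol_ne hk, Function.update_of_ne this]

theorem pivMat_col {i q : ℕ} (h : i < m) (hq : rp i = q + 1) :
    (fun r => pivMat m A rp r ⟨i, h⟩) = colVec m A q := by
  ext r
  simp [pivMat, colVec, hq]

theorem red_pivot_self {i q : ℕ} (h : i < m) (hq : rp i = q + 1) :
    red m A rp i q = pivDet m A rp := by
  rw [red_of_lt h, cramer_apply, ← pivMat_col h hq, pivDet]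
  congr 1
  exact updateCol_eq_self _ _

/-- The column `q` of `A` already occupies position `i` of the basis matrix, so putting it into
position `r` creates a repeated column. -/
theorem red_pivot_ne {i q r : ℕ} (h : i < m) (hq : rp i = q + 1) (hr : r ≠ i) :
    red m A rp r q = 0 := by
  by_cases hrm : r < m
  · have hne : (⟨r, hrm⟩ : Fin m) ≠ ⟨i, h⟩ := fun hh => hr (congrArg Fin.val hh)
    rw [red_of_lt hrm, cramer_apply, ← pivMat_col h hq]
    refine det_zero_of_column_eq hne fun k => ?_
    rw [updateCol_self, updateCol_ne hne.symm]
  · exact dif_neg hrm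

theorem pivDet_update {i : ℕ} (h : i < m) (j : ℕ) :
    pivDet m A (Function.update rp i (j + 1)) = red m A rp i j := by
  rw [pivDet, pivMat_update h, red_of_lt h, cramer_apply]

/-- The Cramer determinant for position `i` overwrites the column `i` of the basis matrix, so it
does not matter what stood there. Hence a pivot step leaves the pivot row unchanged. -/
theorem red_update_self {i : ℕ} (h : i < m) (j l : ℕ) :
    red m A (Function.update rp i (j + 1)) i l = red m A rp i l := by
  rw [red_of_lt h, red_of_lt h, pivMat_update h, cramer_apply, cramer_apply]
  congr 1
  ext k l'
  by_cases hl : l' = ⟨i, h⟩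
  · subst hl
    simp
  · rw [updateCol_ne hl, updateCol_ne hl, updateCol_ne hl]

/-- This is the pivot step. In particular, the division by the old determinant carried out by the
program has no remainder. -/
theorem pivDet_mul_red_update {i r : ℕ} (h : i < m) (hr : r < m) (hri : r ≠ i) (j l : ℕ) :
    pivDet m A rp * red m A (Function.update rp i (j + 1)) r l =
      red m A rp i j * red m A rp r l - red m A rp r j * red m A rp i l := by
  have hne : (⟨r, hr⟩ : Fin m) ≠ ⟨i, h⟩ := fun hh => hri (congrArg Fin.val hh)
  rw [red_of_lt hr, red_of_lt h, red_of_lt hr, red_of_lt hr, red_of_lt h, pivMat_update h, pivDet]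
  exact Matrix.det_mul_cramer_updateCol _ _ _ hne

theorem pivMat_zero : pivMat m A (fun _ => 0) = 1 := by
  ext r k
  simp [pivMat, Matrix.one_apply]

theorem pivDet_zero : pivDet m A (fun _ => 0) = 1 := by
  rw [pivDet, pivMat_zero, det_one]

theorem red_zero {i : ℕ} (h : i < m) (l : ℕ) : red m A (fun _ => 0) i l = A i l := by
  rw [red_of_lt h, pivMat_zero, cramer_one]
  rfl

theorem abs_pivMat_le {H : ℤ} {n : ℕ} (hH : 1 ≤ H) (hA : ∀ i < m, ∀ l ≤ n, |A i l| ≤ H)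
    (hrp : ∀ i < m, rp i ≤ n) (r k : Fin m) : |pivMat m A rp r k| ≤ H := by
  simp only [pivMat, of_apply]
  have := hrp k k.2
  split_ifs
  · simpa using hH
  · simp; omega
  · exact hA r r.2 _ (by omega)

theorem abs_pivDet_le {H : ℤ} {n : ℕ} (hH : 1 ≤ H) (hA : ∀ i < m, ∀ l ≤ n, |A i l| ≤ H)
    (hrp : ∀ i < m, rp i ≤ n) : |pivDet m A rp| ≤ m.factorial * H ^ m := by
  have := det_le (A := pivMat m A rp) (abv := AbsoluteValue.abs) (abs_pivMat_le hH hA hrp)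
  simpa [pivDet] using this

/-- Each entry is a determinant with entries bounded by `H`, regardless of how many pivot steps led
to it. This rules out exponential growth of lengths. The assumption `1 ≤ H` takes care of the unit
vectors in the basis matrix. -/
theorem abs_red_le {H : ℤ} {n i l : ℕ} (hH : 1 ≤ H) (hA : ∀ i < m, ∀ l ≤ n, |A i l| ≤ H)
    (hrp : ∀ i < m, rp i ≤ n) (hl : l ≤ n) : |red m A rp i l| ≤ m.factorial * H ^ m := by
  by_cases hi : i < m
  · rw [red_of_lt hi, cramer_apply]
    have := det_le (A := (pivMat m A rp).updateCol ⟨i, hi⟩ (colVec m A l))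
      (abv := AbsoluteValue.abs) (x := H) fun r k => ?_
    · simpa using this
    · by_cases hk : k = ⟨i, hi⟩
      · subst hk
        rw [updateCol_self]
        exact hA r r.2 l hl
      · rw [updateCol_ne hk]
        exact abs_pivMat_le hH hA hrp r k
  · rw [red, dif_neg hi, abs_zero]
    positivity

/-- Together with `red_eq_sum` this expresses `A` by the tableau and the tableau by `A`; so both
have the same solutions as soon as the determinant is non-zero. -/
theorem pivMat_mul_red (r : Fin m) (l : ℕ) :
    ∑ i : Fin m, pivMat m A rp r i * red m A rp i l = pivDet m A rp * A r l := by
  have := congrFun (mulVec_cramer (pivMat m A rp) (colVec m A l)) r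
  simp only [mulVec, dotProduct, Pi.smul_apply, smul_eq_mul] at this
  rw [pivDet, ← show colVec m A l r = A r l from rfl, ← this]
  refine Finset.sum_congr rfl fun i _ => ?_
  rw [red_of_lt i.2]

theorem red_eq_sum (i : Fin m) (l : ℕ) :
    red m A rp i l = ∑ r : Fin m, (pivMat m A rp).adjugate i r * A r l := by
  rw [red_of_lt i.2, cramer_eq_adjugate_mulVec]
  rfl

/-- Row operations do not change the solutions. -/
theorem red_system_iff {K : Type*} [Field K] [CharZero K] (hd : pivDet m A rp ≠ 0) (n : ℕ)
    (x : ℕ → K) :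
    (∀ i < m, ∑ l ∈ Finset.range n, (red m A rp i l : K) * x l = 0) ↔
      ∀ i < m, ∑ l ∈ Finset.range n, (A i l : K) * x l = 0 := by
  have hd' : (pivDet m A rp : K) ≠ 0 := by exact_mod_cast hd
  constructor
  · intro h r hr
    refine (mul_eq_zero.mp ?_).resolve_left hd'
    rw [Finset.mul_sum]
    have h1 : ∀ l, (pivDet m A rp : K) * ((A r l : K) * x l) =
        ∑ i : Fin m, (pivMat m A rp ⟨r, hr⟩ i : K) * ((red m A rp i l : K) * x l) := by
      intro l
      have := congrArg (Int.cast (R := K)) (pivMat_mul_red (A := A) (rp := rp) ⟨r, hr⟩ l)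
      push_cast at this
      rw [← mul_assoc, ← this, Finset.sum_mul]
      exact Finset.sum_congr rfl fun _ _ => by ring
    rw [Finset.sum_congr rfl fun l _ => h1 l, Finset.sum_comm]
    refine Finset.sum_eq_zero fun i _ => ?_
    rw [← Finset.mul_sum, h i i.2, mul_zero]
  · intro h i hi
    have h1 : ∀ l, (red m A rp i l : K) * x l =
        ∑ r : Fin m, ((pivMat m A rp).adjugate ⟨i, hi⟩ r : K) * ((A r l : K) * x l) := by
      intro l
      have := congrArg (Int.cast (R := K)) (red_eq_sum (A := A) (rp := rp) ⟨i, hi⟩ l)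
      push_cast at this
      rw [this, Finset.sum_mul]
      exact Finset.sum_congr rfl fun _ _ => by ring
    rw [Finset.sum_congr rfl fun l _ => h1 l, Finset.sum_comm]
    refine Finset.sum_eq_zero fun r _ => ?_
    rw [← Finset.mul_sum, h r r.2, mul_zero]

/-- The state of the elimination: all columns from `J` on have been processed, and so have the first
`i` rows of the column `J - 1`.  The pivot in column `l` is in row `r` if `cp l = r + 1`. -/
structure ElimState (m n : ℕ) (A : ℕ → ℕ → ℤ) (rp cp : ℕ → ℕ) (J i : ℕ) : Prop where
  rp_le : ∀ r < m, rp r ≤ n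
  det_ne : pivDet m A rp ≠ 0
  zero : ∀ r < m, rp r = 0 → ∀ l, J ≤ l → l < n → red m A rp r l = 0
  zero' : ∀ r < m, r < i → rp r = 0 → ∀ l, l + 1 = J → red m A rp r l = 0
  ech : ∀ r < m, ∀ q, rp r = q + 1 → J ≤ q + 1 ∧ ∀ l, q < l → l < n → red m A rp r l = 0
  cp_spec : ∀ l < n, (cp l = 0 ∧ ∀ r < m, rp r ≠ l + 1) ∨ ∃ r < m, cp l = r + 1 ∧ rp r = l + 1

namespace ElimState

variable {n J i j : ℕ} {cp : ℕ → ℕ}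

theorem init (m n : ℕ) (A : ℕ → ℕ → ℤ) : ElimState m n A (fun _ => 0) (fun _ => 0) n 0 where
  rp_le _ _ := Nat.zero_le _
  det_ne := by simp [pivDet_zero]
  zero _ _ _ l h1 h2 := absurd h2 (by omega)
  zero' _ _ h := absurd h (by omega)
  ech _ _ q h := absurd h (by omega)
  cp_spec _ _ := by simp

theorem next_col (h : ElimState m n A rp cp (j + 1) m) : ElimState m n A rp cp j 0 where
  rp_le := h.rp_le
  det_ne := h.det_ne
  zero r hr hrp l hl hln := by
    rcases hl.eq_or_lt with rfl | hl
    · exact h.zero' r hr hr hrp _ rfl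
    · exact h.zero r hr hrp l hl hln
  zero' _ _ h := absurd h (by omega)
  ech r hr q hq := ⟨by have := (h.ech r hr q hq).1; omega, (h.ech r hr q hq).2⟩
  cp_spec := h.cp_spec

theorem skip (h : ElimState m n A rp cp (j + 1) i) (hi : rp i = 0 → red m A rp i j = 0) :
    ElimState m n A rp cp (j + 1) (i + 1) where
  rp_le := h.rp_le
  det_ne := h.det_ne
  zero := h.zero
  zero' r hr hri hrp l hl := by
    rcases (Nat.lt_succ_iff_lt_or_eq.mp hri) with hri | rfl
    · exact h.zero' r hr hri hrp l hl
    · obtain rfl : l = j := by omega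
      exact hi hrp
  ech := h.ech
  cp_spec := h.cp_spec

/-- By `zero`, a row without pivot vanishes in all columns processed so far. Where the pivot row and
the row `r` both vanish, the exchange relation makes the new row `r` vanish too, so the zeros
obtained earlier survive. -/
theorem pivot (h : ElimState m n A rp cp (j + 1) i) (hi : i < m) (hj : j < n) (hrp : rp i = 0)
    (hne : red m A rp i j ≠ 0) :
    ElimState m n A (Function.update rp i (j + 1)) (Function.update cp j (i + 1)) (j + 1)
      (i + 1) := by
  have hz : ∀ r < m, r ≠ i → ∀ l, red m A rp i l = 0 → red m A rp r l = 0 →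
      red m A (Function.update rp i (j + 1)) r l = 0 := by
    intro r hr hri l h1 h2
    have := pivDet_mul_red_update (A := A) (rp := rp) hi hr hri j l
    rw [h1, h2, mul_zero, mul_zero, sub_zero] at this
    exact (mul_eq_zero.mp this).resolve_left h.det_ne
  have hzi := h.zero i hi hrp
  refine ⟨?_, by rwa [pivDet_update hi], ?_, ?_, ?_, ?_⟩
  · intro r hr
    by_cases hri : r = i
    · subst hri
      simpa using hj
    · simpa [hri] using h.rp_le r hr
  · intro r hr hr0 l hl hln
    have hri : r ≠ i := fun hh => by simp [hh] at hr0
    rw [Function.update_of_ne hri] at hr0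
    exact hz r hr hri l (hzi l hl hln) (h.zero r hr hr0 l hl hln)
  · intro r hr hri' hr0 l hl
    obtain rfl : l = j := by omega
    have hri : r ≠ i := fun hh => by simp [hh] at hr0
    exact red_pivot_ne hi (by simp) hri
  · intro r hr q hq
    by_cases hri : r = i
    · subst hri
      obtain rfl : j = q := by simpa using hq
      exact ⟨le_rfl, fun l hl hln => by rw [red_update_self hi]; exact hzi l hl hln⟩
    · rw [Function.update_of_ne hri] at hq
      obtain ⟨h1, h2⟩ := h.ech r hr q hq
      exact ⟨h1, fun l hl hln => hz r hr hri l (hzi l (by omega) hln) (h2 l hl hln)⟩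
  · intro l hl
    by_cases hlj : l = j
    · subst hlj
      exact Or.inr ⟨i, hi, by simp, by simp⟩
    · rw [Function.update_of_ne hlj]
      rcases h.cp_spec l hl with ⟨h1, h2⟩ | ⟨r, hr, h1, h2⟩
      · refine Or.inl ⟨h1, fun r hr => ?_⟩
        by_cases hri : r = i
        · subst hri
          simpa using fun h => hlj h.symm
        · rw [Function.update_of_ne hri]
          exact h2 r hr
      · have hri : r ≠ i := fun hh => by rw [hh, hrp] at h2; omega
        exact Or.inr ⟨r, hr, h1, by rw [Function.update_of_ne hri, h2]⟩

end ElimState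

end Elimination

/-! ### Triangular bases of lattices given by congruences -/

section Congruences

/-- The product of the first `k` entries of two vectors. -/
def dotK (k : ℕ) (a z : ℕ → ℤ) : ℤ := ∑ f ∈ Finset.range k, a f * z f

theorem dotK_add (k : ℕ) (a z w : ℕ → ℤ) : dotK k a (z + w) = dotK k a z + dotK k a w := by
  simp [dotK, mul_add, Finset.sum_add_distrib]

theorem dotK_smul (k : ℕ) (a z : ℕ → ℤ) (c : ℤ) : dotK k a (c • z) = c * dotK k a z := by
  simp only [dotK, Finset.mul_sum, Pi.smul_apply, smul_eq_mul]
  exact Finset.sum_congr rfl fun _ _ => by ring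

theorem dotK_sub (k : ℕ) (a z w : ℕ → ℤ) : dotK k a (z - w) = dotK k a z - dotK k a w := by
  simp [dotK, mul_sub, Finset.sum_sub_distrib]

theorem dotK_modEq {k : ℕ} {D : ℤ} (a : ℕ → ℤ) {z w : ℕ → ℤ} (h : ∀ f < k, z f ≡ w f [ZMOD D]) :
    dotK k a z ≡ dotK k a w [ZMOD D] := by
  rw [Int.modEq_iff_dvd, dotK, dotK, ← Finset.sum_sub_distrib]
  refine Finset.dvd_sum fun f hf => ?_
  rw [← mul_sub]
  exact Dvd.dvd.mul_left (h f (Finset.mem_range.mp hf)).dvd _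

/-- The lattice of the solutions of the homogeneous congruences modulo `D` with index in `S`. -/
def congLat (k : ℕ) (D : ℤ) (a : ℕ → ℕ → ℤ) (S : Set ℕ) : AddSubgroup (ℕ → ℤ) where
  carrier := {z | ∀ i ∈ S, D ∣ dotK k (a i) z}
  zero_mem' := fun i _ => by simp [dotK]
  add_mem' := fun hz hw i hi => by
    rw [dotK_add]
    exact dvd_add (hz i hi) (hw i hi)
  neg_mem' := fun {z} hz i hi => by
    rw [show -z = (-1 : ℤ) • z by simp, dotK_smul]
    exact Dvd.dvd.mul_left (hz i hi) _

theorem mem_congLat {k : ℕ} {D : ℤ} {a : ℕ → ℕ → ℤ} {S : Set ℕ} {z : ℕ → ℤ} :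
    z ∈ congLat k D a S ↔ ∀ i ∈ S, D ∣ dotK k (a i) z := Iff.rfl

variable {k : ℕ} {D : ℤ}

/-- This is what permits reduction modulo `D`. It also shows that entries from `k` on are
irrelevant, although lattice vectors are functions on all of `ℕ`. -/
theorem congLat_modEq {a : ℕ → ℕ → ℤ} {S : Set ℕ} {z w : ℕ → ℤ} (h : ∀ f < k, w f ≡ z f [ZMOD D])
    (hz : z ∈ congLat k D a S) : w ∈ congLat k D a S := fun i hi =>
  Int.modEq_zero_iff_dvd.mp ((dotK_modEq (a i) h).trans (Int.modEq_zero_iff_dvd.mpr (hz i hi)))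

theorem mem_congLat_insert {a : ℕ → ℕ → ℤ} {S : Set ℕ} {i : ℕ} {z : ℕ → ℤ} :
    z ∈ congLat k D a (insert i S) ↔ D ∣ dotK k (a i) z ∧ z ∈ congLat k D a S := by
  simp [mem_congLat]

/-- The column `l` of `N` can serve as an element of an upper triangular basis of `Λ`. -/
structure TriCol (k : ℕ) (Λ : AddSubgroup (ℕ → ℤ)) (N : ℕ → ℕ → ℤ) (l : ℕ) : Prop where
  mem : (fun f => N f l) ∈ Λ
  upper : ∀ f < k, l < f → N f l = 0
  pos : 0 < N l l
  dvd : ∀ z ∈ Λ, (∀ f < k, l < f → z f = 0) → N l l ∣ z l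

/-- Every lattice vector is an integer combination of the triangular basis. -/
theorem exists_coords_of_triCol {Λ : AddSubgroup (ℕ → ℤ)} {N : ℕ → ℕ → ℤ}
    (h : ∀ l < k, TriCol k Λ N l) {z : ℕ → ℤ} (hz : z ∈ Λ) :
    ∃ y : ℕ → ℤ, ∀ f < k, z f = ∑ l ∈ Finset.range k, N f l * y l := by
  -- Induction on the number `j` of leading entries that may be non-zero: a multiple of the column
  -- `j` clears the last of them.
  have key : ∀ j ≤ k, ∀ z ∈ Λ, (∀ f < k, j ≤ f → z f = 0) →
      ∃ y : ℕ → ℤ, ∀ f < k, z f = ∑ l ∈ Finset.range j, N f l * y l := by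
    intro j
    induction j with
    | zero =>
      intro _ z _ h0
      exact ⟨0, fun f hf => by simpa using h0 f hf (Nat.zero_le _)⟩
    | succ j ih =>
      intro hj z hz h0
      have hc := h j (by omega)
      obtain ⟨q, hq⟩ := hc.dvd z hz fun f hf hjf => h0 f hf hjf
      obtain ⟨y, hy⟩ := ih (by omega) (z - q • fun f => N f j)
        (Λ.sub_mem hz (Λ.zsmul_mem hc.mem q)) (by
          intro f hf hjf
          rcases hjf.eq_or_lt with rfl | hjf
          · simp [hq, mul_comm]
          · simp [h0 f hf hjf, hc.upper f hf hjf])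
      refine ⟨Function.update y j q, fun f hf => ?_⟩
      rw [Finset.sum_range_succ, Function.update_self]
      have := hy f hf
      simp only [Pi.sub_apply, Pi.smul_apply, smul_eq_mul] at this
      rw [sub_eq_iff_eq_add] at this
      rw [this, mul_comm q]
      congr 1
      refine Finset.sum_congr rfl fun l hl => ?_
      rw [Function.update_of_ne (Finset.mem_range.mp hl).ne]
  exact key k le_rfl z hz fun f hf hkf => absurd hf (by omega)

theorem sum_mem_of_triCol {Λ : AddSubgroup (ℕ → ℤ)} {N : ℕ → ℕ → ℤ}
    (h : ∀ l < k, TriCol k Λ N l) (y : ℕ → ℤ) :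
    (fun f => ∑ l ∈ Finset.range k, N f l * y l) ∈ Λ := by
  have : (fun f => ∑ l ∈ Finset.range k, N f l * y l) =
      ∑ l ∈ Finset.range k, y l • fun f => N f l := by
    ext f
    simp [mul_comm]
  rw [this]
  exact Λ.sum_mem fun l hl => Λ.zsmul_mem (h l (Finset.mem_range.mp hl)).mem _

/-- `D` times the unit vector `l` belongs to `Λ`, so the diagonal entry divides `D`. -/
theorem TriCol.diag_le {Λ : AddSubgroup (ℕ → ℤ)} {N : ℕ → ℕ → ℤ} {l : ℕ} (h : TriCol k Λ N l)
    (hD : 0 < D) (hΛ : ∀ z w : ℕ → ℤ, (∀ f < k, w f ≡ z f [ZMOD D]) → z ∈ Λ → w ∈ Λ) :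
    N l l ≤ D := by
  have hmem : Pi.single l D ∈ Λ := by
    refine hΛ 0 _ (fun f _ => ?_) Λ.zero_mem
    by_cases hf : f = l
    · subst hf
      simp [Int.ModEq]
    · simp [hf, Int.ModEq]
  have := h.dvd _ hmem fun f _ hf => by simp [hf.ne']
  rw [Pi.single_eq_same] at this
  exact Int.le_of_dvd hD this

/-- A new congruence with coefficients `a` is being added to those defining `Λ`, and the first `l`
columns of the triangular basis have been updated.  The vector `u` attains the greatest common divisor
`g` of `D` and all the values of `a` on the span of the first `l` columns. -/
structure ColState (k : ℕ) (D : ℤ) (Λ : AddSubgroup (ℕ → ℤ)) (Λ' : AddSubgroup (ℕ → ℤ))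
    (a : ℕ → ℤ) (l : ℕ) (N : ℕ → ℕ → ℤ) (u : ℕ → ℤ) (g : ℤ) : Prop where
  new : ∀ l' < l, TriCol k Λ' N l'
  old : ∀ l' < k, l ≤ l' → TriCol k Λ N l'
  u_mem : u ∈ Λ
  u_supp : ∀ f < k, l ≤ f → u f = 0
  u_dot : dotK k a u ≡ g [ZMOD D]
  g_pos : 0 < g
  g_dvd : g ∣ D
  g_min : ∀ z ∈ Λ, (∀ f < k, l ≤ f → z f = 0) → g ∣ dotK k a z
  N_bdd : ∀ f < k, ∀ l' < k, f ≠ l' → |N f l'| ≤ D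

theorem TriCol.congr {Λ : AddSubgroup (ℕ → ℤ)} {N N' : ℕ → ℕ → ℤ} {l : ℕ} (h : TriCol k Λ N l)
    (hl : l < k) (hΛ : ∀ z w : ℕ → ℤ, (∀ f < k, w f ≡ z f [ZMOD D]) → z ∈ Λ → w ∈ Λ)
    (hN : ∀ f < k, N' f l = N f l) : TriCol k Λ N' l where
  mem := hΛ _ _ (fun f hf => by rw [hN f hf]) h.mem
  upper f hf hlf := by rw [hN f hf, h.upper f hf hlf]
  pos := by rw [hN l hl]; exact h.pos
  dvd z hz h0 := by rw [hN l hl]; exact h.dvd z hz h0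

/-- On the zero space the only value of `a` is `0`, so the gcd with `D` is `D` itself; it is
attained modulo `D` by the zero vector. -/
theorem ColState.init {Λ Λ' : AddSubgroup (ℕ → ℤ)} {N : ℕ → ℕ → ℤ} {u : ℕ → ℤ} (a : ℕ → ℤ)
    (hD : 0 < D) (h : ∀ l < k, TriCol k Λ N l)
    (hN : ∀ f < k, ∀ l' < k, f ≠ l' → |N f l'| ≤ D)
    (hΛ : ∀ z w : ℕ → ℤ, (∀ f < k, w f ≡ z f [ZMOD D]) → z ∈ Λ → w ∈ Λ)
    (hu : ∀ f < k, u f = 0) : ColState k D Λ Λ' a 0 N u D where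
  new _ h := absurd h (by omega)
  old l' hl' _ := h l' hl'
  u_mem := hΛ 0 _ (fun f hf => by simp [hu f hf, Int.ModEq]) Λ.zero_mem
  u_supp f hf _ := hu f hf
  u_dot := (dotK_modEq a (w := 0) fun f hf => by simp [hu f hf, Int.ModEq]).trans
    (by simp [dotK, Int.ModEq])
  g_pos := hD
  g_dvd := dvd_rfl
  g_min z _ h0 := by
    rw [dotK, Finset.sum_eq_zero]
    · exact dvd_zero _
    · intro f hf
      rw [h0 f (Finset.mem_range.mp hf) (Nat.zero_le _), mul_zero]
  N_bdd := hN

theorem abs_emod_le {D : ℤ} (hD : 0 < D) (x : ℤ) : |x % D| ≤ D := by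
  rw [abs_of_nonneg (Int.emod_nonneg _ hD.ne')]
  exact (Int.emod_lt_of_pos _ hD).le

/-- Let `c` be the value of `a` on the column `l` modulo `D`, and `r = gcd g c`. The vector `(g / r)
N_l - (c / r) u` has value `0` modulo `D`, so it lies in `Λ'`, while `α u + β N_l` attains the new
gcd `r`. The factor `g / r` is the least possible: if a vector of `Λ'` supported on the first `l +
1` entries has last entry `y * N l l`, then `g` divides `y * c`, so `g / r` divides `y` by
coprimality. Since `u` vanishes from `l` on, the diagonal is not affected by `u`; it must not be
reduced modulo `D`, because it has to remain positive. -/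
theorem ColState.step {Λ Λ' : AddSubgroup (ℕ → ℤ)} {N N' : ℕ → ℕ → ℤ} {u u' a : ℕ → ℤ}
    {l : ℕ} {g c r α β : ℤ} (h : ColState k D Λ Λ' a l N u g) (hl : l < k) (hD : 0 < D)
    (hΛ : ∀ z w : ℕ → ℤ, (∀ f < k, w f ≡ z f [ZMOD D]) → z ∈ Λ → w ∈ Λ)
    (hΛ' : ∀ z, z ∈ Λ' ↔ D ∣ dotK k a z ∧ z ∈ Λ)
    (hc : c ≡ dotK k a (fun f => N f l) [ZMOD D])
    (hr : r = Int.gcd g c) (hαβ : α * g + β * c ≡ r [ZMOD D])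
    (hN' : ∀ f < k, ∀ l' < k, l' ≠ l → N' f l' = N f l')
    (hdiag : N' l l = g / r * N l l)
    (hoff : ∀ f < k, f ≠ l → N' f l = (g / r * N f l - c / r * u f) % D)
    (hu' : ∀ f < k, u' f = (α * u f + β * N f l) % D) :
    ColState k D Λ Λ' a (l + 1) N' u' r := by
  have hcol := h.old l hl le_rfl
  have hrg : r ∣ g := hr ▸ Int.gcd_dvd_left ..
  have hrc : r ∣ c := hr ▸ Int.gcd_dvd_right ..
  have hrpos : 0 < r := by
    rw [hr]
    exact_mod_cast Int.gcd_pos_of_ne_zero_left _ h.g_pos.ne'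
  have hΛ'2 : ∀ z w : ℕ → ℤ, (∀ f < k, w f ≡ z f [ZMOD D]) → z ∈ Λ' → w ∈ Λ' := by
    intro z w hzw hz
    rw [hΛ'] at hz ⊢
    exact ⟨Int.modEq_zero_iff_dvd.mp ((dotK_modEq a hzw).trans (Int.modEq_zero_iff_dvd.mpr hz.1)),
      hΛ z w hzw hz.2⟩
  obtain ⟨t, rfl⟩ := hrg
  obtain ⟨e, rfl⟩ := hrc
  rw [Int.mul_ediv_cancel_left _ hrpos.ne'] at hdiag hoff
  simp only [Int.mul_ediv_cancel_left _ hrpos.ne'] at hoff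
  have htpos : 0 < t := pos_of_mul_pos_right h.g_pos hrpos.le
  have hcop : IsCoprime t e := by
    rw [Int.isCoprime_iff_gcd_eq_one]
    rw [Int.gcd_mul_left] at hr
    have h1 : ((r.natAbs * Int.gcd t e : ℕ) : ℤ) = r * Int.gcd t e := by
      push_cast
      rw [abs_of_pos hrpos]
    rw [h1] at hr
    have := mul_left_cancel₀ hrpos.ne' ((mul_one r).trans hr)
    exact_mod_cast this.symm
  have hnl : ∀ f < k, N' f l ≡ (t • (fun f => N f l) - e • u) f [ZMOD D] := by
    intro f hf
    by_cases hfl : f = l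
    · subst hfl
      simp [hdiag, h.u_supp f hf le_rfl]
    · rw [hoff f hf hfl]
      exact Int.mod_modEq _ _
  have hrD : r ∣ D := (dvd_mul_right r t).trans h.g_dvd
  refine ⟨?_, ?_, ?_, ?_, ?_, hrpos, hrD, ?_, ?_⟩
  · intro l' hl'
    rcases Nat.lt_succ_iff_lt_or_eq.mp hl' with hl' | rfl
    · exact (h.new l' hl').congr (by omega) hΛ'2 fun f hf => hN' f hf l' (by omega) hl'.ne
    · refine ⟨?_, ?_, ?_, ?_⟩
      · refine hΛ'2 _ _ hnl ((hΛ' _).mpr ⟨?_, Λ.sub_mem (Λ.zsmul_mem hcol.mem _)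
          (Λ.zsmul_mem h.u_mem _)⟩)
        rw [dotK_sub, dotK_smul, dotK_smul, ← Int.modEq_zero_iff_dvd]
        refine ((hc.symm.mul_left t).sub (h.u_dot.mul_left e)).trans ?_
        rw [show t * (r * e) - e * (r * t) = 0 by ring]
      · intro f hf hlf
        rw [hoff f hf hlf.ne', hcol.upper f hf hlf, h.u_supp f hf hlf.le]
        simp
      · rw [hdiag]
        exact mul_pos htpos hcol.pos
      · intro z hz h0
        rw [hΛ'] at hz
        obtain ⟨y, hy⟩ := hcol.dvd z hz.2 h0
        have h1 := h.g_min (z - y • fun f => N f l') (Λ.sub_mem hz.2 (Λ.zsmul_mem hcol.mem _)) (by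
          intro f hf hlf
          rcases hlf.eq_or_lt with rfl | hlf
          · simp [hy, mul_comm]
          · simp [h0 f hf hlf, hcol.upper f hf hlf])
        rw [dotK_sub, dotK_smul] at h1
        -- The gcd `g = r * t` divides `D`, which divides the value of `a` on `z`; it also divides
        -- the value on `z - y N_l` by minimality.
        have h2 : r * t ∣ y * dotK k a (fun f => N f l') := by
          have := dvd_sub (h.g_dvd.trans hz.1) h1
          rwa [sub_sub_cancel] at this
        have h3 : r * t ∣ y * (r * e) := by
          have h4 := h.g_dvd.trans (hc.mul_left y).dvd
          have := dvd_sub h2 h4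
          rwa [sub_sub_cancel] at this
        rw [mul_left_comm] at h3
        have h5 : t ∣ y := hcop.dvd_of_dvd_mul_right ((mul_dvd_mul_iff_left hrpos.ne').mp h3)
        rw [hdiag, hy, mul_comm t]
        exact mul_dvd_mul_left _ h5
  · intro l' hl'k hl'
    exact (h.old l' hl'k (by omega)).congr hl'k hΛ fun f hf => hN' f hf l' hl'k (by omega)
  · refine hΛ (α • u + β • fun f => N f l) _ (fun f hf => ?_)
      (Λ.add_mem (Λ.zsmul_mem h.u_mem _) (Λ.zsmul_mem hcol.mem _))
    rw [hu' f hf]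
    exact Int.mod_modEq _ _
  · intro f hf hlf
    rw [hu' f hf, h.u_supp f hf (by omega), hcol.upper f hf (by omega)]
    simp
  · refine (dotK_modEq a (w := α • u + β • fun f => N f l) fun f hf => ?_).trans ?_
    · rw [hu' f hf]
      exact Int.mod_modEq _ _
    · rw [dotK_add, dotK_smul, dotK_smul]
      exact ((h.u_dot.mul_left α).add (hc.symm.mul_left β)).trans hαβ
  · intro z hz h0
    obtain ⟨y, hy⟩ := hcol.dvd z hz h0
    have h1 := h.g_min (z - y • fun f => N f l) (Λ.sub_mem hz (Λ.zsmul_mem hcol.mem _)) (by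
      intro f hf hlf
      rcases hlf.eq_or_lt with rfl | hlf
      · simp [hy, mul_comm]
      · simp [h0 f hf hlf, hcol.upper f hf hlf])
    rw [dotK_sub, dotK_smul] at h1
    have h2 : r ∣ dotK k a (fun f => N f l) := by
      have := dvd_add (hrD.trans hc.dvd) (dvd_mul_right r e)
      rwa [sub_add_cancel] at this
    have := dvd_add ((dvd_mul_right r t).trans h1) (h2.mul_left y)
    rwa [sub_add_cancel] at this
  · intro f hf l' hl' hfl'
    by_cases hll : l' = l
    · subst hll
      rw [hoff f hf hfl']
      exact abs_emod_le hD _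
    · rw [hN' f hf l' hl' hll]
      exact h.N_bdd f hf l' hl' hfl'

/-- The state after the congruences with index in `S` have been taken into account: `N` is a basis of
the lattice of the homogeneous system, and `z` is a solution unless there is none. -/
structure CongState (k : ℕ) (D : ℤ) (a : ℕ → ℕ → ℤ) (b : ℕ → ℤ) (S : Set ℕ) (N : ℕ → ℕ → ℤ)
    (z : ℕ → ℤ) (ok : Prop) : Prop where
  basis : ∀ l < k, TriCol k (congLat k D a S) N l
  N_bdd : ∀ f < k, ∀ l < k, f ≠ l → |N f l| ≤ D
  z_bdd : ∀ f < k, |z f| ≤ D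
  sol : ok → ∀ i ∈ S, dotK k (a i) z ≡ b i [ZMOD D]
  no_sol : ¬ ok → ¬ ∃ w : ℕ → ℤ, ∀ i ∈ S, dotK k (a i) w ≡ b i [ZMOD D]

variable {a : ℕ → ℕ → ℤ} {b : ℕ → ℤ} {S : Set ℕ} {N N' : ℕ → ℕ → ℤ} {z z' u : ℕ → ℤ} {ok : Prop}
  {i : ℕ} {g : ℤ}

theorem CongState.init (hD : 0 < D) (hN : ∀ f < k, ∀ l < k, N f l = if f = l then 1 else 0)
    (hz : ∀ f < k, z f = 0) (hok : ok) : CongState k D a b ∅ N z ok where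
  basis l hl := by
    refine ⟨fun i hi => by simp at hi, fun f hf hlf => ?_, ?_, fun z _ _ => ?_⟩
    · rw [hN f hf l hl, if_neg hlf.ne']
    · rw [hN l hl l hl, if_pos rfl]
      exact one_pos
    · rw [hN l hl l hl, if_pos rfl]
      exact one_dvd _
  N_bdd f hf l hl hfl := by
    rw [hN f hf l hl, if_neg hfl, abs_zero]
    exact hD.le
  z_bdd f hf := by
    rw [hz f hf, abs_zero]
    exact hD.le
  sol _ i hi := by simp at hi
  no_sol h := absurd hok h

/-- Adding a multiple of `u` does not disturb the old congruences, because `u` lies in the old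
lattice. Since `a i` takes the value `g` on `u` modulo `D`, the multiple needed for the new
congruence is the defect divided by `g`. -/
theorem CongState.step_ok (h : CongState k D a b S N z ok)
    (h' : ColState k D (congLat k D a S) (congLat k D a (insert i S)) (a i) k N' u g) (hD : 0 < D)
    (hg : g ∣ b i - dotK k (a i) z)
    (hz' : ∀ f < k, z' f = (z f + (b i - dotK k (a i) z) / g * u f) % D) :
    CongState k D a b (insert i S) N' z' ok where
  basis := h'.new
  N_bdd := h'.N_bdd
  z_bdd f hf := by
    rw [hz' f hf]
    exact abs_emod_le hD _
  sol hok j hj := by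
    obtain ⟨e, he⟩ := hg
    rw [he, Int.mul_ediv_cancel_left _ h'.g_pos.ne'] at hz'
    have h1 : dotK k (a j) z' ≡ dotK k (a j) z + e * dotK k (a j) u [ZMOD D] := by
      rw [← dotK_smul, ← dotK_add]
      refine dotK_modEq _ fun f hf => ?_
      rw [hz' f hf]
      exact Int.mod_modEq _ _
    refine h1.trans ?_
    rcases hj with rfl | hj
    · have := (h'.u_dot.mul_left e).add_left (dotK k (a j) z)
      rwa [mul_comm e g, ← he, add_sub_cancel] at this
    · have := ((Int.modEq_zero_iff_dvd.mpr (h'.u_mem j hj)).mul_left e).add (h.sol hok j hj)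
      rwa [mul_zero, zero_add, add_comm] at this
  no_sol hok := fun ⟨w, hw⟩ => h.no_sol hok ⟨w, fun j hj => hw j (Or.inr hj)⟩

/-- If `w` solved all the congruences and `z` the old ones, then `w - z` would be in the old
lattice. So `g` would divide the value of `a i` on it, which is the defect modulo `D`, and `g`
divides `D`. -/
theorem CongState.step_fail {ok' : Prop} (h : CongState k D a b S N z ok)
    (h' : ColState k D (congLat k D a S) (congLat k D a (insert i S)) (a i) k N' u g)
    (hg : ¬ g ∣ b i - dotK k (a i) z) (hok' : ¬ ok') :
    CongState k D a b (insert i S) N' z ok' where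
  basis := h'.new
  N_bdd := h'.N_bdd
  z_bdd := h.z_bdd
  sol h := absurd h hok'
  no_sol _ := fun ⟨w, hw⟩ => by
    by_cases hok : ok
    · refine hg ?_
      have h1 : g ∣ dotK k (a i) (w - z) := by
        refine h'.g_min _ (fun j hj => ?_) fun f hf hkf => absurd hf (by omega)
        rw [dotK_sub]
        exact ((h.sol hok j hj).trans (hw j (Or.inr hj)).symm).dvd
      rw [dotK_sub] at h1
      have h2 := h'.g_dvd.trans (hw i (Or.inl rfl)).dvd
      have := dvd_add h1 h2
      rwa [show dotK k (a i) w - dotK k (a i) z + (b i - dotK k (a i) w) =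
        b i - dotK k (a i) z by ring] at this
    · exact h.no_sol hok ⟨w, fun j hj => hw j (Or.inr hj)⟩

end Congruences

/-! ### Solutions in terms of the free variables -/

section FreeVariables

/-- The columns `j < n` without a pivot are `fr 0 < … < fr (k - 1)`, those less than `p` are the
first `k₁` ones, and `pos` is the inverse of `fr`. -/
structure FreeEnum (n p : ℕ) (cp : ℕ → ℕ) (k k₁ : ℕ) (fr pos : ℕ → ℕ) : Prop where
  fr_lt : ∀ f < k, fr f < n
  cp_fr : ∀ f < k, cp (fr f) = 0
  pos_lt : ∀ j < n, cp j = 0 → pos j < k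
  fr_pos : ∀ j < n, cp j = 0 → fr (pos j) = j
  pos_fr : ∀ f < k, pos (fr f) = f
  lt_iff : ∀ f < k, fr f < p ↔ f < k₁
  le : k₁ ≤ k
  eq_of_le : n ≤ p → k₁ = k

namespace FreeEnum

variable {n p k k₁ : ℕ} {cp fr pos : ℕ → ℕ}

theorem init (p : ℕ) (cp fr pos : ℕ → ℕ) : FreeEnum 0 p cp 0 0 fr pos :=
  ⟨by simp, by simp, by simp, by simp, by simp, by simp, le_rfl, fun _ => rfl⟩

theorem skip (h : FreeEnum n p cp k k₁ fr pos) (hn : cp n ≠ 0) :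
    FreeEnum (n + 1) p cp k k₁ fr pos where
  fr_lt f hf := (h.fr_lt f hf).trans (Nat.lt_succ_self n)
  cp_fr := h.cp_fr
  pos_lt j hj hc := h.pos_lt j (by
    rcases Nat.lt_succ_iff_lt_or_eq.mp hj with hj | rfl
    · exact hj
    · exact absurd hc hn) hc
  fr_pos j hj hc := h.fr_pos j (by
    rcases Nat.lt_succ_iff_lt_or_eq.mp hj with hj | rfl
    · exact hj
    · exact absurd hc hn) hc
  pos_fr := h.pos_fr
  lt_iff := h.lt_iff
  le := h.le
  eq_of_le hp := h.eq_of_le (by omega)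

/-- The field `eq_of_le` is needed here: as long as only integer columns have been seen, every free
column found is an integer one, so a new integer column gets the number `k₁ = k`. -/
theorem push (h : FreeEnum n p cp k k₁ fr pos) (hn : cp n = 0) :
    FreeEnum (n + 1) p cp (k + 1) (if n < p then k₁ + 1 else k₁) (Function.update fr k n)
      (Function.update pos n k) := by
  have hle := h.le
  refine ⟨?_, ?_, ?_, ?_, ?_, ?_, ?_, ?_⟩
  · intro f hf
    rcases Nat.lt_succ_iff_lt_or_eq.mp hf with hf | rfl
    · rw [Function.update_of_ne hf.ne]
      exact (h.fr_lt f hf).trans (Nat.lt_succ_self n)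
    · simp
  · intro f hf
    rcases Nat.lt_succ_iff_lt_or_eq.mp hf with hf | rfl
    · rw [Function.update_of_ne hf.ne]
      exact h.cp_fr f hf
    · simpa using hn
  · intro j hj hc
    rcases Nat.lt_succ_iff_lt_or_eq.mp hj with hj | rfl
    · rw [Function.update_of_ne hj.ne]
      exact (h.pos_lt j hj hc).trans (Nat.lt_succ_self k)
    · simp
  · intro j hj hc
    rcases Nat.lt_succ_iff_lt_or_eq.mp hj with hj | rfl
    · rw [Function.update_of_ne hj.ne, Function.update_of_ne (h.pos_lt j hj hc).ne]
      exact h.fr_pos j hj hc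
    · simp
  · intro f hf
    rcases Nat.lt_succ_iff_lt_or_eq.mp hf with hf | rfl
    · rw [Function.update_of_ne hf.ne, Function.update_of_ne (h.fr_lt f hf).ne]
      exact h.pos_fr f hf
    · simp
  · intro f hf
    rcases Nat.lt_succ_iff_lt_or_eq.mp hf with hf | rfl
    · rw [Function.update_of_ne hf.ne, h.lt_iff f hf]
      split_ifs with hp
      · have := h.eq_of_le hp.le
        omega
      · rfl
    · rw [Function.update_self]
      split_ifs with hp
      · have := h.eq_of_le hp.le
        omega
      · omega
  · split_ifs <;> omega
  · intro hp
    rw [if_pos (by omega), h.eq_of_le (by omega)]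

variable {K : Type*} [Field K]

theorem sum_range (h : FreeEnum n p cp k k₁ fr pos) (c : ℕ → K) :
    ∑ l ∈ Finset.range n, c l = (∑ l ∈ Finset.range n with cp l ≠ 0, c l) +
      ∑ f ∈ Finset.range k, c (fr f) := by
  rw [← Finset.sum_filter_not_add_sum_filter (Finset.range n) (fun l => cp l = 0)]
  congr 1
  symm
  refine Finset.sum_bij' (fun f _ => fr f) (fun j _ => pos j) ?_ ?_ ?_ ?_ ?_
  · intro f hf
    rw [Finset.mem_range] at hf
    simp [h.fr_lt f hf, h.cp_fr f hf]
  · intro j hj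
    simp only [Finset.mem_filter, Finset.mem_range] at hj
    exact Finset.mem_range.mpr (h.pos_lt j hj.1 hj.2)
  · intro f hf
    exact h.pos_fr f (Finset.mem_range.mp hf)
  · intro j hj
    simp only [Finset.mem_filter, Finset.mem_range] at hj
    exact h.fr_pos j hj.1 hj.2
  · intro f _
    rfl

end FreeEnum

/-- The solution of the tableau `T` with right hand side multiplied by `ρ`, for given values `y` of
the free variables. -/
def complete {K : Type*} [Field K] (T : ℕ → ℕ → ℤ) (d : ℤ) (n k : ℕ) (cp fr pos : ℕ → ℕ)
    (y : ℕ → K) (ρ : K) (j : ℕ) : K :=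
  if cp j = 0 then y (pos j)
  else (ρ * (T (cp j - 1) n : K) - ∑ f ∈ Finset.range k, (T (cp j - 1) (fr f) : K) * y f) / d

variable {m n p k k₁ : ℕ} {A : ℕ → ℕ → ℤ} {rp cp fr pos : ℕ → ℕ}

theorem ElimState.cp_eq (h : ElimState m n A rp cp 0 0) {j : ℕ} (hj : j < n) (hc : cp j ≠ 0) :
    cp j - 1 < m ∧ rp (cp j - 1) = j + 1 := by
  rcases h.cp_spec j hj with ⟨h1, -⟩ | ⟨r, hr, h1, h2⟩
  · exact absurd h1 hc
  · rw [h1, Nat.add_sub_cancel]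
    exact ⟨hr, h2⟩

/-- Two rows cannot share a pivot column: the tableau entry would be both `0` and the determinant.
-/
theorem ElimState.cp_of_rp (h : ElimState m n A rp cp 0 0) {i q : ℕ} (hi : i < m)
    (hq : rp i = q + 1) : q < n ∧ cp q = i + 1 := by
  have hqn : q < n := by have := h.rp_le i hi; omega
  refine ⟨hqn, ?_⟩
  rcases h.cp_spec q hqn with ⟨-, h2⟩ | ⟨r, hr, h1, h2⟩
  · exact absurd hq (h2 i hi)
  · by_contra hne
    have hri : i ≠ r := fun hh => hne (by rw [hh, h1])
    have := red_pivot_ne (A := A) hr h2 hri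
    rw [red_pivot_self hi hq] at this
    exact h.det_ne this

section Complete

variable {K : Type*} [Field K]

theorem complete_congr {T : ℕ → ℕ → ℤ} {d : ℤ} (hfe : FreeEnum n p cp k k₁ fr pos)
    {y y' : ℕ → K} (hy : ∀ f < k, y f = y' f) (ρ : K) {j : ℕ} (hj : j < n) :
    complete T d n k cp fr pos y ρ j = complete T d n k cp fr pos y' ρ j := by
  rw [complete, complete]
  split_ifs with h
  · exact hy _ (hfe.pos_lt j hj h)
  · congr 2
    refine Finset.sum_congr rfl fun f hf => ?_
    rw [hy f (Finset.mem_range.mp hf)]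

theorem complete_fr {T : ℕ → ℕ → ℤ} {d : ℤ} (hfe : FreeEnum n p cp k k₁ fr pos) (y : ℕ → K)
    (ρ : K) {f : ℕ} (hf : f < k) : complete T d n k cp fr pos y ρ (fr f) = y f := by
  rw [complete, if_pos (hfe.cp_fr f hf), hfe.pos_fr f hf]

/-- `complete` is linear in the pair of free values and `ρ`. So one particular solution (`ρ = 1`)
and homogeneous ones (`ρ = 0`) can be computed by the same rule and combined afterwards. -/
theorem complete_add_sum (T : ℕ → ℕ → ℤ) (d : ℤ) (y : ℕ → K) (N : ℕ → ℕ → K) (c : ℕ → K) (ρ : K)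
    (k' j : ℕ) :
    complete T d n k cp fr pos y ρ j +
        ∑ l ∈ Finset.range k', complete T d n k cp fr pos (fun f => N f l) 0 j * c l =
      complete T d n k cp fr pos (fun f => y f + ∑ l ∈ Finset.range k', N f l * c l) ρ j := by
  by_cases h : cp j = 0
  · simp [complete, h]
  · simp only [complete, if_neg h, zero_mul, zero_sub]
    have : ∀ l, -(∑ f ∈ Finset.range k, (T (cp j - 1) (fr f) : K) * N f l) / (d : K) * c l =
        -(∑ f ∈ Finset.range k, (T (cp j - 1) (fr f) : K) * (N f l * c l)) / d := by
      intro l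
      rw [div_mul_eq_mul_div, neg_mul, Finset.sum_mul]
      simp only [mul_assoc]
    rw [Finset.sum_congr rfl fun l _ => this l, ← Finset.sum_div, ← add_div,
      Finset.sum_neg_distrib, Finset.sum_comm]
    simp only [mul_add, Finset.sum_add_distrib, Finset.mul_sum]
    ring

/-- Used to pass from the rational data written by the program to real points. -/
theorem complete_cast {L : Type*} [Field L] (g : K →+* L) (T : ℕ → ℕ → ℤ) (d : ℤ) (y : ℕ → K)
    (ρ : K) (j : ℕ) : g (complete T d n k cp fr pos y ρ j) =
      complete T d n k cp fr pos (fun f => g (y f)) (g ρ) j := by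
  rw [complete, complete]
  split_ifs with h
  · rfl
  · simp

theorem ElimState.sum_pivot (h : ElimState m n A rp cp 0 0) (hfe : FreeEnum n p cp k k₁ fr pos)
    {i q : ℕ} (hi : i < m) (hq : rp i = q + 1) (x : ℕ → K) :
    ∑ l ∈ Finset.range n, (red m A rp i l : K) * x l = (pivDet m A rp : K) * x q +
      ∑ f ∈ Finset.range k, (red m A rp i (fr f) : K) * x (fr f) := by
  obtain ⟨hqn, hcq⟩ := h.cp_of_rp hi hq
  rw [hfe.sum_range]
  congr 1
  rw [Finset.sum_eq_single q]
  · rw [red_pivot_self hi hq]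
  · intro l hl hlq
    simp only [Finset.mem_filter, Finset.mem_range] at hl
    rcases h.cp_spec l hl.1 with ⟨h1, -⟩ | ⟨r, hr, h1, h2⟩
    · exact absurd h1 hl.2
    · have hri : i ≠ r := fun hh => hlq (by rw [← hh, hq] at h2; omega)
      rw [red_pivot_ne hr h2 hri, Int.cast_zero, zero_mul]
  · intro hh
    simp [hqn, hcq] at hh

/-- The solutions are obtained by choosing values for the free variables. -/
theorem ElimState.solution_iff [CharZero K] (h : ElimState m n A rp cp 0 0)
    (hfe : FreeEnum n p cp k k₁ fr pos) (x : ℕ → K) (ρ : K) :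
    (∀ i < m, ∑ l ∈ Finset.range n, (A i l : K) * x l = ρ * A i n) ↔
      (∀ i < m, rp i = 0 → ρ * (red m A rp i n : K) = 0) ∧
      ∀ j < n, x j =
        complete (red m A rp) (pivDet m A rp) n k cp fr pos (fun f => x (fr f)) ρ j := by
  have hd : (pivDet m A rp : K) ≠ 0 := by exact_mod_cast h.det_ne
  -- The right hand side is treated as the column `n` of a homogeneous system, with the variable of
  -- that column set to `-ρ`.
  have h1 := red_system_iff (K := K) (m := m) (A := A) h.det_ne (n + 1) (Function.update x n (-ρ))
  have h2 : ∀ c : ℕ → K, ∑ l ∈ Finset.range (n + 1), c l * Function.update x n (-ρ) l = 0 ↔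
      ∑ l ∈ Finset.range n, c l * x l = ρ * c n := by
    intro c
    rw [Finset.sum_range_succ, Function.update_self, Finset.sum_congr rfl (g := fun l => c l * x l),
      mul_neg, mul_comm, ← sub_eq_add_neg, sub_eq_zero]
    intro l hl
    rw [Function.update_of_ne (Finset.mem_range.mp hl).ne]
  simp only [h2 fun l => (red m A rp _ l : K), h2 fun l => (A _ l : K)] at h1
  rw [← h1]
  constructor
  · intro hs
    refine ⟨fun i hi h0 => ?_, fun j hj => ?_⟩
    · rw [← hs i hi, Finset.sum_eq_zero]
      intro l hl
      rw [h.zero i hi h0 l (Nat.zero_le _) (Finset.mem_range.mp hl), Int.cast_zero, zero_mul]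
    · rw [complete]
      split_ifs with hc
      · rw [hfe.fr_pos j hj hc]
      · obtain ⟨hi, hrp⟩ := h.cp_eq hj hc
        rw [eq_div_iff hd, ← hs _ hi, h.sum_pivot hfe hi hrp]
        ring
  · rintro ⟨hz, hx⟩ i hi
    rcases hrp : rp i with _ | q
    · rw [hz i hi hrp, Finset.sum_eq_zero]
      intro l hl
      rw [h.zero i hi hrp l (Nat.zero_le _) (Finset.mem_range.mp hl), Int.cast_zero, zero_mul]
    · obtain ⟨hqn, hcq⟩ := h.cp_of_rp hi hrp
      have := hx q hqn
      rw [complete, if_neg (by omega), eq_div_iff hd, hcq, Nat.add_sub_cancel] at this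
      rw [h.sum_pivot hfe hi hrp, mul_comm, this]
      ring

end Complete

end FreeVariables

/-! ### The solution set of a mixed integer system -/

namespace MixedSystem

variable {I : MixedSystem} {A : ℕ → ℕ → ℤ} {Q : ℤ}

/-- The integers `A i j` are the coefficients of the system `I`, multiplied by `Q`; the right hand
side is in the column `n`. -/
structure IsScaled (I : MixedSystem) (A : ℕ → ℕ → ℤ) (Q : ℤ) : Prop where
  ne_zero : Q ≠ 0
  coeff : ∀ (i : Fin I.m) (j : Fin I.n), (A i j : ℚ) = Q * I.W i j
  rhs : ∀ i : Fin I.m, (A i I.n : ℚ) = Q * I.w i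

/-- The parameter `ρ` covers the system itself (`ρ = 1`) and its homogeneous version (`ρ = 0`) at
once. -/
theorem IsScaled.iff {K : Type*} [Field K] [CharZero K] (h : I.IsScaled A Q) (x : ℕ → K) (ρ : K) :
    (∀ i < I.m, ∑ l ∈ Finset.range I.n, (A i l : K) * x l = ρ * A i I.n) ↔
      ∀ i : Fin I.m, ∑ j : Fin I.n, (I.W i j : K) * x j = ρ * I.w i := by
  have hQ : (Q : K) ≠ 0 := by exact_mod_cast h.ne_zero
  have h1 : ∀ (i : Fin I.m) (j : Fin I.n), (A i j : K) = Q * I.W i j := fun i j => by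
    exact_mod_cast congrArg (Rat.cast (K := K)) (h.coeff i j)
  have h2 : ∀ i : Fin I.m, (A i I.n : K) = Q * I.w i := fun i => by
    exact_mod_cast congrArg (Rat.cast (K := K)) (h.rhs i)
  constructor
  · intro hs i
    have := hs i i.2
    rw [Finset.sum_range, h2, Finset.sum_congr rfl fun j _ => by rw [h1 i j, mul_assoc],
      ← Finset.mul_sum, mul_left_comm] at this
    exact mul_left_cancel₀ hQ this
  · intro hs i hi
    rw [Finset.sum_range, h2 ⟨i, hi⟩, Finset.sum_congr rfl fun j _ => by rw [h1 ⟨i, hi⟩ j, mul_assoc],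
      ← Finset.mul_sum, hs ⟨i, hi⟩, mul_left_comm]

/-- Extension of a vector by zeros. -/
def extend {K : Type*} [Zero K] {n : ℕ} (x : Fin n → K) (j : ℕ) : K :=
  if h : j < n then x ⟨j, h⟩ else 0

@[simp] theorem extend_coe {K : Type*} [Zero K] {n : ℕ} (x : Fin n → K) (j : Fin n) :
    extend x j = x j := dif_pos j.2

theorem extend_lt {K : Type*} [Zero K] {n : ℕ} (x : Fin n → K) {j : ℕ} (h : j < n) :
    extend x j = x ⟨j, h⟩ := dif_pos h

/-- The data produced by the elimination. -/
structure Tableau (I : MixedSystem) (A : ℕ → ℕ → ℤ) (Q : ℤ) (rp cp : ℕ → ℕ) (k k₁ : ℕ)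
    (fr pos : ℕ → ℕ) : Prop where
  scaled : I.IsScaled A Q
  elim : ElimState I.m I.n A rp cp 0 0
  free : FreeEnum I.n I.p cp k k₁ fr pos

variable {rp cp fr pos : ℕ → ℕ} {k k₁ : ℕ}

/-- The solution with right hand side multiplied by `ρ` for the values `y` of the free variables. -/
noncomputable def solve (I : MixedSystem) (A : ℕ → ℕ → ℤ) (rp cp : ℕ → ℕ) (k : ℕ) (fr pos : ℕ → ℕ)
    {K : Type*} [Field K] (y : ℕ → K) (ρ : K) (j : ℕ) : K :=
  complete (red I.m A rp) (pivDet I.m A rp) I.n k cp fr pos y ρ j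

/-- Extension of a vector of values of the continuous variables by zeros. -/
def extendB {K : Type*} [Zero K] (y : {j : Fin I.n // I.p ≤ (j : ℕ)} → K) (j : Fin I.n) : K :=
  if hj : I.p ≤ (j : ℕ) then y ⟨j, hj⟩ else 0

theorem B_mulVec (y : {j : Fin I.n // I.p ≤ (j : ℕ)} → ℚ) (i : Fin I.m) :
    I.B.mulVec y i = ∑ j : Fin I.n, I.W i j * extendB y j := by
  have h1 : ∑ j ∈ Finset.univ.filter (fun j : Fin I.n => I.p ≤ (j : ℕ)), I.W i j * extendB y j =
      ∑ j : Fin I.n, I.W i j * extendB y j := by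
    refine Finset.sum_filter_of_ne fun j _ hj => ?_
    by_contra hlt
    exact hj (by rw [extendB, dif_neg hlt, mul_zero])
  rw [← h1]
  refine Eq.trans ?_ (Finset.sum_subtype (F := inferInstance)
    (p := fun j : Fin I.n => I.p ≤ (j : ℕ)) _ (by simp) _).symm
  change ∑ j : {j : Fin I.n // I.p ≤ (j : ℕ)}, I.W i j * y j = _
  refine Finset.sum_congr rfl fun j _ => ?_
  rw [extendB, dif_pos j.2]

/-- A non-trivial equation for the integer variables forces their number to drop. -/
theorem p'_le (I : MixedSystem) (hA : I.affineSet.Nonempty) (d : Fin I.n → ℝ) (β : ℝ) (hd : d ≠ 0)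
    (hd0 : ∀ j : Fin I.n, I.p ≤ (j : ℕ) → d j = 0)
    (hβ : ∀ x ∈ I.affineSet, ∑ j, d j * x j = β) : (I.p' : ℤ) ≤ (I.p : ℤ) - 1 := by
  obtain ⟨j₀, hj₀⟩ := Function.ne_iff.mp hd
  have hj₀p : (j₀ : ℕ) < I.p := by
    by_contra hlt
    exact hj₀ (hd0 j₀ (by omega))
  by_contra hcon
  have hrank : I.W.rank ≤ I.B.rank := by
    have := I.cast_p'
    omega
  -- The columns of `B` are columns of `W`, so the inequality of ranks forces equality of the spans.
  have hspan : Submodule.span ℚ (Set.range I.B.col) = Submodule.span ℚ (Set.range I.W.col) := by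
    refine Submodule.eq_of_le_of_finrank_le (Submodule.span_mono ?_) ?_
    · rintro _ ⟨j, rfl⟩
      exact ⟨j, rfl⟩
    · rwa [Matrix.rank_eq_finrank_span_cols, Matrix.rank_eq_finrank_span_cols] at hrank
  have hmem : I.W.col j₀ ∈ LinearMap.range I.B.mulVecLin := by
    rw [Matrix.range_mulVecLin, hspan]
    exact Submodule.subset_span ⟨j₀, rfl⟩
  obtain ⟨y, hy⟩ := hmem
  -- A vector in the kernel of `W` whose only non-zero integer coordinate is `-1`, at `j₀`.
  have hx : ∀ i, ∑ j, I.W i j * (extendB y j - (Pi.single j₀ 1 : Fin I.n → ℚ) j) = 0 := by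
    intro i
    simp only [mul_sub, Finset.sum_sub_distrib, ← B_mulVec, Pi.single_apply]
    have := congrFun hy i
    rw [Matrix.mulVecLin_apply] at this
    simp [this]
  obtain ⟨x₀, hx₀⟩ := hA
  let x : Fin I.n → ℝ := fun j => ((extendB y j - (Pi.single j₀ 1 : Fin I.n → ℚ) j : ℚ) : ℝ)
  have hx₁ : x₀ + x ∈ I.affineSet := by
    rw [affineSet, Set.mem_ofPred_eq] at hx₀ ⊢
    rw [Matrix.mulVec_add, hx₀]
    ext i
    have := congrArg (Rat.cast (K := ℝ)) (hx i)
    rw [Rat.cast_sum, Rat.cast_zero] at this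
    simp only [Rat.cast_mul] at this
    simp only [Pi.add_apply, Matrix.mulVec, dotProduct, Matrix.map_apply, x]
    rw [this, add_zero]
  -- Moving along this vector leaves `d` constant by assumption, but changes it by `-d j₀`, as `d`
  -- vanishes on the continuous coordinates.
  have h1 := (hβ _ hx₁).trans (hβ _ hx₀).symm
  simp only [Pi.add_apply, mul_add, Finset.sum_add_distrib, add_eq_left] at h1
  rw [Finset.sum_eq_single j₀] at h1
  · simp only [x, extendB, dif_neg (not_le.mpr hj₀p), Pi.single_eq_same] at h1
    refine hj₀ ?_
    simpa using h1
  · intro j _ hj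
    by_cases hjp : I.p ≤ (j : ℕ)
    · rw [hd0 j hjp, zero_mul]
    · simp [x, extendB, hjp, hj]
  · simp

/-! ### Counting the free variables by rank-nullity. -/

namespace Tableau

section

variable {K : Type*} [Field K]

theorem solution_iff [CharZero K] (h : I.Tableau A Q rp cp k k₁ fr pos) (x : Fin I.n → K) (ρ : K) :
    (∀ i : Fin I.m, ∑ j : Fin I.n, (I.W i j : K) * x j = ρ * I.w i) ↔
      (∀ i < I.m, rp i = 0 → ρ * (red I.m A rp i I.n : K) = 0) ∧
      ∀ j : Fin I.n, x j = I.solve A rp cp k fr pos (fun f => extend x (fr f)) ρ j := by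
  have h1 := h.scaled.iff (extend x) ρ
  simp only [extend_coe] at h1
  rw [← h1, h.elim.solution_iff h.free]
  refine and_congr_right fun _ => ⟨fun hx j => ?_, fun hx j hj => ?_⟩
  · rw [← extend_coe x j]
    exact hx j j.2
  · rw [extend_lt x hj]
    exact hx ⟨j, hj⟩

theorem solve_solution [CharZero K] (h : I.Tableau A Q rp cp k k₁ fr pos) (y : ℕ → K) (ρ : K)
    (hz : ∀ i < I.m, rp i = 0 → ρ * (red I.m A rp i I.n : K) = 0) (i : Fin I.m) :
    ∑ j : Fin I.n, (I.W i j : K) * I.solve A rp cp k fr pos y ρ j = ρ * I.w i := by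
  refine (h.solution_iff (fun j => I.solve A rp cp k fr pos y ρ j) ρ).mpr ⟨hz, fun j => ?_⟩ i
  refine complete_congr h.free (fun f hf => ?_) ρ j.2
  rw [extend_lt _ (h.free.fr_lt f hf)]
  exact (complete_fr h.free y ρ hf).symm

/-- A pivot in an integer column has only zeros to its right (`ech`), so free continuous variables
do not enter its row; the free integer variables are zero by assumption. -/
theorem solve_zero (h : I.Tableau A Q rp cp k k₁ fr pos) {y : ℕ → K}
    (hy : ∀ f < k₁, y f = 0) {j : ℕ} (hj : j < I.p) : I.solve A rp cp k fr pos y 0 j = 0 := by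
  have hjn : j < I.n := hj.trans_le I.p_le
  rw [solve, complete]
  split_ifs with hc
  · refine hy _ ((h.free.lt_iff _ (h.free.pos_lt j hjn hc)).mp ?_)
    rwa [h.free.fr_pos j hjn hc]
  · rw [Finset.sum_eq_zero, zero_mul, sub_zero, zero_div]
    intro f hf
    rw [Finset.mem_range] at hf
    by_cases hf1 : f < k₁
    · rw [hy f hf1, mul_zero]
    · have h1 := mt (h.free.lt_iff f hf).mp hf1
      obtain ⟨h2, h3⟩ := h.elim.cp_eq hjn hc
      rw [(h.elim.ech _ h2 j h3).2 _ (by omega) (h.free.fr_lt f hf), Int.cast_zero, zero_mul]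

end

/-- Restriction to the free coordinates is an isomorphism from the kernel of `W` onto `ℚ ^ k`. -/
theorem eq_n' (h : I.Tableau A Q rp cp k k₁ fr pos) : k = I.n' := by
  let φ : LinearMap.ker I.W.mulVecLin →ₗ[ℚ] (Fin k → ℚ) :=
    { toFun := fun x f => extend x.1 (fr f)
      map_add' := fun x y => by
        ext f
        simp [extend_lt _ (h.free.fr_lt f f.2)]
      map_smul' := fun c x => by
        ext f
        simp [extend_lt _ (h.free.fr_lt f f.2)] }
  have hker : ∀ x : Fin I.n → ℚ, x ∈ LinearMap.ker I.W.mulVecLin ↔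
      ∀ i : Fin I.m, ∑ j : Fin I.n, (I.W i j : ℚ) * x j = 0 * I.w i := by
    intro x
    simp [LinearMap.mem_ker, funext_iff, Matrix.mulVec, dotProduct]
  have hφ : Function.Bijective φ := by
    constructor
    · rw [← LinearMap.ker_eq_bot, LinearMap.ker_eq_bot']
      rintro ⟨x, hx⟩ h0
      have h1 := ((h.solution_iff x 0).mp ((by simpa using (hker x).mp hx))).2
      ext j
      refine (h1 j).trans ?_
      have h2 : ∀ f < k, extend x (fr f) = (fun _ => 0 : ℕ → ℚ) f := fun f hf =>
        congrFun h0 ⟨f, hf⟩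
      refine (complete_congr h.free h2 0 j.2).trans ?_
      simp [complete]
    · intro y
      refine ⟨⟨fun j => I.solve A rp cp k fr pos (extend y) 0 j, (hker _).mpr fun i => ?_⟩, ?_⟩
      · simpa using h.solve_solution (extend y) 0 (by simp) i
      · ext f
        simp only [φ, LinearMap.coe_mk, AddHom.coe_mk, extend_lt _ (h.free.fr_lt f f.2)]
        exact (complete_fr h.free _ 0 f.2).trans (extend_coe y f)
  have h1 := (LinearEquiv.ofBijective φ hφ).finrank_eq
  have h2 := LinearMap.finrank_range_add_finrank_ker I.W.mulVecLin
  rw [Module.finrank_fin_fun] at h1 h2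
  rw [n', Matrix.rank]
  omega

/-- The kernel of `B`, extended by zeros, consists of the kernel vectors of `W` without integer
part. By `solve_zero` these are the ones whose free integer coordinates vanish, so they are
parametrized by the `k - k₁` free continuous coordinates. -/
theorem sub_eq (h : I.Tableau A Q rp cp k k₁ fr pos) : k - k₁ + I.B.rank = I.n - I.p := by
  have hle := h.free.le
  have hge : ∀ f < k, k₁ ≤ f → I.p ≤ fr f := fun f hf hk => by
    have := mt (h.free.lt_iff f hf).mp (by omega)
    omega
  let c : Fin (k - k₁) → {j : Fin I.n // I.p ≤ (j : ℕ)} := fun f =>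
    ⟨⟨fr (k₁ + f), h.free.fr_lt _ (by omega)⟩, hge _ (by omega) (by omega)⟩
  let φ : LinearMap.ker I.B.mulVecLin →ₗ[ℚ] (Fin (k - k₁) → ℚ) :=
    { toFun := fun x f => x.1 (c f)
      map_add' := fun x y => rfl
      map_smul' := fun c x => rfl }
  have hker : ∀ y, y ∈ LinearMap.ker I.B.mulVecLin ↔
      ∀ i : Fin I.m, ∑ j : Fin I.n, (I.W i j : ℚ) * extendB y j = 0 * I.w i := by
    intro y
    simp [LinearMap.mem_ker, funext_iff, B_mulVec]
  have hφ : Function.Bijective φ := by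
    constructor
    · rw [← LinearMap.ker_eq_bot, LinearMap.ker_eq_bot']
      rintro ⟨y, hy⟩ h0
      have h1 := ((h.solution_iff (extendB y) 0).mp (by simpa using (hker y).mp hy)).2
      have h2 : ∀ f < k, extend (extendB y) (fr f) = (fun _ => 0 : ℕ → ℚ) f := by
        intro f hf
        rw [extend_lt _ (h.free.fr_lt f hf)]
        by_cases hk : k₁ ≤ f
        · have h3 := congrFun h0 ⟨f - k₁, by omega⟩
          simp only [φ, c, LinearMap.coe_mk, AddHom.coe_mk, Nat.add_sub_cancel' hk] at h3
          rw [extendB, dif_pos (hge f hf hk), h3]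
          rfl
        · have := (h.free.lt_iff f hf).mpr (by omega)
          exact dif_neg (by simpa using this)
      ext j
      have h4 := h1 j
      rw [extendB, dif_pos j.2] at h4
      refine h4.trans ((complete_congr h.free h2 0 j.1.2).trans ?_)
      simp [complete]
    · intro v
      let y : ℕ → ℚ := fun f => if k₁ ≤ f then extend v (f - k₁) else 0
      have hy : ∀ f < k₁, y f = 0 := fun f hf => if_neg (by omega)
      let x : Fin I.n → ℚ := fun j => I.solve A rp cp k fr pos y 0 j
      have hx : extendB (fun j => x j) = x := by
        ext j
        by_cases hj : I.p ≤ (j : ℕ)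
        · rw [extendB, dif_pos hj]
        · rw [extendB, dif_neg hj]
          exact (h.solve_zero hy (by omega)).symm
      refine ⟨⟨fun j => x j, (hker _).mpr fun i => ?_⟩, ?_⟩
      · rw [hx]
        exact h.solve_solution y 0 (by simp) i
      · ext f
        have hf := f.2
        refine (complete_fr h.free y 0 (by omega)).trans ?_
        simp [y]
  have h1 := (LinearEquiv.ofBijective φ hφ).finrank_eq
  have h2 := LinearMap.finrank_range_add_finrank_ker I.B.mulVecLin
  have h3 : Fintype.card {j : Fin I.n // I.p ≤ (j : ℕ)} = I.n - I.p := by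
    have h4 := Fintype.card_subtype_compl (fun j : Fin I.n => (j : ℕ) < I.p)
    have h5 : Fintype.card {j : Fin I.n // (j : ℕ) < I.p} = I.p := by
      rw [Fintype.card_subtype, Fin.card_filter_val_lt, min_eq_right I.p_le]
    simp only [not_lt, h5, Fintype.card_fin] at h4
    exact h4
  rw [Module.finrank_fin_fun] at h1
  rw [Module.finrank_fintype_fun_eq_card, h3] at h2
  rw [Matrix.rank]
  omega

theorem eq_p' (h : I.Tableau A Q rp cp k k₁ fr pos) : k₁ = I.p' := by
  have h1 := h.eq_n'
  have h2 := h.sub_eq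
  have h3 := h.free.le
  have h4 := I.p_le
  have h5 : I.W.rank ≤ I.n := by simpa using I.W.rank_le_width
  have h6 := I.rank_W_le
  rw [n'] at h1
  rw [p']
  omega

end Tableau

end MixedSystem

/-! ### Parametrization of the affine space and of its mixed integer points. -/

namespace MixedSystem

variable {I : MixedSystem} {A : ℕ → ℕ → ℤ} {Q : ℤ} {rp cp fr pos : ℕ → ℕ} {k k₁ : ℕ}

/-- The system of congruences for the free integer variables. -/
abbrev IntState (I : MixedSystem) (A : ℕ → ℕ → ℤ) (rp : ℕ → ℕ) (k₁ : ℕ) (fr : ℕ → ℕ)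
    (S : Set ℕ) (N : ℕ → ℕ → ℤ) (z : ℕ → ℤ) (ok : Prop) : Prop :=
  CongState k₁ |pivDet I.m A rp| (fun i f => red I.m A rp i (fr f)) (fun i => red I.m A rp i I.n)
    S N z ok

/-- The rows with a pivot in an integer column. -/
def intRows (I : MixedSystem) (rp : ℕ → ℕ) : Set ℕ := {i | i < I.m ∧ 0 < rp i ∧ rp i ≤ I.p}

/-- The matrix `N` acts trivially on the free continuous variables, where `z` vanishes. -/
structure IsExtended (k k₁ : ℕ) (N : ℕ → ℕ → ℤ) (z : ℕ → ℤ) : Prop where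
  mat : ∀ f < k, ∀ l < k, (k₁ ≤ f ∨ k₁ ≤ l) → N f l = if f = l then 1 else 0
  vec : ∀ f < k, k₁ ≤ f → z f = 0

/-- The parametrization of the solution set. -/
noncomputable def solMap (I : MixedSystem) (A : ℕ → ℕ → ℤ) (rp cp : ℕ → ℕ) (k : ℕ)
    (fr pos : ℕ → ℕ) (N : ℕ → ℕ → ℤ) (z : ℕ → ℤ) : RatAffineMap I.n I.n' where
  xbar j := I.solve A rp cp k fr pos (fun f => (z f : ℚ)) 1 j
  M := Matrix.of fun j l => I.solve A rp cp k fr pos (fun f => (N f l : ℚ)) 0 j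

variable {N : ℕ → ℕ → ℤ} {z : ℕ → ℤ} {S : Set ℕ} {ok : Prop}

theorem mem_affineSet {x : Fin I.n → ℝ} : x ∈ I.affineSet ↔
    ∀ i : Fin I.m, ∑ j : Fin I.n, (I.W i j : ℝ) * x j = 1 * I.w i := by
  rw [affineSet, Set.mem_ofPred_eq, funext_iff]
  simp [Matrix.mulVec, dotProduct]

namespace Tableau

/-- By linearity, the affine map can be pulled into the choice of the free values: a parameter `y`
stands for the free values `z + N y`. -/
theorem toFun_solMap (h : I.Tableau A Q rp cp k k₁ fr pos) (y : Fin I.n' → ℝ) (j : Fin I.n) :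
    (I.solMap A rp cp k fr pos N z).toFun y j = I.solve A rp cp k fr pos
      (fun f => (z f : ℝ) + ∑ l ∈ Finset.range k, (N f l : ℝ) * extend y l) 1 j := by
  have := complete_add_sum (K := ℝ) (n := I.n) (k := k) (cp := cp) (fr := fr) (pos := pos)
    (red I.m A rp) (pivDet I.m A rp) (fun f => (z f : ℝ)) (fun f l => (N f l : ℝ)) (extend y) 1 k j
  refine Eq.trans ?_ this
  rw [RatAffineMap.toFun]
  have hc := fun v : ℕ → ℚ => fun ρ : ℚ => complete_cast (n := I.n) (k := k) (cp := cp) (fr := fr)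
    (pos := pos) (Rat.castHom ℝ) (red I.m A rp) (pivDet I.m A rp) v ρ j
  simp only [eq_ratCast] at hc
  congr 1
  · simp only [solMap, solve, hc]
    simp
  · rw [h.eq_n', Finset.sum_range, Matrix.mulVec, dotProduct]
    refine Finset.sum_congr rfl fun l _ => ?_
    simp only [solMap, solve, Matrix.map_apply, Matrix.of_apply, hc, ← h.eq_n', extend_coe]
    simp

theorem mem_affineSet_iff (h : I.Tableau A Q rp cp k k₁ fr pos) {x : Fin I.n → ℝ} :
    x ∈ I.affineSet ↔ (∀ i < I.m, rp i = 0 → red I.m A rp i I.n = 0) ∧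
      ∀ j : Fin I.n, x j = I.solve A rp cp k fr pos (fun f => extend x (fr f)) 1 j := by
  rw [mem_affineSet, h.solution_iff]
  simp

/-- The pivot column is an integer column, and the free continuous column lies to its right. Thus
the congruences involve no continuous variable. -/
theorem red_free_eq_zero (h : I.Tableau A Q rp cp k k₁ fr pos) {i f : ℕ} (hi : i ∈ I.intRows rp)
    (hf : f < k) (hk : k₁ ≤ f) : red I.m A rp i (fr f) = 0 := by
  obtain ⟨him, h1, h2⟩ := hi
  have h3 := mt (h.free.lt_iff f hf).mp (by omega)
  exact (h.elim.ech i him (rp i - 1) (by omega)).2 _ (by omega) (h.free.fr_lt f hf)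

theorem sum_free (h : I.Tableau A Q rp cp k k₁ fr pos) {K : Type*} [Field K] {i : ℕ}
    (hi : i ∈ I.intRows rp) (v : ℕ → K) :
    ∑ f ∈ Finset.range k, (red I.m A rp i (fr f) : K) * v f =
      ∑ f ∈ Finset.range k₁, (red I.m A rp i (fr f) : K) * v f := by
  symm
  refine Finset.sum_subset (Finset.range_mono h.free.le) fun f hf hf1 => ?_
  rw [Finset.mem_range] at hf hf1
  rw [h.red_free_eq_zero hi hf (by omega), Int.cast_zero, zero_mul]

/-- A solution with integral free integer variables is integral if and only if these variables
satisfy the congruences. -/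
theorem solve_int_iff (h : I.Tableau A Q rp cp k k₁ fr pos) (v : ℕ → ℝ) (c : ℕ → ℤ)
    (hv : ∀ f < k₁, v f = c f) :
    (∀ j < I.p, ∃ t : ℤ, I.solve A rp cp k fr pos v 1 j = t) ↔
      ∀ i ∈ I.intRows rp, dotK k₁ (fun f => red I.m A rp i (fr f)) c ≡ red I.m A rp i I.n
        [ZMOD |pivDet I.m A rp|] := by
  have hd : (pivDet I.m A rp : ℝ) ≠ 0 := by exact_mod_cast h.elim.det_ne
  have hsum : ∀ i ∈ I.intRows rp, ∑ f ∈ Finset.range k, (red I.m A rp i (fr f) : ℝ) * v f =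
      (dotK k₁ (fun f => red I.m A rp i (fr f)) c : ℤ) := by
    intro i hi
    rw [h.sum_free hi, dotK, Int.cast_sum]
    refine Finset.sum_congr rfl fun f hf => ?_
    rw [hv f (Finset.mem_range.mp hf), Int.cast_mul]
  constructor
  · rintro hj i hi
    obtain ⟨him, h1, h2⟩ := id hi
    obtain ⟨hqn, hcq⟩ := h.elim.cp_of_rp him (show rp i = (rp i - 1) + 1 by omega)
    obtain ⟨t, ht⟩ := hj (rp i - 1) (by omega)
    -- The pivot variable equals right hand side minus linear form, divided by the determinant; its
    -- integrality is precisely the congruence.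
    rw [solve, complete, if_neg (by omega), hcq, Nat.add_sub_cancel, hsum i hi, div_eq_iff hd,
      one_mul] at ht
    rw [Int.modEq_iff_dvd, abs_dvd]
    refine ⟨t, ?_⟩
    rw [mul_comm]
    exact_mod_cast ht
  · intro hi j hj
    have hjn : j < I.n := hj.trans_le I.p_le
    rw [solve, complete]
    split_ifs with hc
    · refine ⟨c (pos j), hv _ ((h.free.lt_iff _ (h.free.pos_lt j hjn hc)).mp ?_)⟩
      rwa [h.free.fr_pos j hjn hc]
    · obtain ⟨h2, h3⟩ := h.elim.cp_eq hjn hc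
      have hmem : cp j - 1 ∈ I.intRows rp := ⟨h2, by omega, by omega⟩
      have h4 := (hi _ hmem).dvd
      rw [abs_dvd] at h4
      obtain ⟨t, ht⟩ := h4
      refine ⟨t, ?_⟩
      rw [hsum _ hmem, div_eq_iff hd, one_mul, mul_comm]
      exact_mod_cast ht

theorem mixedSet_empty (h : I.Tableau A Q rp cp k k₁ fr pos)
    (hs : I.IntState A rp k₁ fr (I.intRows rp) N z ok)
    (hfail : (∃ i < I.m, rp i = 0 ∧ red I.m A rp i I.n ≠ 0) ∨ ¬ ok) : I.mixedSet = ∅ := by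
  refine Set.eq_empty_of_forall_notMem fun x hx => ?_
  obtain ⟨h1, h2⟩ := h.mem_affineSet_iff.mp hx.1
  rcases hfail with ⟨i, hi, h3, h4⟩ | hok
  · exact h4 (h1 i hi h3)
  · refine hs.no_sol hok ?_
    have h3 : ∀ f, ∃ c : ℤ, f < k₁ → extend x (fr f) = c := by
      intro f
      by_cases hf : f < k₁
      · have hfk := hf.trans_le h.free.le
        obtain ⟨c, hc⟩ := hx.2 ⟨fr f, h.free.fr_lt f hfk⟩ ((h.free.lt_iff f hfk).mpr hf)
        exact ⟨c, fun _ => by rw [extend_lt _ (h.free.fr_lt f hfk), hc]⟩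
      · exact ⟨0, fun hh => absurd hh hf⟩
    choose c hc using h3
    refine ⟨c, (h.solve_int_iff _ c hc).mp fun j hj => ?_⟩
    obtain ⟨t, ht⟩ := hx.2 ⟨j, hj.trans_le I.p_le⟩ hj
    exact ⟨t, by rw [← ht, h2]⟩

/-- The matrix of the new coordinates is triangular, so it is invertible. -/
theorem exists_coords
    (hs : I.IntState A rp k₁ fr (I.intRows rp) N z ok) (hext : IsExtended k k₁ N z)
    (K : Type*) [Field K] [CharZero K] :
    Function.Bijective (fun y : Fin k → K => fun f : Fin k => ∑ l : Fin k, (N f l : K) * y l) := by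
  let T : Matrix (Fin k) (Fin k) K := Matrix.of fun f l => (N f l : K)
  have hdet : IsUnit T.det := by
    rw [Matrix.det_of_isUpperTriangular (M := T), isUnit_iff_ne_zero, Finset.prod_ne_zero_iff]
    · intro l _
      simp only [T, Matrix.of_apply]
      by_cases hl : (l : ℕ) < k₁
      · exact_mod_cast (hs.basis l hl).pos.ne'
      · rw [hext.mat l l.2 l l.2 (by omega)]
        simp
    · intro f l hlf
      have hlf' : (l : ℕ) < f := hlf
      simp only [T, Matrix.of_apply]
      by_cases hf : (f : ℕ) < k₁
      · rw [(hs.basis l (by omega)).upper f hf hlf', Int.cast_zero]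
      · rw [hext.mat f f.2 l l.2 (by omega), if_neg (by omega), Int.cast_zero]
  have hT : IsUnit T := (Matrix.isUnit_iff_isUnit_det T).mpr hdet
  exact ⟨Matrix.mulVec_injective_iff_isUnit.mpr hT, Matrix.mulVec_surjective_iff_isUnit.mpr hT⟩

/-- In the free coordinates the map given by `M` is the triangular matrix `N`, which is injective.
-/
theorem rank_solMap (h : I.Tableau A Q rp cp k k₁ fr pos)
    (hs : I.IntState A rp k₁ fr (I.intRows rp) N z ok) (hext : IsExtended k k₁ N z) :
    (I.solMap A rp cp k fr pos N z).M.rank = I.n' := by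
  obtain rfl := h.eq_n'
  rw [Matrix.rank, LinearMap.finrank_range_of_inj, Module.finrank_fin_fun]
  rw [← LinearMap.ker_eq_bot, LinearMap.ker_eq_bot']
  intro y hy
  refine (exists_coords hs hext ℚ).1 ?_
  ext f
  have := congrFun hy ⟨fr f, h.free.fr_lt f f.2⟩
  simp only [Matrix.mulVecLin_apply, Matrix.mulVec, dotProduct, solMap, Matrix.of_apply, solve,
    complete_fr h.free _ _ f.2] at this
  simpa using this

theorem affineSet_eq (h : I.Tableau A Q rp cp k k₁ fr pos)
    (hs : I.IntState A rp k₁ fr (I.intRows rp) N z ok) (hext : IsExtended k k₁ N z)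
    (hz : ∀ i < I.m, rp i = 0 → red I.m A rp i I.n = 0) :
    I.affineSet = Set.range (I.solMap A rp cp k fr pos N z).toFun := by
  ext x
  constructor
  · intro hx
    obtain ⟨-, h2⟩ := h.mem_affineSet_iff.mp hx
    obtain ⟨y, hy⟩ := (exists_coords hs hext ℝ).2 fun f => extend x (fr f) - z f
    obtain rfl := h.eq_n'
    refine ⟨y, funext fun j => ?_⟩
    rw [h.toFun_solMap, h2 j]
    refine complete_congr h.free (fun f hf => ?_) 1 j.2
    have := congrFun hy ⟨f, hf⟩
    simp only at this
    rw [Finset.sum_range]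
    simp only [extend_coe, this]
    ring
  · rintro ⟨y, rfl⟩
    rw [mem_affineSet]
    intro i
    simp only [h.toFun_solMap]
    exact h.solve_solution _ 1 (fun i hi h0 => by rw [hz i hi h0]; simp) i

/-- The free integer values of a mixed integer point differ from `z` by a vector of the lattice,
which has integer coordinates in the triangular basis. In the free continuous positions `N` is the
identity and `z` is zero, so these values serve as their own coordinates. Conversely, adding lattice
vectors to `z` preserves the congruences. -/
theorem mixedSet_eq (h : I.Tableau A Q rp cp k k₁ fr pos)
    (hs : I.IntState A rp k₁ fr (I.intRows rp) N z ok) (hext : IsExtended k k₁ N z) (hok : ok)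
    (hz : ∀ i < I.m, rp i = 0 → red I.m A rp i I.n = 0) :
    I.mixedSet = (I.solMap A rp cp k fr pos N z).toFun '' mixedInt I.n' I.p' := by
  obtain rfl := h.eq_n'
  obtain rfl := h.eq_p'
  have hle := h.free.le
  ext x
  constructor
  · rintro ⟨hxA, hxI⟩
    obtain ⟨-, h2⟩ := h.mem_affineSet_iff.mp hxA
    have h3 : ∀ f, ∃ c : ℤ, f < I.p' → extend x (fr f) = c := by
      intro f
      by_cases hf : f < I.p'
      · have hfk := hf.trans_le hle
        obtain ⟨c, hc⟩ := hxI ⟨fr f, h.free.fr_lt f hfk⟩ ((h.free.lt_iff f hfk).mpr hf)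
        exact ⟨c, fun _ => by rw [extend_lt _ (h.free.fr_lt f hfk), hc]⟩
      · exact ⟨0, fun hh => absurd hh hf⟩
    choose c hc using h3
    have h4 := (h.solve_int_iff _ c hc).mp fun j hj => by
      obtain ⟨t, ht⟩ := hxI ⟨j, hj.trans_le I.p_le⟩ hj
      exact ⟨t, by rw [← ht, h2]⟩
    have h5 : c - z ∈ congLat I.p' |pivDet I.m A rp| (fun i f => red I.m A rp i (fr f))
        (I.intRows rp) := by
      intro i hi
      rw [dotK_sub]
      exact ((hs.sol hok i hi).trans (h4 i hi).symm).dvd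
    obtain ⟨y, hy⟩ := exists_coords_of_triCol hs.basis h5
    refine ⟨fun l => if (l : ℕ) < I.p' then (y l : ℝ) else extend x (fr l), ?_, ?_⟩
    · intro l hl
      exact ⟨y l, if_pos hl⟩
    · ext j
      rw [h.toFun_solMap, h2 j]
      refine complete_congr h.free (fun f hf => ?_) 1 j.2
      by_cases hf1 : f < I.p'
      · rw [hc f hf1, ← Finset.sum_subset (Finset.range_mono hle)]
        · have h6 := hy f hf1
          rw [Pi.sub_apply, sub_eq_iff_eq_add'] at h6
          rw [h6]
          push_cast
          congr 1
          refine Finset.sum_congr rfl fun l hl => ?_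
          rw [Finset.mem_range] at hl
          rw [extend_lt _ (hl.trans_le hle), if_pos hl]
        · intro l hl hl1
          rw [Finset.mem_range] at hl hl1
          rw [hext.mat f hf l hl (by omega), if_neg (by omega), Int.cast_zero, zero_mul]
      · rw [hext.vec f hf (by omega), Int.cast_zero, zero_add, Finset.sum_eq_single f]
        · rw [hext.mat f hf f hf (by omega), if_pos rfl, Int.cast_one, one_mul, extend_lt _ hf,
            if_neg hf1]
        · intro l hl hlf
          rw [Finset.mem_range] at hl
          rw [hext.mat f hf l hl (by omega), if_neg hlf.symm, Int.cast_zero, zero_mul]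
        · intro hh
          exact absurd (Finset.mem_range.mpr hf) hh
  · rintro ⟨y, hy, rfl⟩
    refine ⟨?_, ?_⟩
    · rw [h.affineSet_eq hs hext hz]
      exact ⟨y, rfl⟩
    · have h3 : ∀ l, ∃ c : ℤ, l < I.p' → extend y l = c := by
        intro l
        by_cases hl : l < I.p'
        · obtain ⟨c, hc⟩ := hy ⟨l, hl.trans_le hle⟩ hl
          exact ⟨c, fun _ => by rw [extend_lt _ (hl.trans_le hle), hc]⟩
        · exact ⟨0, fun hh => absurd hh hl⟩
      choose c hc using h3
      intro j hj
      rw [h.toFun_solMap]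
      refine (h.solve_int_iff _ (z + fun f => ∑ l ∈ Finset.range I.p', N f l * c l) ?_).mpr
        ?_ j hj
      · intro f hf
        have hfk := hf.trans_le hle
        rw [← Finset.sum_subset (Finset.range_mono hle)]
        · rw [Pi.add_apply]
          push_cast
          congr 1
          refine Finset.sum_congr rfl fun l hl => ?_
          rw [hc l (Finset.mem_range.mp hl)]
        · intro l hl hl1
          rw [Finset.mem_range] at hl hl1
          rw [hext.mat f hfk l hl (by omega), if_neg (by omega), Int.cast_zero, zero_mul]
      · intro i hi
        rw [dotK_add]
        have := (hs.sol hok i hi).add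
          (Int.modEq_zero_iff_dvd.mpr (sum_mem_of_triCol hs.basis c i hi))
        rwa [add_zero] at this

/-- The vector `x̄` is the image of `0`, which belongs to `mixedInt`. -/
theorem xbar_int (h : I.Tableau A Q rp cp k k₁ fr pos)
    (hs : I.IntState A rp k₁ fr (I.intRows rp) N z ok) (hext : IsExtended k k₁ N z) (hok : ok)
    (hz : ∀ i < I.m, rp i = 0 → red I.m A rp i I.n = 0) (j : Fin I.n) (hj : (j : ℕ) < I.p) :
    ∃ t : ℤ, (I.solMap A rp cp k fr pos N z).xbar j = (t : ℚ) := by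
  have h0 : (I.solMap A rp cp k fr pos N z).toFun 0 ∈ I.mixedSet := by
    rw [h.mixedSet_eq hs hext hok hz]
    exact ⟨0, fun l _ => ⟨0, by simp⟩, rfl⟩
  obtain ⟨t, ht⟩ := h0.2 j hj
  refine ⟨t, ?_⟩
  rw [RatAffineMap.toFun, Matrix.mulVec_zero, Pi.zero_apply, add_zero] at ht
  exact_mod_cast ht

end Tableau

end MixedSystem

namespace RAM

/-! ### The extended Euclidean algorithm -/

open AExp Prog in
/-- Extended Euclidean algorithm for the contents of the arrays `27` and `28`.  The coefficients are
computed modulo the content of array `21`, and the result is left in the arrays `27`, `29`, `31`. -/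
def xgcd : Prog :=
  .seq (set 29 (.const 1)) <| .seq (set 30 (.const 0)) <| .seq (set 31 (.const 0)) <|
  .seq (set 32 (.const 1)) <|
  .whilePos (var 28) <|
    .seq (set 33 (var 27 / var 28)) <|
    .seq (set 34 (modE (var 27) (var 28))) <| .seq (set 27 (var 28)) <| .seq (set 28 (var 34)) <|
    .seq (set 34 (modE (var 29 - var 33 * var 30) (var 21))) <|
    .seq (set 29 (var 30)) <| .seq (set 30 (var 34)) <|
    .seq (set 34 (modE (var 31 - var 33 * var 32) (var 21))) <|
    .seq (set 31 (var 32)) (set 32 (var 34))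

/-- The quotient is at least `1`, so `a` is at least `b + a % b`, and `b` exceeds the remainder. -/
theorem Int.two_mul_emod_le {a b : ℤ} (hb : 0 < b) (hab : b ≤ a) : 2 * (a % b) ≤ a := by
  have h1 := Int.emod_lt_of_pos a hb
  have h2 := Int.mul_ediv_add_emod a b
  have h3 : 1 ≤ a / b := (Int.le_ediv_iff_mul_le hb).mpr (by simpa using hab)
  nlinarith

variable {L : ℕ} {M : ℤ} {s : Mem}

open AExp in
-- The product of two consecutive remainders is at least halved in each round, so its length bounds
-- the number of rounds. The extra factor `2` in `hL` pays for a first round that merely exchanges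
-- the arguments, if `g < c`. Arrays `29` and `31` hold the coefficients of the content of `27`,
-- arrays `30` and `32` those of the content of `28`; as they are needed modulo `D` only, reduction
-- keeps them bounded.
theorem xgcd_spec {g c D : ℤ} (hg : s 27 0 = g) (hc : s 28 0 = c) (hD : s 21 0 = D) (hg0 : 0 < g)
    (hc0 : 0 ≤ c) (hD0 : 0 < D) (hL : 2 * (g * c) < 2 ^ L) :
    WP L M xgcd s (fun s' => s' 27 0 = Int.gcd g c ∧
      s' 29 0 * g + s' 31 0 * c ≡ Int.gcd g c [ZMOD D]) := by
  refine WP.of_bdd fun hb => ?_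
  have hgM : g ≤ M := hg ▸ (le_abs_self _).trans (hb 27 0)
  have hcM : c ≤ M := hc ▸ (le_abs_self _).trans (hb 28 0)
  have hDM : D ≤ M := hD ▸ (le_abs_self _).trans (hb 21 0)
  have hmod : ∀ x : ℤ, |x % D| ≤ M := fun x => (abs_emod_le hD0 x).trans hDM
  refine .seq (.assign (by simp; omega) ?_)
  refine .seq (.assign (by simp; omega) ?_)
  refine .seq (.assign (by simp; omega) ?_)
  refine .seq (.assign (by simp; omega) ?_)
  refine .whilePos (fun k s' => s' 21 0 = D ∧ 0 < s' 27 0 ∧ 0 ≤ s' 28 0 ∧ s' 27 0 ≤ M ∧ s' 28 0 ≤ M ∧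
    Int.gcd (s' 27 0) (s' 28 0) = Int.gcd g c ∧
    s' 29 0 * g + s' 31 0 * c ≡ s' 27 0 [ZMOD D] ∧ s' 30 0 * g + s' 32 0 * c ≡ s' 28 0 [ZMOD D] ∧
    |s' 30 0| ≤ M ∧ |s' 32 0| ≤ M ∧
    ((s' 28 0 ≤ s' 27 0 ∧ s' 27 0 * s' 28 0 < 2 ^ k) ∨ 2 * (s' 27 0 * s' 28 0) < 2 ^ k)) ?_ ?_ L
    le_rfl ?_
  · rintro k s' - ⟨h21, h27, h28, h27M, h28M, hgcd, h1, h2, h30, h32, hk⟩ hpos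
    simp only [eval_read, eval_const] at hpos
    have hmul : 0 < s' 27 0 * s' 28 0 := mul_pos h27 hpos
    obtain ⟨k, rfl⟩ : ∃ k', k = k' + 1 := by
      refine Nat.exists_eq_succ_of_ne_zero fun h0 => ?_
      subst h0
      rw [pow_zero] at hk
      omega
    refine ⟨k, rfl, ?_⟩
    have hq0 : 0 ≤ s' 27 0 / s' 28 0 := Int.ediv_nonneg h27.le h28
    have hqM : s' 27 0 / s' 28 0 ≤ M := (Int.ediv_le_self _ h27.le).trans h27M
    have hr0 : 0 ≤ s' 27 0 % s' 28 0 := Int.emod_nonneg _ hpos.ne'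
    have hrlt : s' 27 0 % s' 28 0 < s' 28 0 := Int.emod_lt_of_pos _ hpos
    have hrle : s' 27 0 % s' 28 0 ≤ s' 27 0 := by
      linarith [Int.mul_ediv_add_emod (s' 27 0) (s' 28 0), mul_nonneg h28 hq0]
    refine .seq (.assign (by simp only [eval_div, eval_read, eval_const, abs_le]; omega) ?_)
    refine .seq (.assign (by
      simp only [eval_modE, eval_read, eval_const, abs_le, Mem.write_apply]; simp; omega) ?_)
    refine .seq (.assign (by simp [Mem.write_apply, abs_le]; omega) ?_)
    refine .seq (.assign (by simp [Mem.write_apply, abs_le]; omega) ?_)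
    refine .seq (.assign (by simp [Mem.write_apply, h21, hmod]) ?_)
    refine .seq (.assign (by simp [Mem.write_apply, h30]) ?_)
    refine .seq (.assign (by simp [Mem.write_apply, h21, hmod]) ?_)
    refine .seq (.assign (by simp [Mem.write_apply, h21, hmod]) ?_)
    refine .seq (.assign (by simp [Mem.write_apply, h32]) ?_)
    refine .assign (by simp [Mem.write_apply, h21, hmod]) ?_
    simp only [eval_modE, eval_read, eval_const, eval_sub, eval_mul, eval_div, Mem.write_apply]
    simp only [Nat.reduceEqDiff, false_and, and_self, if_true, if_false, h21]
    refine ⟨trivial, hpos, hr0, h28M, by omega, ?_, h2, ?_, hmod _, hmod _, Or.inl ⟨hrlt.le, ?_⟩⟩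
    · rw [← hgcd, Int.gcd_comm, Int.gcd_emod]
    · have h3 := h1.sub (h2.mul_left (s' 27 0 / s' 28 0))
      have h4 : (s' 29 0 - s' 27 0 / s' 28 0 * s' 30 0) % D * g +
          (s' 31 0 - s' 27 0 / s' 28 0 * s' 32 0) % D * c ≡
          (s' 29 0 - s' 27 0 / s' 28 0 * s' 30 0) * g +
          (s' 31 0 - s' 27 0 / s' 28 0 * s' 32 0) * c [ZMOD D] :=
        ((Int.mod_modEq _ _).mul_right g).add ((Int.mod_modEq _ _).mul_right c)
      have h5 : s' 27 0 % s' 28 0 = s' 27 0 - s' 27 0 / s' 28 0 * s' 28 0 := by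
        rw [Int.emod_def, mul_comm]
      rw [h5]
      refine h4.trans (Eq.trans ?_ h3)
      congr 1
      ring
    · rcases hk with ⟨hle, hk⟩ | hk
      · have := Int.two_mul_emod_le hpos hle
        rw [pow_succ] at hk
        nlinarith
      · rw [pow_succ] at hk
        nlinarith
  · rintro k s' - ⟨h21, h27, h28, -, -, hgcd, h1, -⟩ hneg
    simp only [eval_read, eval_const] at hneg
    have h0 : s' 28 0 = 0 := le_antisymm hneg h28
    rw [h0, Int.gcd_zero_right] at hgcd
    have h27' : s' 27 0 = Int.gcd g c := by
      rw [← hgcd]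
      omega
    exact ⟨h27', h27' ▸ h1⟩
  · simp [Mem.write_apply, hg, hc, hD, hg0, hc0, hgM, hcM, Int.ModEq]
    omega

/-! ### Linear combinations of tableau entries -/

open AExp Prog in
/-- The sum of the products of the entries of a row of the tableau in the free columns, and the values
of `x`, which depends on the content of array `39`, is computed in array `26`. -/
def dotProg (bound row x : AExp) : Prog :=
  .seq (set 26 (.const 0)) <| .forTo 39 bound <|
    set 26 (var 26 + read₂ 6 row (.read 19 (var 39)) * x)

/-- The expressions are evaluated while the scratch arrays `26` and `39` change; hence the
hypotheses on their values concern all memories agreeing with `s` elsewhere. The bound `k * C`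
covers all partial sums. -/
theorem dotProg_spec {bound row x : AExp} {k i : ℕ} {fr : ℕ → ℕ} {a X : ℕ → ℤ} {C : ℤ}
    (hkL : k ≤ L) (hkM : (k : ℤ) ≤ M) (hC : k * C ≤ M)
    (hbound : ∀ s' : Mem, (∀ y, y ≠ 26 → y ≠ 39 → s' y = s y) → bound.eval s' = k)
    (hrow : ∀ s' : Mem, (∀ y, y ≠ 26 → y ≠ 39 → s' y = s y) → row.eval s' = i)
    (hx : ∀ f < k, ∀ s' : Mem, (∀ y, y ≠ 26 → y ≠ 39 → s' y = s y) → s' 39 0 = f → x.eval s' = X f)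
    (hfr : ∀ f < k, s 19 f = fr f) (ha : ∀ f < k, s 6 (addr i (fr f)) = a f)
    (habs : ∀ f < k, |a f * X f| ≤ C) :
    WP L M (dotProg bound row x) s (fun s' => s' 26 0 = dotK k a X) := by
  have hM : 0 ≤ M := by omega
  refine .seq (.assign (by simpa using hM) ?_)
  have hfr' : ∀ s' : Mem, (∀ y, y ≠ 39 → y ∉ (Prog.set 26 (AExp.var 26 +
      AExp.read₂ 6 row (.read 19 (AExp.var 39)) * x)).mods → s' y =
      s.write 26 ((AExp.const 0).eval s) ((AExp.const 0).eval s) y) →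
      ∀ y, y ≠ 26 → y ≠ 39 → s' y = s y := by
    intro s' h y h1 h2
    rw [h y h2 (by simpa [Prog.mods] using h1), Mem.write_ne _ _ _ h1]
  refine .forTo k (fun f s' => s' 26 0 = dotK f a X) hkL hkM
    (fun s' h => hbound s' (hfr' s' h)) (by simp [Mem.write_apply, dotK]) ?_ fun s' _ _ h => h
  intro f hf s' hs' h39 hI
  have hs := hfr' s' hs'
  have heval : (AExp.var 26 + AExp.read₂ 6 row (.read 19 (AExp.var 39)) * x).eval s' =
      dotK (f + 1) a X := by
    rw [AExp.eval_add, AExp.eval_mul, hx f hf s' hs h39,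
      AExp.eval_read₂ (hrow s' hs) (b := fr f), hs 6 (by decide) (by decide), ha f hf, dotK,
      Finset.sum_range_succ, ← dotK, ← hI]
    · rfl
    · simp only [AExp.eval_read, AExp.eval_const, h39]
      rw [hs 19 (by decide) (by decide), hfr f hf]
  refine .assign ?_ ?_
  · rw [heval, dotK]
    refine (Finset.abs_sum_le_sum_abs _ _).trans ((Finset.sum_le_card_nsmul _ _ C ?_).trans ?_)
    · intro f' hf'
      exact habs f' (by rw [Finset.mem_range] at hf'; omega)
    · rw [Finset.card_range, nsmul_eq_mul]
      have hC0 : 0 ≤ C := (abs_nonneg _).trans (habs f hf)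
      have : ((f + 1 : ℕ) : ℤ) ≤ k := by exact_mod_cast hf
      exact (mul_le_mul_of_nonneg_right this hC0).trans hC
  · rw [heval]
    simp [Mem.write_apply, h39]

end RAM

namespace RAM

/-! ### The elimination program -/

open AExp Prog in
/-- Subtract a multiple of the pivot row from the row `r` (content of array `12`). -/
def elimRow : Prog :=
  .seq (set 15 (read₂ 6 (var 12) (var 40))) <|
  .forTo 13 (var 3 + .const 1) <| .assign 6 (addrE (var 12) (var 13))
    ((var 14 * read₂ 6 (var 12) (var 13) - var 15 * read₂ 6 (var 10) (var 13)) / var 7)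

open AExp Prog in
/-- Pivot step at the position given by the contents of the arrays `10` and `40`. -/
def pivotProg : Prog :=
  .seq (set 14 (read₂ 6 (var 10) (var 40))) <|
  .seq (.forTo 12 (var 2)
    -- The square is positive exactly for the rows other than the pivot row.
    (.ifPos ((var 12 - var 10) * (var 12 - var 10)) elimRow .skip)) <|
  .seq (set 7 (var 14)) <|
  .seq (.assign 8 (var 10) (var 40 + .const 1)) (.assign 9 (var 40) (var 10 + .const 1))

open AExp Prog in
/-- Elimination, column by column from the right to the left. -/
def elimProg : Prog :=
  .forTo 11 (var 3) <|
    .seq (set 40 (var 3 - .const 1 - var 11)) <|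
    .forTo 10 (var 2) <|
      -- Positive exactly if the row has no pivot yet and its entry in the current column is
      -- non-zero.
      .ifPos ((.const 1 - .read 8 (var 10)) *
        (read₂ 6 (var 10) (var 40) * read₂ 6 (var 10) (var 40))) pivotProg .skip

variable {L : ℕ} {M : ℤ} {s : Mem} {m n : ℕ} {A : ℕ → ℕ → ℤ} {rp cp : ℕ → ℕ}

/-- The memory contains the tableau for the pivots `rp`. -/
structure ElimMem (m n : ℕ) (A : ℕ → ℕ → ℤ) (rp cp : ℕ → ℕ) (s : Mem) : Prop where
  rows : s 2 0 = m
  cols : s 3 0 = n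
  tab : ∀ i < m, ∀ l ≤ n, s 6 (addr i l) = red m A rp i l
  det : s 7 0 = pivDet m A rp
  rowPiv : ∀ i < m, s 8 i = rp i
  colPiv : ∀ j < n, s 9 j = cp j

theorem ElimMem.of_frame {s' : Mem} (h : ElimMem m n A rp cp s)
    (hs : ∀ x ∈ [2, 3, 6, 7, 8, 9], s' x = s x) : ElimMem m n A rp cp s' := by
  simp only [List.forall_mem_cons] at hs
  obtain ⟨h2, h3, h6, h7, h8, h9, -⟩ := hs
  exact ⟨by rw [h2, h.rows], by rw [h3, h.cols], by rw [h6]; exact h.tab, by rw [h7, h.det],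
    by rw [h8]; exact h.rowPiv, by rw [h9]; exact h.colPiv⟩

open AExp in
-- The entry in the pivot column is saved in array `15`, since the loop overwrites it while it is
-- still needed for later columns.
theorem elimRow_spec {i j r : ℕ} {v : ℕ → ℤ} (hnL : n + 1 ≤ L) (hnM : (n : ℤ) + 1 ≤ M)
    (h3 : s 3 0 = n) (h10 : s 10 0 = i) (h12 : s 12 0 = r) (h40 : s 40 0 = j)
    (hv : ∀ l ≤ n, (s 14 0 * s 6 (addr r l) - s 6 (addr r j) * s 6 (addr i l)) / s 7 0 = v l)
    (hM : ∀ l ≤ n, |v l| ≤ M) :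
    WP L M elimRow s
      (fun s' => ∀ a b, s' 6 (addr a b) = if a = r ∧ b ≤ n then v b else s 6 (addr a b)) := by
  refine .of_bdd fun hb => ?_
  have h15 : (read₂ 6 (var 12) (var 40)).eval s = s 6 (addr r j) :=
    eval_read₂ (by simpa using h12) (by simpa using h40)
  refine .seq (.assign (by rw [h15]; exact hb _ _) ?_)
  rw [h15, eval_const]
  refine .forTo (n + 1) (fun l s' => ∀ a b, s' 6 (addr a b) =
    if a = r ∧ b < l then v b else s 6 (addr a b)) hnL (by push_cast; exact hnM) ?_ ?_ ?_ ?_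
  · intro s' hs'
    simp [hs' 3 (by decide) (by decide), Mem.write_apply, h3]
  · simp [Mem.write_apply]
  · intro l hl s' hs' h13 hI
    have hl' : l ≤ n := by omega
    have e12 : (var 12).eval s' = r := by
      simp [hs' 12 (by decide) (by decide), Mem.write_apply, h12]
    have e13 : (var 13).eval s' = l := by simp [h13]
    have e10 : (var 10).eval s' = i := by
      simp [hs' 10 (by decide) (by decide), Mem.write_apply, h10]
    have e14 : (var 14).eval s' = s 14 0 := by
      simp [hs' 14 (by decide) (by decide), Mem.write_apply]
    have e15 : (var 15).eval s' = s 6 (addr r j) := by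
      simp [hs' 15 (by decide) (by decide), Mem.write_apply]
    have e7 : (var 7).eval s' = s 7 0 := by
      simp [hs' 7 (by decide) (by decide), Mem.write_apply]
    have hval : ((var 14 * read₂ 6 (var 12) (var 13) - var 15 * read₂ 6 (var 10) (var 13)) /
        var 7).eval s' = v l := by
      rw [eval_div, eval_sub, eval_mul, eval_mul, e14, e15, e7, eval_read₂ e12 e13,
        eval_read₂ e10 e13, hI, hI, if_neg (by omega), if_neg (by omega), hv l hl']
    refine .assign (by rw [hval]; exact hM l hl') ⟨by simp [Mem.write_apply, h13], ?_⟩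
    intro a b
    rw [hval, eval_addrE e12 e13]
    simp only [Mem.write_apply, addr_inj, hI]
    by_cases hab : a = r ∧ b = l
    · simp [hab]
    · have : (a = r ∧ b ≤ l) ↔ (a = r ∧ b < l) := by omega
      simp [this, hab]
  · intro s' _ _ hI a b
    rw [hI a b]
    simp

open AExp in
-- During the loop the rows already treated belong to the new tableau, the others to the old one.
-- The pivot row is common to both (`red_update_self`), so it can be read at any time.
theorem pivotProg_spec {i j : ℕ} (hnL : n + 1 ≤ L) (hmL : m ≤ L) (hnM : (n : ℤ) + 1 ≤ M)
    (hmM : (m : ℤ) ≤ M)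
    (hM : ∀ rp : ℕ → ℕ, (∀ i < m, rp i ≤ n) → ∀ i, ∀ l ≤ n, |red m A rp i l| ≤ M)
    (h : ElimMem m n A rp cp s) (hrp : ∀ i < m, rp i ≤ n) (hd : pivDet m A rp ≠ 0)
    (hi : i < m) (hj : j < n) (h10 : s 10 0 = i) (h40 : s 40 0 = j) :
    WP L M pivotProg s
      (ElimMem m n A (Function.update rp i (j + 1)) (Function.update cp j (i + 1))) := by
  have hrp' : ∀ r < m, Function.update rp i (j + 1) r ≤ n := by
    intro r hr
    by_cases hri : r = i
    · subst hri
      simpa using hj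
    · simpa [hri] using hrp r hr
  have h14 : (read₂ 6 (var 10) (var 40)).eval s = red m A rp i j := by
    rw [eval_read₂ (a := i) (b := j) (by simpa using h10) (by simpa using h40), h.tab i hi j hj.le]
  refine .seq (.assign (by rw [h14]; exact hM rp hrp i j hj.le) ?_)
  rw [h14, eval_const]
  refine .seq (.forTo m (fun R s' => ∀ a < m, ∀ l ≤ n, s' 6 (addr a l) =
    if a < R then red m A (Function.update rp i (j + 1)) a l else red m A rp a l) hmL hmM ?_ ?_ ?_ ?_)
  · intro s' hs'
    simp [hs' 2 (by decide) (by decide), Mem.write_apply, h.rows]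
  · intro a ha l hl
    simp [Mem.write_apply, h.tab a ha l hl]
  · intro r hr s' hs' h12 hI
    have e10 : s' 10 0 = i := by simp [hs' 10 (by decide) (by decide), Mem.write_apply, h10]
    refine .ifPos (fun hpos => ?_) (fun hneg => .skip ⟨h12, ?_⟩)
    · have hri : r ≠ i := by
        rintro rfl
        simp [h12, e10] at hpos
      refine (elimRow_spec (i := i) (j := j) (r := r)
        (v := red m A (Function.update rp i (j + 1)) r) hnL hnM ?_ e10 h12 ?_ ?_ ?_).mono ?_
      · simp [hs' 3 (by decide) (by decide), Mem.write_apply, h.cols]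
      · simp [hs' 40 (by decide) (by decide), Mem.write_apply, h40]
      · intro l hl
        have hi' : s' 6 (addr i l) = red m A rp i l := by
          rw [hI i hi l hl]
          split_ifs
          · rw [red_update_self hi]
          · rfl
        rw [hi', hI r hr l hl, hI r hr j hj.le, if_neg (lt_irrefl _), if_neg (lt_irrefl _)]
        have e14 : s' 14 0 = red m A rp i j := by
          simp [hs' 14 (by decide) (by decide), Mem.write_apply]
        have e7 : s' 7 0 = pivDet m A rp := by
          simp [hs' 7 (by decide) (by decide), Mem.write_apply, h.det]
        rw [e14, e7, ← pivDet_mul_red_update hi hr hri, Int.mul_ediv_cancel_left _ hd]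
      · exact fun l hl => hM _ hrp' r l hl
      · intro s'' hf hQ
        refine ⟨by rw [hf 12 (by decide), h12], fun a ha l hl => ?_⟩
        simp only [Mem.write_apply]
        rw [if_neg (by simp), hQ a l, hI a ha l hl]
        by_cases har : a = r
        · subst har
          simp [hl]
        · have : a < r + 1 ↔ a < r := by omega
          simp [har, this]
    · have hri : r = i := by
        by_contra hne
        have h0 : (r : ℤ) - i ≠ 0 := by omega
        have := mul_self_pos.mpr h0
        simp only [eval_mul, eval_sub, eval_read, eval_const, h12, e10] at hneg
        omega
      subst hri
      intro a ha l hl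
      simp only [Mem.write_apply]
      rw [if_neg (by simp), hI a ha l hl]
      by_cases har : a = r
      · subst har
        simp [red_update_self hi]
      · have : a < r + 1 ↔ a < r := by omega
        simp [this]
  · intro s' hs' _ hI
    have e14 : s' 14 0 = red m A rp i j := by
      simp [hs' 14 (by decide) (by decide), Mem.write_apply]
    have e10 : s' 10 0 = i := by simp [hs' 10 (by decide) (by decide), Mem.write_apply, h10]
    have e40 : s' 40 0 = j := by simp [hs' 40 (by decide) (by decide), Mem.write_apply, h40]
    refine .seq (.assign (by simpa [e14] using hM rp hrp i j hj.le) ?_)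
    refine .seq (.assign (by simp [Mem.write_apply, e40, abs_le]; omega) ?_)
    refine .assign (by simp [Mem.write_apply, e10, abs_le]; omega) ?_
    constructor
    · simp [Mem.write_apply, hs' 2 (by decide) (by decide), h.rows]
    · simp [Mem.write_apply, hs' 3 (by decide) (by decide), h.cols]
    · intro a ha l hl
      simp [Mem.write_apply, hI a ha l hl, ha]
    · simp [Mem.write_apply, e14, pivDet_update hi]
    · intro a ha
      by_cases hai : a = i
      · subst hai
        simp [Mem.write_apply, e10, e40]
      · simp [Mem.write_apply, e10, hai, hs' 8 (by decide) (by decide), h.rowPiv a ha]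
    · intro b hb
      by_cases hbj : b = j
      · subst hbj
        simp [Mem.write_apply, e10, e40]
      · simp [Mem.write_apply, e40, hbj, hs' 9 (by decide) (by decide), h.colPiv b hb]

open AExp in
-- The bound `hM` is required for all admissible choices of pivots, because the ones made by the
-- program depend on the data.
theorem elimProg_spec (hnL : n + 1 ≤ L) (hmL : m ≤ L) (hnM : (n : ℤ) + 1 ≤ M) (hmM : (m : ℤ) ≤ M)
    (hM : ∀ rp : ℕ → ℕ, (∀ i < m, rp i ≤ n) → ∀ i, ∀ l ≤ n, |red m A rp i l| ≤ M)
    (h : ElimMem m n A (fun _ => 0) (fun _ => 0) s) :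
    WP L M elimProg s
      (fun s' => ∃ rp cp, ElimMem m n A rp cp s' ∧ ElimState m n A rp cp 0 0) := by
  refine .forTo n (fun jj s' => ∃ rp cp, ElimMem m n A rp cp s' ∧ ElimState m n A rp cp (n - jj) 0)
    (by omega) (by omega) ?_ ?_ ?_ ?_
  · intro s' hs'
    simp [hs' 3 (by decide) (by decide), h.cols]
  · refine ⟨_, _, h.of_frame ?_, ElimState.init m n A⟩
    simp [Mem.write_ne]
  · rintro jj hjj s' hs' h11 ⟨rp, cp, hmem, hst⟩
    obtain ⟨j, hj⟩ : ∃ j, n - jj = j + 1 := ⟨n - jj - 1, by omega⟩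
    have hjn : j < n := by omega
    rw [hj] at hst
    have hjj' : n - (jj + 1) = j := by omega
    have e40 : (var 3 - AExp.const 1 - var 11).eval s' = j := by
      simp [h11, hmem.cols]
      omega
    refine .seq (.assign (by rw [e40, abs_le]; omega) ?_)
    rw [e40, eval_const]
    refine .forTo m (fun i s'' => ∃ rp cp, ElimMem m n A rp cp s'' ∧
      ElimState m n A rp cp (j + 1) i) hmL hmM ?_ ?_ ?_ ?_
    · intro s'' hs''
      simp [hs'' 2 (by decide) (by decide), Mem.write_apply, hmem.rows]
    · exact ⟨rp, cp, hmem.of_frame (by simp [Mem.write_ne]), hst⟩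
    · rintro i hi s'' hs'' h10 ⟨rp, cp, hmem, hst⟩
      have e40' : s'' 40 0 = j := by
        simp [hs'' 40 (by decide) (by decide), Mem.write_apply]
      have e6 : (read₂ 6 (var 10) (var 40)).eval s'' = red m A rp i j := by
        rw [eval_read₂ (a := i) (b := j) (by simpa using h10) (by simpa using e40'),
          hmem.tab i hi j hjn.le]
      have hcond : ((AExp.const 1 - .read 8 (var 10)) *
          (read₂ 6 (var 10) (var 40) * read₂ 6 (var 10) (var 40))).eval s'' =
          (1 - rp i) * (red m A rp i j * red m A rp i j) := by
        rw [eval_mul, eval_mul, e6, eval_sub]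
        simp [h10, hmem.rowPiv i hi]
      refine .ifPos (fun hpos => ?_) (fun hneg => .skip ⟨h10, rp, cp, ?_, ?_⟩)
      · rw [hcond] at hpos
        have hne : red m A rp i j ≠ 0 := by
          intro h0
          simp [h0] at hpos
        have hrp0 : rp i = 0 := by
          by_contra h0
          have h1 : (1 : ℤ) - rp i ≤ 0 := by omega
          nlinarith [mul_self_pos.mpr hne]
        refine (pivotProg_spec hnL hmL hnM hmM hM hmem hst.rp_le hst.det_ne hi hjn h10 e40').mono ?_
        intro t hf hQ
        exact ⟨by rw [hf 10 (by decide), h10], _, _, hQ.of_frame (by simp [Mem.write_ne]),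
          hst.pivot hi hjn hrp0 hne⟩
      · exact hmem.of_frame (by simp [Mem.write_ne])
      · refine hst.skip fun h0 => ?_
        rw [hcond, h0] at hneg
        by_contra hne
        have := mul_self_pos.mpr hne
        simp at hneg
        omega
    · rintro s'' hs'' - ⟨rp, cp, hmem, hst⟩
      refine ⟨?_, rp, cp, hmem.of_frame (by simp [Mem.write_ne]), ?_⟩
      · simp [hs'' 11 (by decide) (by decide), Mem.write_apply, h11]
      · rw [hjj']
        exact hst.next_col
  · rintro s' - - ⟨rp, cp, hmem, hst⟩
    rw [Nat.sub_self] at hst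
    exact ⟨rp, cp, hmem, hst⟩

end RAM

/-! ### Reading the input -/

theorem length_flatMap_encodeRat (l : List ℚ) : (l.flatMap encodeRat).length = 2 * l.length := by
  induction l with
  | nil => rfl
  | cons a l ih =>
    simp [encodeRat] at ih ⊢
    omega

theorem getD_flatMap_encodeRat (l : List ℚ) {t : ℕ} (ht : t < l.length) :
    (l.flatMap encodeRat).getD (2 * t) 0 = (l.getD t 0).num ∧
      (l.flatMap encodeRat).getD (2 * t + 1) 0 = (l.getD t 0).den := by
  induction l generalizing t with
  | nil => simp at ht
  | cons a l ih =>
    cases t with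
    | zero => simp [encodeRat]
    | succ t =>
      have := ih (t := t) (by simpa using ht)
      simpa [encodeRat, Nat.mul_add] using this

namespace MixedSystem

variable (I : MixedSystem)

/-- All the rational numbers in the input. -/
def rats : List ℚ := (List.ofFn fun i => List.ofFn (I.W i)).flatten ++ List.ofFn I.w

theorem encode_eq : I.encode = (I.m : ℤ) :: (I.n : ℤ) :: (I.p : ℤ) :: I.rats.flatMap encodeRat := by
  rw [encode, rats, List.flatMap_append, encodeVec, encodeMat]
  simp only [List.cons_append, List.nil_append]
  congr 4
  rw [List.flatMap_def, List.flatMap_def, List.map_flatten, List.map_ofFn, List.map_ofFn,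
    List.flatten_flatten, List.map_ofFn]
  rfl

theorem mul_add_lt (i : Fin I.m) (j : Fin I.n) : (i : ℕ) * I.n + j < I.m * I.n := by
  have := Nat.mul_le_mul_right I.n (Nat.succ_le_of_lt i.2)
  rw [Nat.succ_mul] at this
  omega

theorem coeff_divNat_modNat (i : Fin I.m) (j : Fin I.n) :
    I.W (⟨i * I.n + j, I.mul_add_lt i j⟩ : Fin (I.m * I.n)).divNat
      (⟨i * I.n + j, I.mul_add_lt i j⟩ : Fin (I.m * I.n)).modNat = I.W i j := by
  have h1 : (⟨i * I.n + j, I.mul_add_lt i j⟩ : Fin (I.m * I.n)) = finProdFinEquiv (i, j) :=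
    Fin.ext (by simp [mul_comm, add_comm])
  rw [h1]
  exact congrArg (fun q : Fin I.m × Fin I.n => I.W q.1 q.2)
    (finProdFinEquiv.symm_apply_apply (i, j))

theorem rats_eq : I.rats = List.ofFn (fun t : Fin (I.m * I.n) => I.W t.divNat t.modNat) ++
    List.ofFn I.w := by
  rw [rats, List.ofFn_mul]
  congr 3
  ext i : 1
  congr 1
  ext j : 1
  exact (I.coeff_divNat_modNat i j).symm

theorem length_rats : I.rats.length = I.m * I.n + I.m := by simp [rats_eq]

/-- The rational number at position `t` of the input. -/
def ratAt (t : ℕ) : ℚ := I.rats.getD t 0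

theorem ratAt_coeff (i : Fin I.m) (j : Fin I.n) : I.ratAt (i * I.n + j) = I.W i j := by
  have h := I.mul_add_lt i j
  rw [ratAt, rats_eq, List.getD_append _ _ _ _ (by simpa using h),
    List.getD_eq_getElem _ _ (by simpa using h), List.getElem_ofFn]
  exact I.coeff_divNat_modNat i j

theorem ratAt_rhs (i : Fin I.m) : I.ratAt (I.m * I.n + i) = I.w i := by
  rw [ratAt, rats_eq, List.getD_append_right _ _ _ _ (by simp)]
  simp

theorem sum_ratSize : ∑ t ∈ Finset.range (I.m * I.n + I.m), ratSize (I.ratAt t) =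
    (∑ i, ∑ j, ratSize (I.W i j)) + ∑ i, ratSize (I.w i) := by
  rw [Finset.sum_range_add, Finset.sum_range, Finset.sum_range, ← Equiv.sum_comp finProdFinEquiv,
    Fintype.sum_prod_type]
  congr 1
  · refine Finset.sum_congr rfl fun i _ => Finset.sum_congr rfl fun j _ => ?_
    rw [← ratAt_coeff]
    simp [mul_comm, add_comm]
  · exact Finset.sum_congr rfl fun i _ => by rw [ratAt_rhs]

/-- The product of all denominators in the input. -/
def denProd : ℕ := ∏ t ∈ Finset.range (I.m * I.n + I.m), (I.ratAt t).den

/-- The position of the entry `l` of the row `i` in the input, the right hand side being entry `n`. -/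
def entryPos (i l : ℕ) : ℕ := if l < I.n then i * I.n + l else I.m * I.n + i

/-- The scaled entries of the system. -/
def intCoeff (i l : ℕ) : ℤ :=
  (I.ratAt (I.entryPos i l)).num * ((I.denProd : ℤ) / (I.ratAt (I.entryPos i l)).den)

theorem entryPos_lt {i l : ℕ} (hi : i < I.m) : I.entryPos i l < I.m * I.n + I.m := by
  rw [entryPos]
  split_ifs with h
  · nlinarith
  · omega

theorem denProd_pos : 0 < I.denProd := Finset.prod_pos fun _ _ => Rat.den_pos _

theorem den_dvd {t : ℕ} (ht : t < I.m * I.n + I.m) : (I.ratAt t).den ∣ I.denProd :=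
  Finset.dvd_prod_of_mem _ (Finset.mem_range.mpr ht)

theorem intCoeff_eq {i l : ℕ} (hi : i < I.m) :
    (I.intCoeff i l : ℚ) = I.denProd * I.ratAt (I.entryPos i l) := by
  obtain ⟨c, hc⟩ := I.den_dvd (I.entryPos_lt hi (l := l))
  have hd : ((I.ratAt (I.entryPos i l)).den : ℤ) ≠ 0 := by exact_mod_cast Rat.den_nz _
  have hd' : ((I.ratAt (I.entryPos i l)).den : ℚ) ≠ 0 := by exact_mod_cast Rat.den_nz _
  rw [intCoeff, hc]
  push_cast
  rw [Int.mul_ediv_cancel_left _ hd, mul_right_comm, mul_comm (_ : ℚ) (I.ratAt _),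
    Rat.mul_den_eq_num]
  push_cast
  rfl

theorem isScaled : I.IsScaled I.intCoeff I.denProd where
  ne_zero := by exact_mod_cast I.denProd_pos.ne'
  coeff i j := by
    rw [I.intCoeff_eq i.2, entryPos, if_pos j.2, ratAt_coeff]
    rfl
  rhs i := by
    rw [I.intCoeff_eq i.2, entryPos, if_neg (lt_irrefl _), ratAt_rhs]
    rfl

theorem m_le_size : I.m ≤ I.size := by
  simp only [size, vecSize]
  omega

theorem n_le_size : I.n ≤ I.size := by
  simp only [size]
  omega

theorem mul_le_size : I.m * I.n + I.m ≤ I.size := by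
  simp only [size, vecSize, matSize]
  omega

theorem sum_ratSize_le : ∑ t ∈ Finset.range (I.m * I.n + I.m), ratSize (I.ratAt t) ≤ I.size := by
  rw [sum_ratSize]
  simp only [size, vecSize, matSize]
  omega

theorem abs_num_le {t : ℕ} (ht : t < I.m * I.n + I.m) : |(I.ratAt t).num| ≤ 2 ^ I.size := by
  have h1 := Finset.single_le_sum (f := fun t => ratSize (I.ratAt t)) (fun _ _ => Nat.zero_le _)
    (Finset.mem_range.mpr ht)
  have h2 : (I.ratAt t).num.natAbs < 2 ^ I.size := by
    rw [← Nat.size_le]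
    have := I.sum_ratSize_le
    have h3 : ratSize (I.ratAt t) ≤ I.size := h1.trans this
    simp only [ratSize] at h3
    omega
  rw [Int.abs_eq_natAbs]
  exact_mod_cast h2.le

/-- The lengths of the denominators add up to at most the input size. Partial products are included
because the program computes them one after the other. -/
theorem prod_den_le {T : ℕ} (hT : T ≤ I.m * I.n + I.m) :
    ∏ t ∈ Finset.range T, (I.ratAt t).den ≤ 2 ^ I.size := by
  calc ∏ t ∈ Finset.range T, (I.ratAt t).den
      ≤ ∏ t ∈ Finset.range T, 2 ^ ratSize (I.ratAt t) := by
        refine Finset.prod_le_prod' fun t _ => ?_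
        refine (Nat.lt_size_self _).le.trans (Nat.pow_le_pow_right (by norm_num) ?_)
        rw [ratSize]
        omega
    _ = 2 ^ ∑ t ∈ Finset.range T, ratSize (I.ratAt t) := Finset.prod_pow_eq_pow_sum _ _ _
    _ ≤ 2 ^ I.size := by
        refine Nat.pow_le_pow_right (by norm_num) (le_trans ?_ I.sum_ratSize_le)
        exact Finset.sum_le_sum_of_subset (Finset.range_mono hT)

theorem abs_intCoeff_le {i l : ℕ} (hi : i < I.m) : |I.intCoeff i l| ≤ 2 ^ I.size * 2 ^ I.size := by
  rw [intCoeff, abs_mul]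
  refine mul_le_mul (I.abs_num_le (I.entryPos_lt hi)) ?_ (abs_nonneg _) (by positivity)
  rw [abs_of_nonneg (by positivity)]
  refine (Int.ediv_le_self _ (by positivity)).trans ?_
  exact_mod_cast I.prod_den_le le_rfl

end MixedSystem

namespace RAM

variable {L : ℕ} {M : ℤ} {s : Mem}

open AExp Prog in
/-- The numerator at position `t` of the input, multiplied by the product of the denominators. -/
def scaledEntry (t : AExp) : AExp :=
  -- The cells `0`, `1`, `2` hold `m`, `n`, `p`; from cell `3` on, numerators and denominators
  -- alternate.
  .read 0 (.const 3 + .const 2 * t) * (var 5 / .read 0 (.const 4 + .const 2 * t))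

open AExp Prog in
/-- Reading the input: the scaled system is stored in array `6`. -/
def readProg : Prog :=
  .seq (set 2 (.read 0 (.const 0))) <| .seq (set 3 (.read 0 (.const 1))) <|
  .seq (set 4 (.read 0 (.const 2))) <| .seq (set 5 (.const 1)) <|
  .seq (.forTo 10 (var 2 * var 3 + var 2)
    (set 5 (var 5 * .read 0 (.const 4 + .const 2 * var 10)))) <|
  .seq (.forTo 10 (var 2) <| .seq
    (.forTo 11 (var 3) (.assign 6 (addrE (var 10) (var 11))
      (scaledEntry (var 10 * var 3 + var 11))))
    (.assign 6 (addrE (var 10) (var 3)) (scaledEntry (var 2 * var 3 + var 10)))) <|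
  set 7 (.const 1)

variable {I : MixedSystem}

theorem inputMem_encode_num {t : ℕ} (ht : t < I.m * I.n + I.m) :
    inputMem I.encode 0 (3 + 2 * (t : ℤ)) = (I.ratAt t).num := by
  have h1 : (3 + 2 * (t : ℤ)).toNat = 2 * t + 3 := by omega
  have h2 := (getD_flatMap_encodeRat I.rats (t := t) (by rwa [I.length_rats])).1
  rw [inputMem, if_pos ⟨rfl, by positivity⟩, h1, I.encode_eq]
  simpa [MixedSystem.ratAt] using h2

theorem inputMem_encode_den {t : ℕ} (ht : t < I.m * I.n + I.m) :
    inputMem I.encode 0 (4 + 2 * (t : ℤ)) = (I.ratAt t).den := by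
  have h1 : (4 + 2 * (t : ℤ)).toNat = (2 * t + 1) + 3 := by omega
  have h2 := (getD_flatMap_encodeRat I.rats (t := t) (by rwa [I.length_rats])).2
  rw [inputMem, if_pos ⟨rfl, by positivity⟩, h1, I.encode_eq]
  simpa [MixedSystem.ratAt] using h2

theorem eval_scaledEntry {t : AExp} {i l : ℕ} (hi : i < I.m) (ht : t.eval s = I.entryPos i l)
    (h0 : s 0 = inputMem I.encode 0) (h5 : s 5 0 = I.denProd) :
    (scaledEntry t).eval s = I.intCoeff i l := by
  have h := I.entryPos_lt hi (l := l)
  simp only [scaledEntry, AExp.eval_mul, AExp.eval_div, AExp.eval_read, AExp.eval_add,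
    AExp.eval_const, ht, h0, h5, inputMem_encode_num h, inputMem_encode_den h]
  rfl

open AExp in
theorem readProg_spec (hL : I.m * I.n + I.m ≤ L) (hnL : I.n ≤ L)
    (hM : 2 ^ I.size * 2 ^ I.size ≤ M) :
    WP L M readProg (inputMem I.encode) (fun s => s 2 0 = I.m ∧ s 3 0 = I.n ∧ s 4 0 = I.p ∧
      s 7 0 = 1 ∧ ∀ i < I.m, ∀ l ≤ I.n, s 6 (addr i l) = I.intCoeff i l) := by
  have h2size : (1 : ℤ) ≤ 2 ^ I.size := one_le_pow₀ (by norm_num)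
  have hsM : (2 : ℤ) ^ I.size ≤ M := (le_mul_of_one_le_right (by positivity) h2size).trans hM
  have hsize : (I.size : ℤ) ≤ M := by
    refine le_trans ?_ hsM
    exact_mod_cast Nat.lt_two_pow_self.le
  have hmn := I.mul_le_size
  have hn := I.n_le_size
  have hm := I.m_le_size
  have hp := I.p_le
  have h00 : inputMem I.encode 0 0 = I.m := by simp [inputMem, I.encode_eq]
  have h01 : inputMem I.encode 0 1 = I.n := by simp [inputMem, I.encode_eq]
  have h02 : inputMem I.encode 0 2 = I.p := by simp [inputMem, I.encode_eq]
  refine .seq (.assign (by simp [h00]; omega) ?_)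
  refine .seq (.assign (by simp [Mem.write_apply, h01]; omega) ?_)
  refine .seq (.assign (by simp [Mem.write_apply, h02]; omega) ?_)
  refine .seq (.assign (by simp; omega) ?_)
  simp only [eval_const, eval_read, Mem.write_apply]
  simp only [OfNat.zero_ne_ofNat, false_and, if_false, h00, h01, h02]
  refine .seq (.forTo (I.m * I.n + I.m) (fun T s' => s' 5 0 =
    ∏ t ∈ Finset.range T, ((I.ratAt t).den : ℤ)) hL (by omega) ?_ ?_ ?_ ?_)
  · intro s' hs'
    simp [hs' 2 (by decide) (by decide), hs' 3 (by decide) (by decide), Mem.write_apply]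
  · simp [Mem.write_apply]
  · intro t ht s' hs' h10 hI
    have heval : (var 5 * .read 0 (.const 4 + .const 2 * var 10)).eval s' =
        ∏ t ∈ Finset.range (t + 1), ((I.ratAt t).den : ℤ) := by
      simp only [eval_mul, eval_read, eval_const, eval_add, h10, hI, hs' 0 (by decide) (by decide)]
      simp only [Mem.write_apply, OfNat.zero_ne_ofNat, false_and, if_false, inputMem_encode_den ht,
        Finset.prod_range_succ]
    refine .assign ?_ ?_
    · rw [heval, abs_of_nonneg (by positivity)]
      refine le_trans ?_ hsM
      exact_mod_cast I.prod_den_le ht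
    · rw [heval]
      simp [Mem.write_apply, h10]
  rintro s₁ hs₁ - h5
  have e0 : s₁ 0 = inputMem I.encode 0 := by
    rw [hs₁ 0 (by decide) (by decide)]
    simp [Mem.write_ne]
  have e2 : s₁ 2 0 = I.m := by simp [hs₁ 2 (by decide) (by decide), Mem.write_apply]
  have e3 : s₁ 3 0 = I.n := by simp [hs₁ 3 (by decide) (by decide), Mem.write_apply]
  have e4 : s₁ 4 0 = I.p := by simp [hs₁ 4 (by decide) (by decide), Mem.write_apply]
  have e5 : s₁ 5 0 = I.denProd := by
    rw [h5, MixedSystem.denProd]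
    push_cast
    rfl
  refine .seq (.forTo I.m (fun i s' => ∀ a < i, ∀ l ≤ I.n, s' 6 (addr a l) = I.intCoeff a l)
    (by nlinarith) (by omega) ?_ (by simp) ?_ ?_)
  · intro s' hs'
    simp [hs' 2 (by decide) (by decide), e2]
  · intro i hi s' hs' h10 hI
    refine .seq (.forTo I.n (fun j s'' => (∀ a < i, ∀ l ≤ I.n, s'' 6 (addr a l) = I.intCoeff a l) ∧
      ∀ l < j, s'' 6 (addr i l) = I.intCoeff i l) hnL (by omega) ?_ ?_ ?_ ?_)
    · intro s'' hs''
      simp [hs'' 3 (by decide) (by decide), hs' 3 (by decide) (by decide), e3]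
    · simpa [Mem.write_apply] using hI
    · intro j hj s'' hs'' h11 hJ
      have f10 : (var 10).eval s'' = i := by simp [hs'' 10 (by decide) (by decide), h10]
      have f11 : (var 11).eval s'' = j := by simp [h11]
      have f3 : (var 3).eval s'' = I.n := by
        simp [hs'' 3 (by decide) (by decide), hs' 3 (by decide) (by decide), e3]
      have heval : (scaledEntry (var 10 * var 3 + var 11)).eval s'' = I.intCoeff i j := by
        refine eval_scaledEntry hi ?_ ?_ ?_
        · rw [eval_add, eval_mul, f10, f11, f3, MixedSystem.entryPos, if_pos hj]
          push_cast
          rfl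
        · rw [hs'' 0 (by decide) (by decide), hs' 0 (by decide) (by decide), e0]
        · rw [hs'' 5 (by decide) (by decide), hs' 5 (by decide) (by decide), e5]
      refine .assign (by rw [heval]; exact (I.abs_intCoeff_le hi).trans hM) ?_
      rw [heval, eval_addrE f10 f11]
      refine ⟨by simp [Mem.write_apply, h11], fun a ha l hl => ?_, fun l hl => ?_⟩
      · simp [Mem.write_apply, ha.ne, hJ.1 a ha l hl]
      · by_cases hlj : l = j
        · subst hlj
          simp [Mem.write_apply]
        · simp [Mem.write_apply, hlj, hJ.2 l (by omega)]
    · intro s'' hs'' h11 hJ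
      have f10 : (var 10).eval s'' = i := by simp [hs'' 10 (by decide) (by decide), h10]
      have f2 : (var 2).eval s'' = I.m := by
        simp [hs'' 2 (by decide) (by decide), hs' 2 (by decide) (by decide), e2]
      have f3 : (var 3).eval s'' = I.n := by
        simp [hs'' 3 (by decide) (by decide), hs' 3 (by decide) (by decide), e3]
      have heval : (scaledEntry (var 2 * var 3 + var 10)).eval s'' = I.intCoeff i I.n := by
        refine eval_scaledEntry hi ?_ ?_ ?_
        · rw [eval_add, eval_mul, f10, f2, f3, MixedSystem.entryPos, if_neg (lt_irrefl _)]
          push_cast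
          rfl
        · rw [hs'' 0 (by decide) (by decide), hs' 0 (by decide) (by decide), e0]
        · rw [hs'' 5 (by decide) (by decide), hs' 5 (by decide) (by decide), e5]
      refine .assign (by rw [heval]; exact (I.abs_intCoeff_le hi).trans hM) ?_
      rw [heval, eval_addrE f10 f3]
      refine ⟨?_, fun a ha l hl => ?_⟩
      · simpa [Mem.write_apply] using f10
      · by_cases hai : a = i
        · subst hai
          by_cases hln : l = I.n
          · subst hln
            simp [Mem.write_apply]
          · simp [Mem.write_apply, hln, hJ.2 l (by omega)]
        · simp [Mem.write_apply, hai, hJ.1 a (by omega) l hl]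
  · rintro s' hs' - hI
    refine .assign (by simp; omega) ⟨?_, ?_, ?_, ?_, ?_⟩
    · simp [Mem.write_apply, hs' 2 (by decide) (by decide), e2]
    · simp [Mem.write_apply, hs' 3 (by decide) (by decide), e3]
    · simp [Mem.write_apply, hs' 4 (by decide) (by decide), e4]
    · simp [Mem.write_apply]
    · intro i hi l hl
      simp [Mem.write_apply, hI i hi l hl]

end RAM

namespace RAM

variable {L : ℕ} {M : ℤ} {s : Mem} {m n p : ℕ} {A : ℕ → ℕ → ℤ} {rp cp : ℕ → ℕ}

/-! ### Evaluation of the tableau -/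

open AExp Prog in
/-- Is there a row without pivot and with non-zero right hand side? -/
def checkProg : Prog :=
  .forTo 10 (var 2) <| .ifPos ((.const 1 - .read 8 (var 10)) *
    (read₂ 6 (var 10) (var 3) * read₂ 6 (var 10) (var 3))) (set 36 (.const 1)) .skip

open AExp Prog in
/-- List the columns without pivot. -/
def freeProg : Prog :=
  .forTo 11 (var 3) <| .ifPos (.read 9 (var 11)) .skip <|
    .seq (.assign 19 (var 17) (var 11)) <| .seq (.assign 20 (var 11) (var 17)) <|
    .seq (set 17 (var 17 + .const 1)) <|
    .ifPos (var 4 - var 11) (set 18 (var 18 + .const 1)) .skip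

open AExp Prog in
/-- Absolute value of the determinant. -/
def modulusProg : Prog :=
  .ifPos (var 7) (set 21 (var 7)) (set 21 (.const 0 - var 7))

open AExp Prog in
/-- Initialize the array `22` by the identity matrix. -/
def identityProg : Prog :=
  .forTo 39 (var 17) (.assign 22 (addrE (var 39) (var 39)) (.const 1))

open AExp in
theorem checkProg_spec (hmL : m ≤ L) (hM : 1 ≤ M) (hmM : (m : ℤ) ≤ M) (h : ElimMem m n A rp cp s)
    (h36 : s 36 0 = 0) :
    WP L M checkProg s (fun s' => (s' 36 0 = 0 ∧ ∀ i < m, rp i = 0 → red m A rp i n = 0) ∨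
      (s' 36 0 = 1 ∧ ∃ i < m, rp i = 0 ∧ red m A rp i n ≠ 0)) := by
  refine .forTo m (fun i s' => (s' 36 0 = 0 ∧ ∀ a < i, rp a = 0 → red m A rp a n = 0) ∨
      (s' 36 0 = 1 ∧ ∃ i < m, rp i = 0 ∧ red m A rp i n ≠ 0)) hmL hmM ?_ ?_ ?_ ?_
  · intro s' hs'
    simp [hs' 2 (by decide) (by decide), h.rows]
  · simp [Mem.write_apply, h36]
  · intro i hi s' hs' h10 hI
    have h' : ElimMem m n A rp cp s' := h.of_frame fun x hx => by
      revert hx x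
      simp only [List.forall_mem_cons]
      exact ⟨hs' 2 (by decide) (by decide), hs' 3 (by decide) (by decide),
        hs' 6 (by decide) (by decide), hs' 7 (by decide) (by decide),
        hs' 8 (by decide) (by decide), hs' 9 (by decide) (by decide), by simp⟩
    have e6 : (read₂ 6 (var 10) (var 3)).eval s' = red m A rp i n := by
      rw [eval_read₂ (a := i) (b := n) (by simpa using h10) (by simpa using h'.cols),
        h'.tab i hi n le_rfl]
    have hcond : ((AExp.const 1 - .read 8 (var 10)) *
        (read₂ 6 (var 10) (var 3) * read₂ 6 (var 10) (var 3))).eval s' =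
        (1 - rp i) * (red m A rp i n * red m A rp i n) := by
      rw [eval_mul, eval_mul, e6, eval_sub]
      simp [h10, h'.rowPiv i hi]
    refine .ifPos (fun hpos => ?_) (fun hneg => .skip ⟨h10, ?_⟩)
    · rw [hcond] at hpos
      have hne : red m A rp i n ≠ 0 := by
        intro h0
        simp [h0] at hpos
      have hrp0 : rp i = 0 := by
        by_contra h0
        have h1 : (1 : ℤ) - rp i ≤ 0 := by omega
        nlinarith [mul_self_pos.mpr hne]
      exact .assign (by simp; omega) ⟨by simp [Mem.write_apply, h10],
        Or.inr ⟨by simp [Mem.write_apply], i, hi, hrp0, hne⟩⟩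
    · refine hI.imp (fun hI => ⟨by simp [Mem.write_apply, hI.1], fun a ha h0 => ?_⟩)
        fun hI => ⟨by simp [Mem.write_apply, hI.1], hI.2⟩
      rcases Nat.lt_succ_iff_lt_or_eq.mp ha with ha | rfl
      · exact hI.2 a ha h0
      · rw [hcond, h0] at hneg
        by_contra hne
        have := mul_self_pos.mpr hne
        simp at hneg
        omega
  · exact fun _ _ _ h => h

/-- The memory contains the enumeration of the free columns. -/
structure FreeMem (n p : ℕ) (cp : ℕ → ℕ) (k k₁ : ℕ) (fr pos : ℕ → ℕ) (s : Mem) : Prop where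
  enum : FreeEnum n p cp k k₁ fr pos
  num : s 17 0 = k
  numInt : s 18 0 = k₁
  col : ∀ f < k, s 19 f = fr f
  inv : ∀ j < n, cp j = 0 → s 20 j = pos j

open AExp in
theorem freeProg_spec (hnL : n ≤ L) (hnM : (n : ℤ) ≤ M) (h3 : s 3 0 = n) (h4 : s 4 0 = p)
    (h9 : ∀ j < n, s 9 j = cp j) (h17 : s 17 0 = 0) (h18 : s 18 0 = 0) :
    WP L M freeProg s (fun s' => ∃ k k₁ fr pos, FreeMem n p cp k k₁ fr pos s') := by
  refine .forTo n (fun j s' => ∃ k k₁ fr pos, k ≤ j ∧ FreeMem j p cp k k₁ fr pos s')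
    hnL hnM ?_ ?_ ?_ ?_
  · intro s' hs'
    simp [hs' 3 (by decide) (by decide), h3]
  · exact ⟨0, 0, fun _ => 0, fun _ => 0, le_rfl, FreeEnum.init p cp _ _,
      by simp [Mem.write_apply, h17], by simp [Mem.write_apply, h18], by simp, by simp⟩
  · rintro j hj s' hs' h11 ⟨k, k₁, fr, pos, hkj, hI⟩
    have e9 : (AExp.read 9 (var 11)).eval s' = cp j := by
      simp [h11, hs' 9 (by decide) (by decide), h9 j hj]
    have e4 : s' 4 0 = p := by rw [hs' 4 (by decide) (by decide), h4]
    have hle := hI.enum.le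
    refine .ifPos (fun hpos => ?_) (fun hneg => ?_)
    · rw [e9] at hpos
      have hc : cp j ≠ 0 := by omega
      refine .skip ⟨h11, k, k₁, fr, pos, by omega, hI.enum.skip hc, ?_, ?_, ?_, ?_⟩
      · simp [Mem.write_apply, hI.num]
      · simp [Mem.write_apply, hI.numInt]
      · simpa [Mem.write_apply] using hI.col
      · intro j' hj' hc'
        have : j' < j := by
          rcases Nat.lt_succ_iff_lt_or_eq.mp hj' with h | rfl
          · exact h
          · exact absurd hc' hc
        simp [Mem.write_apply, hI.inv j' this hc']
    · rw [e9] at hneg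
      have hc : cp j = 0 := by omega
      refine .seq (.assign (by simp [h11]; omega) ?_)
      refine .seq (.assign (by simp [Mem.write_apply, hI.num]; omega) ?_)
      refine .seq (.assign (by simp [Mem.write_apply, hI.num, abs_le]; omega) ?_)
      simp only [eval_const, eval_read, eval_add, Mem.write_apply]
      simp only [Nat.reduceEqDiff, false_and, if_false, h11, hI.num]
      -- The common end of both branches: an integer and a continuous free column differ only in the
      -- new value of `k₁`.
      have key : ∀ (t : Mem) (k₁' : ℕ), k₁' = (if j < p then k₁ + 1 else k₁) → t 11 0 = j →
          t 17 0 = k + 1 → t 18 0 = k₁' → (∀ i, t 19 i = if i = (k : ℤ) then (j : ℤ) else s' 19 i) →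
          (∀ i, t 20 i = if i = (j : ℤ) then (k : ℤ) else s' 20 i) →
          t 11 0 = j ∧ ∃ k k₁ fr pos, k ≤ j + 1 ∧
            FreeMem (j + 1) p cp k k₁ fr pos (t.write 11 0 (j + 1)) := by
        rintro t k₁' rfl h11 h17 h18 h19 h20
        refine ⟨h11, k + 1, _, _, _, by omega, hI.enum.push hc, ?_, ?_, ?_, ?_⟩
        · simp [Mem.write_apply, h17]
        · simp [Mem.write_apply, h18]
        · intro f hf
          by_cases hfk : f = k
          · subst hfk
            simp [Mem.write_apply, h19]
          · simp [Mem.write_apply, h19, hfk, hI.col f (by omega)]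
        · intro j' hj' hc'
          by_cases hjj : j' = j
          · subst hjj
            simp [Mem.write_apply, h20]
          · simp [Mem.write_apply, h20, hjj, hI.inv j' (by omega) hc']
      refine .ifPos (fun hpos => .assign ?_ ?_) (fun hneg => .skip ?_)
      · simp [Mem.write_apply, hI.numInt, abs_le]
        omega
      · simp [Mem.write_apply, e4, h11] at hpos
        refine key _ (k₁ + 1) (by rw [if_pos (by omega)]) ?_ ?_ ?_ ?_ ?_
        · simp [Mem.write_apply, h11]
        · simp [Mem.write_apply]
        · simp [Mem.write_apply, hI.numInt]
        · simp [Mem.write_apply]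
        · simp [Mem.write_apply]
      · simp [Mem.write_apply, e4, h11] at hneg
        refine key _ k₁ (by rw [if_neg (by omega)]) ?_ ?_ ?_ ?_ ?_
        · simp [Mem.write_apply, h11]
        · simp [Mem.write_apply]
        · simp [Mem.write_apply, hI.numInt]
        · simp [Mem.write_apply]
        · simp [Mem.write_apply]
  · rintro s' - - ⟨k, k₁, fr, pos, -, h⟩
    exact ⟨k, k₁, fr, pos, h⟩

theorem modulusProg_spec : WP L M modulusProg s (fun s' => s' 21 0 = |s 7 0|) := by
  refine .of_bdd fun hb => .ifPos (fun hpos => .assign (hb 7 0) ?_) (fun hneg => .assign ?_ ?_)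
  · simp only [AExp.eval_read, AExp.eval_const] at hpos
    simp [Mem.write_apply, abs_of_pos hpos]
  · simpa using hb 7 0
  · simp only [AExp.eval_read, AExp.eval_const] at hneg
    simp [Mem.write_apply, abs_of_nonpos hneg]

open AExp in
theorem identityProg_spec {k : ℕ} (hkL : k ≤ L) (hM : 1 ≤ M) (hkM : (k : ℤ) ≤ M)
    (h17 : s 17 0 = k) (h22 : ∀ f l, s 22 (addr f l) = 0) : WP L M identityProg s
      (fun s' => ∀ f < k, ∀ l < k, s' 22 (addr f l) = if f = l then 1 else 0) := by
  refine .forTo k (fun F s' => ∀ f l, s' 22 (addr f l) = if f = l ∧ f < F then 1 else 0)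
    hkL hkM ?_ ?_ ?_ ?_
  · intro s' hs'
    simp [hs' 17 (by decide) (by decide), h17]
  · simp [Mem.write_apply, h22]
  · intro F _ s' _ h39 hI
    refine .assign (by simp; omega) ?_
    rw [eval_addrE (a := F) (b := F) (by simpa using h39) (by simpa using h39)]
    refine ⟨by simp [Mem.write_apply, h39], fun f l => ?_⟩
    simp only [Mem.write_apply, addr_inj, eval_const, hI]
    by_cases hf : f = F
    · subst hf
      by_cases hl : l = f
      · simp [hl]
      · simp [hl, Ne.symm hl]
    · have : f < F + 1 ↔ f < F := by omega
      simp [hf, this]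
  · intro s' _ _ hI f hf l _
    simp [hI, hf]

end RAM

namespace RAM

variable {L : ℕ} {M : ℤ} {s : Mem}

/-! ### Solving the congruences -/

open AExp Prog in
/-- Update of the column `l` (content of array `13`) of the basis and of the vector in array `24`. -/
def colUpdate : Prog :=
  .forTo 39 (var 18) <|
    -- The test is positive exactly on the diagonal, whose entry is not reduced. The new entry waits
    -- in array `35`, since the update of array `24` still needs the old one.
    .seq (.ifPos (.const 1 - (var 39 - var 13) * (var 39 - var 13))
      (set 35 (var 25 / var 27 * read₂ 22 (var 39) (var 13)))
      (set 35 (modE (var 25 / var 27 * read₂ 22 (var 39) (var 13) -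
        var 26 / var 27 * .read 24 (var 39)) (var 21)))) <|
    .seq (.assign 24 (var 39) (modE (var 29 * .read 24 (var 39) +
      var 31 * read₂ 22 (var 39) (var 13)) (var 21)))
    (.assign 22 (addrE (var 39) (var 13)) (var 35))

/-- The new entry `f` of the column `l` after a column update. -/
def newEntry (D t e : ℤ) (l : ℕ) (v u : ℕ → ℤ) (f : ℕ) : ℤ :=
  if f = l then t * v l else (t * v f - e * u f) % D

open AExp in
theorem colUpdate_spec {k₁ l : ℕ} {D t e : ℤ} (hkL : k₁ ≤ L) (hkM : (k₁ : ℤ) ≤ M) (hD : 0 < D)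
    (h18 : s 18 0 = k₁) (h13 : s 13 0 = l) (h21 : s 21 0 = D) (ht : s 25 0 / s 27 0 = t)
    (he : s 26 0 / s 27 0 = e) (hdiag : |t * s 22 (addr l l)| ≤ M) :
    WP L M colUpdate s (fun s' => (∀ f l', s' 22 (addr f l') = if l' = l ∧ f < k₁ then
        newEntry D t e l (fun f => s 22 (addr f l)) (fun f => s 24 f) f else s 22 (addr f l')) ∧
      ∀ f < k₁, s' 24 f = (s 29 0 * s 24 f + s 31 0 * s 22 (addr f l)) % D) := by
  refine .of_bdd fun hb => ?_
  have hDM : D ≤ M := h21 ▸ (le_abs_self _).trans (hb 21 0)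
  have hmod : ∀ x : ℤ, |x % D| ≤ M := fun x => (abs_emod_le hD x).trans hDM
  refine .forTo k₁ (fun F s' => (∀ f l', s' 22 (addr f l') = if l' = l ∧ f < F then
        newEntry D t e l (fun f => s 22 (addr f l)) (fun f => s 24 f) f else s 22 (addr f l')) ∧
      ∀ f : ℕ, s' 24 f = if f < F then (s 29 0 * s 24 f + s 31 0 * s 22 (addr f l)) % D
        else s 24 f) hkL hkM ?_ ?_ ?_ ?_
  · intro s' hs'
    simp [hs' 18 (by decide) (by decide), h18]
  · simp [Mem.write_apply]
  · rintro F hF s' hs' h39 ⟨hI, hu⟩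
    have e39 : (var 39).eval s' = F := by simp [h39]
    have e13 : (var 13).eval s' = l := by simp [hs' 13 (by decide) (by decide), h13]
    have e22 : (read₂ 22 (var 39) (var 13)).eval s' = s 22 (addr F l) := by
      rw [eval_read₂ e39 e13, hI, if_neg (by omega)]
    have e24 : s' 24 F = s 24 F := by rw [hu, if_neg (lt_irrefl _)]
    have e25 : (var 25 / var 27).eval s' = t := by
      simp [hs' 25 (by decide) (by decide), hs' 27 (by decide) (by decide), ht]
    have e26 : (var 26 / var 27).eval s' = e := by
      simp [hs' 26 (by decide) (by decide), hs' 27 (by decide) (by decide), he]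
    have e21 : s' 21 0 = D := by rw [hs' 21 (by decide) (by decide), h21]
    have e29 : s' 29 0 = s 29 0 := by rw [hs' 29 (by decide) (by decide)]
    have e31 : s' 31 0 = s 31 0 := by rw [hs' 31 (by decide) (by decide)]
    -- Both branches differ only in how they fill array `35`; everything after that is treated here
    -- once.
    have main : ∀ w : Mem, (∀ y, y ≠ 35 → w y = s' y) → w 35 0 = newEntry D t e l
        (fun f => s 22 (addr f l)) (fun f => s 24 f) F → |w 35 0| ≤ M →
        WP L M (.seq (.assign 24 (var 39) (modE (var 29 * .read 24 (var 39) +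
          var 31 * read₂ 22 (var 39) (var 13)) (var 21)))
          (.assign 22 (addrE (var 39) (var 13)) (var 35))) w (fun s'' => s'' 39 0 = F ∧
          (∀ f l', s''.write 39 0 ((F : ℤ) + 1) 22 (addr f l') = if l' = l ∧ f < F + 1 then
            newEntry D t e l (fun f => s 22 (addr f l)) (fun f => s 24 f) f else s 22 (addr f l')) ∧
          ∀ f : ℕ, s''.write 39 0 ((F : ℤ) + 1) 24 f = if f < F + 1 then
            (s 29 0 * s 24 f + s 31 0 * s 22 (addr f l)) % D else s 24 f) := by
      intro w hw h35 h35M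
      have w39 : (var 39).eval w = F := by simp [hw 39 (by decide), h39]
      have w13 : (var 13).eval w = l := by rw [← e13]; simp [hw 13 (by decide)]
      have w22 : (read₂ 22 (var 39) (var 13)).eval w = s 22 (addr F l) := by
        rw [eval_read₂ w39 w13, hw 22 (by decide), hI, if_neg (by omega)]
      have hval : (modE (var 29 * .read 24 (var 39) +
          var 31 * read₂ 22 (var 39) (var 13)) (var 21)).eval w =
          (s 29 0 * s 24 F + s 31 0 * s 22 (addr F l)) % D := by
        have w24 : (AExp.read 24 (var 39)).eval w = s 24 F := by
          rw [AExp.eval_read _ 24, w39, hw 24 (by decide), e24]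
        rw [eval_modE, eval_add, eval_mul, eval_mul, w22, w24]
        simp [hw 29 (by decide), hw 31 (by decide), hw 21 (by decide), e29, e31, e21]
      refine .seq (.assign (by rw [hval]; exact hmod _) ?_)
      rw [hval, w39]
      refine .assign (by simpa [Mem.write_apply] using h35M) ?_
      have x39 : (var 39).eval (w.write 24 F ((s 29 0 * s 24 F + s 31 0 * s 22 (addr F l)) % D)) =
          F := by rw [← w39]; simp [Mem.write_apply]
      have x13 : (var 13).eval (w.write 24 F ((s 29 0 * s 24 F + s 31 0 * s 22 (addr F l)) % D)) =
          l := by rw [← w13]; simp [Mem.write_apply]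
      rw [eval_addrE x39 x13]
      refine ⟨?_, fun f l' => ?_, fun f => ?_⟩
      · simp [Mem.write_apply, hw 39 (by decide), h39]
      · simp only [eval_read, eval_const, Mem.write_apply, addr_inj]
        simp only [Nat.reduceEqDiff, false_and, if_false, true_and, h35, hw 22 (by decide : 22 ≠ 35),
          hI]
        by_cases hfl : f = F ∧ l' = l
        · simp [hfl]
        · have : (l' = l ∧ f < F + 1) ↔ (l' = l ∧ f < F) := by omega
          rw [if_neg hfl]
          simp only [this]
      · simp only [Mem.write_apply]
        simp only [Nat.reduceEqDiff, false_and, if_false, true_and, hw 24 (by decide), hu]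
        by_cases hf : f = F
        · subst hf
          simp
        · have : f < F + 1 ↔ f < F := by omega
          simp [hf, this]
    refine .seq (.ifPos (fun hpos => .assign ?_ ?_) (fun hneg => .assign ?_ ?_))
    · have hFl : F = l := by
        by_contra hne
        have := mul_self_pos.mpr (show (F : ℤ) - l ≠ 0 by omega)
        rw [eval_sub, eval_mul, eval_sub, e39, e13, eval_const] at hpos
        omega
      rw [eval_mul, e25, e22, hFl]
      exact hdiag
    · have hFl : F = l := by
        by_contra hne
        have := mul_self_pos.mpr (show (F : ℤ) - l ≠ 0 by omega)
        rw [eval_sub, eval_mul, eval_sub, e39, e13, eval_const] at hpos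
        omega
      refine main _ (fun y hy => Mem.write_ne _ _ _ hy) ?_ ?_
      · rw [eval_mul, e25, e22, newEntry, if_pos hFl, hFl]
        simp [Mem.write_apply]
      · rw [eval_mul, e25, e22, hFl]
        simpa [Mem.write_apply] using hdiag
    · rw [eval_modE, eval_read, eval_const, e21]
      exact hmod _
    · have hFl : F ≠ l := by
        rintro rfl
        rw [eval_sub, eval_mul, eval_sub, e39, e13, eval_const] at hneg
        omega
      have hval : (modE (var 25 / var 27 * read₂ 22 (var 39) (var 13) -
          var 26 / var 27 * .read 24 (var 39)) (var 21)).eval s' = newEntry D t e l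
          (fun f => s 22 (addr f l)) (fun f => s 24 f) F := by
        rw [eval_modE, eval_sub, eval_mul, e25, e22, eval_mul, e26, AExp.eval_read _ 24, e39, e24,
          eval_read, eval_const, e21, newEntry, if_neg hFl]
      rw [hval]
      refine main _ (fun y hy => Mem.write_ne _ _ _ hy) ?_ ?_
      · simp [Mem.write_apply]
      · simp only [Mem.write_apply, eval_const, and_self, if_true, newEntry, if_neg hFl]
        exact hmod _
  · rintro s' - - ⟨hI, hu⟩
    exact ⟨hI, fun f hf => by rw [hu, if_pos hf]⟩

end RAM

/-! ### One column step for a new congruence. -/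

namespace RAM

variable {L : ℕ} {M : ℤ} {s : Mem} {I : MixedSystem} {A : ℕ → ℕ → ℤ} {rp cp fr pos : ℕ → ℕ}
  {k k₁ : ℕ}

/-- The memory contains the data produced by the elimination. -/
structure TabMem (I : MixedSystem) (A : ℕ → ℕ → ℤ) (rp cp : ℕ → ℕ) (k k₁ : ℕ) (fr pos : ℕ → ℕ)
    (s : Mem) : Prop where
  elim : ElimMem I.m I.n A rp cp s
  free : FreeMem I.n I.p cp k k₁ fr pos s
  ints : s 4 0 = I.p
  modulus : s 21 0 = |pivDet I.m A rp|

theorem TabMem.of_frame {s' : Mem} (h : TabMem I A rp cp k k₁ fr pos s)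
    (hs : ∀ x ∈ [2, 3, 6, 7, 8, 9, 4, 17, 18, 19, 20, 21], s' x = s x) :
    TabMem I A rp cp k k₁ fr pos s' := by
  refine ⟨h.elim.of_frame fun x hx => hs x ?_, ?_, ?_, ?_⟩
  · simp only [List.mem_cons, List.not_mem_nil] at hx ⊢
    tauto
  · have e17 := hs 17 (by decide)
    have e18 := hs 18 (by decide)
    have e19 := hs 19 (by decide)
    have e20 := hs 20 (by decide)
    exact ⟨h.free.enum, by rw [e17, h.free.num], by rw [e18, h.free.numInt],
      by rw [e19]; exact h.free.col, by rw [e20]; exact h.free.inv⟩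
  · rw [hs 4 (by decide), h.ints]
  · rw [hs 21 (by decide), h.modulus]

/-- Bounds which are sufficient for running the programs on the tableau. -/
structure Limits (I : MixedSystem) (A : ℕ → ℕ → ℤ) (rp : ℕ → ℕ) (L : ℕ) (M B : ℤ) : Prop where
  red_le : ∀ i, ∀ l ≤ I.n, |red I.m A rp i l| ≤ B
  det_le : |pivDet I.m A rp| ≤ B
  one_le : 1 ≤ B
  rows_le : I.m ≤ L
  cols_le : I.n ≤ L
  loop_le : 2 * (B * B) < 2 ^ L
  mem_le : (L + 1) * (B * B) ≤ M

namespace Limits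

variable {B : ℤ}

theorem loop_le_mem (h : Limits I A rp L M B) : (L : ℤ) + 1 ≤ M := by
  have h1 := h.mem_le
  have h2 := h.one_le
  nlinarith [mul_le_mul h2 h2 zero_le_one (by omega : (0 : ℤ) ≤ B)]

theorem bound_le_mem (h : Limits I A rp L M B) : B ≤ M := by
  have h1 := h.mem_le
  have h2 := h.one_le
  nlinarith [mul_nonneg (Int.natCast_nonneg L) (mul_self_nonneg B)]

/-- Room for a sum of `k` products of two bounded numbers and one further bounded number, as needed
for scalar products and for their difference from a right hand side. -/
theorem mul_le_mem (h : Limits I A rp L M B) {k : ℕ} (hk : k ≤ L) : k * (B * B) + B ≤ M := by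
  have h1 := h.mem_le
  have h2 := h.one_le
  have h3 : (k : ℤ) ≤ L := by exact_mod_cast hk
  nlinarith [mul_le_mul_of_nonneg_right h3 (mul_self_nonneg B)]

end Limits

theorem TabMem.k_le (h : TabMem I A rp cp k k₁ fr pos s) : k ≤ I.n := by
  have : Function.Injective (fun f : Fin k => (⟨fr f, h.free.enum.fr_lt f f.2⟩ : Fin I.n)) := by
    intro f f' hff
    have h1 := congrArg pos (congrArg Fin.val hff)
    simp only [h.free.enum.pos_fr _ f.2, h.free.enum.pos_fr _ f'.2] at h1
    exact Fin.ext h1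
  simpa using Fintype.card_le_of_injective _ this

open AExp Prog in
/-- Processing of the column `l` (content of array `13`) of the basis for the congruence given by
the row `i` (content of array `10`). -/
def colProg : Prog :=
  .seq (dotProg (var 18) (var 10) (read₂ 22 (var 39) (var 13))) <|
  .seq (set 26 (modE (var 26) (var 21))) <| .seq (set 27 (var 25)) <| .seq (set 28 (var 26)) <|
  .seq xgcd <| .seq colUpdate (set 25 (var 27))

open AExp in
-- The program version of `ColState.step`. Both arguments of the Euclidean algorithm are at most
-- `D`: one divides `D`, the other is a remainder modulo `D`. So the loop bound for numbers up to
-- `B` applies.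
theorem colProg_spec {B : ℤ} (hlim : Limits I A rp L M B) {S : Set ℕ} {i l : ℕ} {D : ℤ}
    {Λ' : AddSubgroup (ℕ → ℤ)} (hT : TabMem I A rp cp k k₁ fr pos s) (hi : i < I.m)
    (h10 : s 10 0 = i) (h13 : s 13 0 = l) (hl : l < k₁) (hD : D = |pivDet I.m A rp|) (hD0 : 0 < D)
    (hΛ' : Λ' = congLat k₁ D (fun i f => red I.m A rp i (fr f)) (insert i S))
    (hst : ColState k₁ D (congLat k₁ D (fun i f => red I.m A rp i (fr f)) S) Λ'
      (fun f => red I.m A rp i (fr f)) l (fun f l => s 22 (addr f l)) (fun f => s 24 f) (s 25 0)) :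
    WP L M colProg s (fun s' => ColState k₁ D
      (congLat k₁ D (fun i f => red I.m A rp i (fr f)) S) Λ'
      (fun f => red I.m A rp i (fr f)) (l + 1) (fun f l => s' 22 (addr f l)) (fun f => s' 24 f)
      (s' 25 0) ∧ ∀ f l', k₁ ≤ f ∨ k₁ ≤ l' → s' 22 (addr f l') = s 22 (addr f l')) := by
  have hk1 := hT.free.enum.le
  have hkn := hT.k_le
  have hnL := hlim.cols_le
  have hLM := hlim.loop_le_mem
  have hBM := hlim.bound_le_mem
  have hB := hlim.one_le
  have hDB : D ≤ B := hD ▸ hlim.det_le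
  have h21 : s 21 0 = D := by rw [hT.modulus, hD]
  have hg0 := hst.g_pos
  have hgD : s 25 0 ≤ D := Int.le_of_dvd hD0 hst.g_dvd
  have hclosed : ∀ z w : ℕ → ℤ, (∀ f < k₁, w f ≡ z f [ZMOD D]) →
      z ∈ congLat k₁ D (fun i f => red I.m A rp i (fr f)) S →
      w ∈ congLat k₁ D (fun i f => red I.m A rp i (fr f)) S := fun z w => congLat_modEq
  have hNl : ∀ f < k₁, |s 22 (addr f l)| ≤ D := by
    intro f hf
    by_cases hfl : f = l
    · subst hfl
      have hcol := hst.old f hl le_rfl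
      rw [abs_of_pos hcol.pos]
      exact hcol.diag_le hD0 hclosed
    · exact hst.N_bdd f hf l hl hfl
  refine .seq ((dotProg_spec (k := k₁) (i := i) (fr := fr)
    (a := fun f => red I.m A rp i (fr f)) (X := fun f => s 22 (addr f l)) (C := B * B)
    (by omega) (by omega) ?_ ?_ ?_ ?_ ?_ ?_ ?_).mono ?_)
  · have := hlim.mul_le_mem (k := k₁) (by omega)
    omega
  · intro s' hs'
    simp [hs' 18 (by decide) (by decide), hT.free.numInt]
  · intro s' hs'
    simp [hs' 10 (by decide) (by decide), h10]
  · intro f hf s' hs' h39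
    rw [eval_read₂ (a := f) (b := l) (by simp [h39]) (by simp [hs' 13 (by decide) (by decide), h13]),
      hs' 22 (by decide) (by decide)]
  · exact fun f hf => hT.free.col f (by omega)
  · exact fun f hf => hT.elim.tab i hi _ (hT.free.enum.fr_lt f (by omega)).le
  · intro f hf
    rw [abs_mul]
    exact mul_le_mul (hlim.red_le i _ (hT.free.enum.fr_lt f (by omega)).le)
      ((hNl f hf).trans hDB) (abs_nonneg _) (by omega)
  intro s₁ hs₁ h26
  have hc0 : 0 ≤ s₁ 26 0 % D := Int.emod_nonneg _ hD0.ne'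
  have hcD : s₁ 26 0 % D < D := Int.emod_lt_of_pos _ hD0
  have e21 : s₁ 21 0 = D := by rw [hs₁ 21 (by decide), h21]
  have e25 : s₁ 25 0 = s 25 0 := by rw [hs₁ 25 (by decide)]
  refine .seq (.assign (by simp [e21, abs_le]; omega) ?_)
  refine .seq (.assign (by simp [Mem.write_apply, e25, abs_le]; omega) ?_)
  refine .seq (.assign (by simp [Mem.write_apply, e21, abs_le]; omega) ?_)
  refine .seq ((xgcd_spec (g := s 25 0) (c := s₁ 26 0 % D) (D := D) ?_ ?_ ?_ hg0 hc0 hD0 ?_).mono ?_)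
  · simp [Mem.write_apply, e25]
  · simp [Mem.write_apply, e21]
  · simp [Mem.write_apply, e21]
  · refine lt_of_le_of_lt ?_ hlim.loop_le
    have := mul_le_mul (hgD.trans hDB) (hcD.le.trans hDB) hc0 (by omega)
    omega
  rintro s₂ hs₂ ⟨h27, h29⟩
  have e26 : s₂ 26 0 = s₁ 26 0 % D := by
    rw [hs₂ 26 (by decide)]
    simp [Mem.write_apply, e21]
  have f25 : s₂ 25 0 = s 25 0 := by
    rw [hs₂ 25 (by decide)]
    simp [Mem.write_apply, e25]
  have f21 : s₂ 21 0 = D := by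
    rw [hs₂ 21 (by decide)]
    simp [Mem.write_apply, e21]
  have f22 : s₂ 22 = s 22 := by
    rw [hs₂ 22 (by decide)]
    simp [Mem.write_ne, hs₁ 22 (by decide)]
  have f24 : s₂ 24 = s 24 := by
    rw [hs₂ 24 (by decide)]
    simp [Mem.write_ne, hs₁ 24 (by decide)]
  have f18 : s₂ 18 0 = k₁ := by
    rw [hs₂ 18 (by decide)]
    simp [Mem.write_ne, hs₁ 18 (by decide), hT.free.numInt]
  have f13 : s₂ 13 0 = l := by
    rw [hs₂ 13 (by decide)]
    simp [Mem.write_ne, hs₁ 13 (by decide), h13]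
  have hstep : ∀ (N' : ℕ → ℕ → ℤ) (u' : ℕ → ℤ),
      (∀ f l', N' f l' = if l' = l ∧ f < k₁ then newEntry D (s₂ 25 0 / s₂ 27 0) (s₂ 26 0 / s₂ 27 0) l
        (fun f => s₂ 22 (addr f l)) (fun f => s₂ 24 f) f else s₂ 22 (addr f l')) →
      (∀ f < k₁, u' f = (s₂ 29 0 * s₂ 24 f + s₂ 31 0 * s₂ 22 (addr f l)) % D) →
      ColState k₁ D (congLat k₁ D (fun i f => red I.m A rp i (fr f)) S) Λ'
        (fun f => red I.m A rp i (fr f)) (l + 1) N' u' (s₂ 27 0) := by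
    intro N' u' hN' hu'
    rw [f25, e26, f22, f24] at hN'
    rw [f24, f22] at hu'
    refine hst.step (c := s₁ 26 0 % D) (α := s₂ 29 0) (β := s₂ 31 0) hl hD0 hclosed ?_ ?_ h27
      (h27 ▸ h29) ?_ ?_ ?_ hu'
    · intro z
      rw [hΛ', mem_congLat_insert]
    · rw [h26]
      exact Int.mod_modEq _ _
    · intro f hf l' hl' hne
      rw [hN', if_neg (by tauto)]
    · rw [hN', if_pos ⟨rfl, hl⟩, newEntry, if_pos rfl]
    · intro f hf hne
      rw [hN', if_pos ⟨rfl, hf⟩, newEntry, if_neg hne]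
  -- The new diagonal entry is not reduced, so its bound comes from the theory: it belongs to a
  -- triangular basis of a lattice closed under congruence modulo `D`, hence is at most `D`.
  have hdiag : |s₂ 25 0 / s₂ 27 0 * s₂ 22 (addr l l)| ≤ M := by
    have h1 := hstep _ _ (fun _ _ => rfl) (fun _ _ => rfl)
    have h2 := h1.new l (Nat.lt_succ_self l)
    have h3 := h2.diag_le hD0 (fun z w => by rw [hΛ']; exact congLat_modEq)
    have h4 := h2.pos
    simp only [hl, and_self, if_true, newEntry] at h3 h4
    rw [abs_of_pos h4]
    omega
  refine .seq ((colUpdate_spec (k₁ := k₁) (l := l) (by omega) (by omega) hD0 f18 f13 f21 rfl rfl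
    hdiag).mono ?_)
  rintro s₃ hs₃ ⟨h22, h24⟩
  have e27 : s₃ 27 0 = s₂ 27 0 := by rw [hs₃ 27 (by decide)]
  refine .of_bdd fun hb => .assign (hb 27 0) ⟨?_, fun f l' hfl => ?_⟩
  · simpa [Mem.write_apply, e27] using hstep _ _ h22 h24
  · simp only [Mem.write_apply]
    rw [if_neg (by simp), h22, if_neg (by omega), f22]

open AExp Prog in
/-- Processing of the congruence given by the row `i` (content of array `10`). -/
def congRow : Prog :=
  .seq (set 25 (var 21)) <| .seq (.forTo 39 (var 18) (.assign 24 (var 39) (.const 0))) <|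
  .seq (.forTo 13 (var 18) colProg) <|
  .seq (dotProg (var 18) (var 10) (.read 23 (var 39))) <|
  .seq (set 26 (read₂ 6 (var 10) (var 3) - var 26)) <|
  -- The remainder is positive exactly if the gcd does not divide the defect; then the failure flag
  -- in array `16` is set.
  .ifPos (modE (var 26) (var 25)) (set 16 (.const 1)) <|
    .seq (set 26 (var 26 / var 25)) <|
    .forTo 39 (var 18) (.assign 23 (var 39)
      (modE (.read 23 (var 39) + var 26 * .read 24 (var 39)) (var 21)))

open AExp Prog in
/-- Solving the congruences given by the rows with a pivot in an integer column. -/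
def congProg : Prog :=
  .forTo 10 (var 2) <|
    -- Positive exactly if the stored value is between `1` and `p`, that is, if the row has a pivot
    -- in an integer column.
    .ifPos (.read 8 (var 10) * (var 4 + .const 1 - .read 8 (var 10))) congRow .skip

end RAM

/-! ### Correctness of the congruence solver. -/

namespace RAM

variable {L : ℕ} {M : ℤ} {s : Mem} {I : MixedSystem} {A : ℕ → ℕ → ℤ} {rp cp fr pos : ℕ → ℕ}
  {k k₁ : ℕ}

open AExp in
-- The failure flag is never reset, and the lattice basis is updated even if the congruence cannot
-- be satisfied. Positions from `k₁` on are not touched; this later gives `IsExtended`.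
theorem congRow_spec {B : ℤ} (hlim : Limits I A rp L M B) {S : Set ℕ} {i : ℕ}
    (hT : TabMem I A rp cp k k₁ fr pos s) (hi : i < I.m) (h10 : s 10 0 = i)
    (hd : pivDet I.m A rp ≠ 0)
    (hst : I.IntState A rp k₁ fr S (fun f l => s 22 (addr f l)) (fun f => s 23 f) (s 16 0 = 0)) :
    WP L M congRow s (fun s' =>
      I.IntState A rp k₁ fr (insert i S) (fun f l => s' 22 (addr f l)) (fun f => s' 23 f)
        (s' 16 0 = 0) ∧
      (∀ f l', k₁ ≤ f ∨ k₁ ≤ l' → s' 22 (addr f l') = s 22 (addr f l')) ∧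
      (∀ f : ℕ, k₁ ≤ f → s' 23 f = s 23 f) ∧ (s' 16 0 = s 16 0 ∨ s' 16 0 = 1)) := by
  have hk1 := hT.free.enum.le
  have hkn := hT.k_le
  have hnL := hlim.cols_le
  have hLM := hlim.loop_le_mem
  have hBM := hlim.bound_le_mem
  have hB := hlim.one_le
  have hD0 : 0 < |pivDet I.m A rp| := abs_pos.mpr hd
  have hDB := hlim.det_le
  have hTf : ∀ s' : Mem, (∀ x ∈ [2, 3, 6, 7, 8, 9, 4, 17, 18, 19, 20, 21], s' x = s x) →
      TabMem I A rp cp k k₁ fr pos s' := fun s' => hT.of_frame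
  rw [MixedSystem.IntState] at hst
  refine .seq (.assign (by rw [eval_read, eval_const, hT.modulus, abs_abs]; omega) ?_)
  simp only [eval_read, eval_const, hT.modulus]
  refine .seq (.forTo k₁ (fun F s' => ∀ f : ℕ, f < F → s' 24 f = 0) (by omega) (by omega) ?_
    (by simp) ?_ ?_)
  · intro s' hs'
    simp [hs' 18 (by decide) (by decide), Mem.write_ne, hT.free.numInt]
  · intro F hF s' _ h39 hI
    refine .assign (by simp; omega) ⟨by simp [Mem.write_apply, h39], fun f hf => ?_⟩
    by_cases hfF : f = F
    · subst hfF
      simp [Mem.write_apply, h39]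
    · simp [Mem.write_apply, h39, hfF, hI f (by omega)]
  rintro s₁ hs₁ - h24
  have f₁ : ∀ x, x ≠ 39 → x ≠ 24 → x ≠ 25 → s₁ x = s x := by
    intro x h1 h2 h3
    rw [hs₁ x h1 (by simpa [Prog.mods] using h2), Mem.write_ne _ _ _ h3]
  have e25 : s₁ 25 0 = |pivDet I.m A rp| := by
    rw [hs₁ 25 (by decide) (by decide)]
    simp [Mem.write_apply]
  refine .seq (.forTo k₁ (fun l s' => ColState k₁ |pivDet I.m A rp|
      (congLat k₁ |pivDet I.m A rp| (fun i f => red I.m A rp i (fr f)) S)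
      (congLat k₁ |pivDet I.m A rp| (fun i f => red I.m A rp i (fr f)) (insert i S))
      (fun f => red I.m A rp i (fr f)) l (fun f l => s' 22 (addr f l)) (fun f => s' 24 f) (s' 25 0) ∧
      ∀ f l', k₁ ≤ f ∨ k₁ ≤ l' → s' 22 (addr f l') = s 22 (addr f l')) (by omega) (by omega)
      ?_ ?_ ?_ ?_)
  · intro s' hs'
    simp [hs' 18 (by decide) (by decide), f₁ 18, hT.free.numInt]
  · simp only [Mem.write_apply]
    simp only [Nat.reduceEqDiff, false_and, if_false, e25, f₁ 22 (by decide) (by decide) (by decide)]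
    exact ⟨.init _ hD0 hst.basis hst.N_bdd (fun z w => congLat_modEq) h24, fun _ _ _ => trivial⟩
  · rintro l hl s' hs' h13 ⟨hI, hext⟩
    have hT' : TabMem I A rp cp k k₁ fr pos s' := hTf s' fun x hx => by
      rw [hs' x (by rintro rfl; revert hx; decide) (by revert hx x; decide),
        f₁ x (by rintro rfl; revert hx; decide) (by rintro rfl; revert hx; decide)
        (by rintro rfl; revert hx; decide)]
    refine (colProg_spec hlim hT' hi ?_ h13 hl rfl hD0 rfl hI).mono ?_
    · rw [hs' 10 (by decide) (by decide), f₁ 10 (by decide) (by decide) (by decide), h10]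
    · rintro s'' hs'' ⟨hI', hext'⟩
      refine ⟨by rw [hs'' 13 (by decide), h13], ?_, fun f l' hfl => ?_⟩
      · simpa [Mem.write_ne] using hI'
      · rw [Mem.write_ne _ _ _ (by decide), hext' f l' hfl, hext f l' hfl]
  rintro s₂ hs₂ - ⟨hI, hext⟩
  have f₂ : ∀ x, x ≠ 13 → x ∉ colProg.mods → x ≠ 25 → s₂ x = s x := by
    intro x h1 h2 h3
    rw [hs₂ x h1 h2, f₁ x (fun h => h2 (by rw [h]; decide)) (fun h => h2 (by rw [h]; decide)) h3]
  refine .seq ((dotProg_spec (k := k₁) (i := i) (fr := fr)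
    (a := fun f => red I.m A rp i (fr f)) (X := fun f => s 23 f) (C := B * B)
    (by omega) (by omega) ?_ ?_ ?_ ?_ ?_ ?_ ?_).mono ?_)
  · have := hlim.mul_le_mem (k := k₁) (by omega)
    omega
  · intro s' hs'
    simp [hs' 18 (by decide) (by decide), f₂ 18 (by decide) (by decide) (by decide), hT.free.numInt]
  · intro s' hs'
    simp [hs' 10 (by decide) (by decide), f₂ 10 (by decide) (by decide) (by decide), h10]
  · intro f hf s' hs' h39
    simp [h39, hs' 23 (by decide) (by decide), f₂ 23 (by decide) (by decide) (by decide)]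
  · intro f hf
    rw [f₂ 19 (by decide) (by decide) (by decide)]
    exact hT.free.col f (by omega)
  · intro f hf
    rw [f₂ 6 (by decide) (by decide) (by decide)]
    exact hT.elim.tab i hi _ (hT.free.enum.fr_lt f (by omega)).le
  · intro f hf
    rw [abs_mul]
    exact mul_le_mul (hlim.red_le i _ (hT.free.enum.fr_lt f (by omega)).le)
      ((hst.z_bdd f hf).trans hDB) (abs_nonneg _) (by omega)
  intro s₃ hs₃ h26
  have f₃ : ∀ x, x ≠ 13 → x ∉ colProg.mods → x ≠ 25 → s₃ x = s x := by
    intro x h1 h2 h3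
    rw [hs₃ x ?_, f₂ x h1 h2 h3]
    intro h
    have h' : x = 26 ∨ x = 39 := by
      simp only [dotProg, Prog.forTo, Prog.mods, List.mem_append, List.mem_singleton] at h
      tauto
    rcases h' with rfl | rfl
    · exact h2 (by decide)
    · exact h2 (by decide)
  have hdot : |dotK k₁ (fun f => red I.m A rp i (fr f)) (fun f => s 23 f)| ≤ k₁ * (B * B) := by
    refine (Finset.abs_sum_le_sum_abs _ _).trans
      ((Finset.sum_le_card_nsmul _ _ (B * B) fun f hf => ?_).trans ?_)
    · rw [Finset.mem_range] at hf
      rw [abs_mul]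
      exact mul_le_mul (hlim.red_le i _ (hT.free.enum.fr_lt f (by omega)).le)
        ((hst.z_bdd f hf).trans hDB) (abs_nonneg _) (by omega)
    · rw [Finset.card_range, nsmul_eq_mul]
  obtain ⟨ρ, hρ⟩ : ∃ ρ, ρ = red I.m A rp i I.n -
      dotK k₁ (fun f => red I.m A rp i (fr f)) (fun f => s 23 f) := ⟨_, rfl⟩
  have hρM : |ρ| ≤ M := by
    rw [hρ]
    have := hlim.mul_le_mem (k := k₁) (by omega)
    have h1 := hlim.red_le i I.n le_rfl
    have := abs_sub (red I.m A rp i I.n)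
      (dotK k₁ (fun f => red I.m A rp i (fr f)) (fun f => s 23 f))
    omega
  have hval : (read₂ 6 (var 10) (var 3) - var 26).eval s₃ = ρ := by
    rw [eval_sub, eval_read₂ (a := i) (b := I.n), f₃ 6 (by decide) (by decide) (by decide),
      hT.elim.tab i hi _ le_rfl, eval_read, eval_const, h26, hρ]
    · rw [eval_read, eval_const, f₃ 10 (by decide) (by decide) (by decide), h10]
    · rw [eval_read, eval_const, f₃ 3 (by decide) (by decide) (by decide), hT.elim.cols]
  have g25 : s₃ 25 0 = s₂ 25 0 := by rw [hs₃ 25 (by decide)]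
  have g22 : s₃ 22 = s₂ 22 := by rw [hs₃ 22 (by decide)]
  have g24 : s₃ 24 = s₂ 24 := by rw [hs₃ 24 (by decide)]
  have g23 : s₃ 23 = s 23 := f₃ 23 (by decide) (by decide) (by decide)
  have g16 : s₃ 16 = s 16 := f₃ 16 (by decide) (by decide) (by decide)
  have g18 : s₃ 18 0 = k₁ := by rw [f₃ 18 (by decide) (by decide) (by decide), hT.free.numInt]
  have g21 : s₃ 21 0 = |pivDet I.m A rp| := by
    rw [f₃ 21 (by decide) (by decide) (by decide), hT.modulus]
  refine .seq (.assign (by rw [hval]; exact hρM) ?_)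
  rw [hval, eval_const]
  have hg := hI.g_pos
  have hcond : (modE (var 26) (var 25)).eval (s₃.write 26 0 ρ) = ρ % s₂ 25 0 := by
    simp [Mem.write_apply, g25]
  have hnn := Int.emod_nonneg ρ hg.ne'
  refine .ifPos (fun hpos => .assign (by simp; omega) ?_) (fun hneg => ?_)
  · rw [hcond] at hpos
    simp only [eval_const]
    have w22 : ((s₃.write 26 0 ρ).write 16 0 1) 22 = s₂ 22 := by simp [Mem.write_ne, g22]
    have w23 : ((s₃.write 26 0 ρ).write 16 0 1) 23 = s 23 := by simp [Mem.write_ne, g23]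
    have w16 : ((s₃.write 26 0 ρ).write 16 0 1) 16 0 = 1 := by simp [Mem.write_apply]
    rw [w22, w23, w16]
    refine ⟨hst.step_fail hI ?_ (by simp), hext, fun _ _ => rfl, Or.inr rfl⟩
    intro hdvd
    rw [← hρ] at hdvd
    exact hpos.ne' (Int.emod_eq_zero_of_dvd hdvd)
  · rw [hcond] at hneg
    have hdvd : s₂ 25 0 ∣ ρ := Int.dvd_of_emod_eq_zero (le_antisymm hneg hnn)
    have h1 : (var 26 / var 25).eval (s₃.write 26 0 ρ) = ρ / s₂ 25 0 := by
      simp [Mem.write_apply, g25]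
    refine .seq (.assign ?_ ?_)
    · rw [h1, Int.abs_eq_natAbs]
      rw [Int.abs_eq_natAbs] at hρM
      have := Int.natAbs_ediv_le_natAbs ρ (s₂ 25 0)
      omega
    rw [h1, eval_const]
    have f₄ : ∀ x, x ≠ 26 → ((s₃.write 26 0 ρ).write 26 0 (ρ / s₂ 25 0)) x = s₃ x := by
      intro x hx
      rw [Mem.write_ne _ _ _ hx, Mem.write_ne _ _ _ hx]
    refine .forTo k₁ (fun F s' => ∀ f : ℕ, s' 23 f = if f < F then
      (s 23 f + ρ / s₂ 25 0 * s₂ 24 f) % |pivDet I.m A rp| else s 23 f) (by omega) (by omega)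
      ?_ ?_ ?_ ?_
    · intro s' hs'
      rw [eval_read, eval_const, hs' 18 (by decide) (by decide), f₄ 18 (by decide), g18]
    · intro f
      rw [Mem.write_ne _ _ _ (by decide), f₄ 23 (by decide), g23, if_neg (Nat.not_lt_zero f)]
    · intro F hF s' hs' h39 hJ
      have hval' : (modE (.read 23 (var 39) + var 26 * .read 24 (var 39)) (var 21)).eval s' =
          (s 23 F + ρ / s₂ 25 0 * s₂ 24 F) % |pivDet I.m A rp| := by
        have e26 : s' 26 0 = ρ / s₂ 25 0 := by
          rw [hs' 26 (by decide) (by decide)]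
          simp [Mem.write_apply]
        have e24 : s' 24 = s₂ 24 := by rw [hs' 24 (by decide) (by decide), f₄ 24 (by decide), g24]
        have e21 : s' 21 0 = |pivDet I.m A rp| := by
          rw [hs' 21 (by decide) (by decide), f₄ 21 (by decide), g21]
        simp only [eval_modE, eval_add, eval_mul, eval_read, eval_const, h39, e26, e24, e21, hJ,
          lt_irrefl, if_false]
      refine .assign ?_ ⟨by simp [Mem.write_apply, h39], fun f => ?_⟩
      · rw [hval']
        exact (abs_emod_le hD0 _).trans (hDB.trans hBM)
      · rw [hval']
        by_cases hfF : f = F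
        · subst hfF
          simp [Mem.write_apply, h39]
        · have : f < F + 1 ↔ f < F := by omega
          simp only [Mem.write_apply, eval_read, eval_const, h39]
          simp [hfF, hJ, this]
    · intro s' hs' _ hJ
      have w22 : s' 22 = s₂ 22 := by rw [hs' 22 (by decide) (by decide), f₄ 22 (by decide), g22]
      have w16 : s' 16 = s 16 := by rw [hs' 16 (by decide) (by decide), f₄ 16 (by decide), g16]
      rw [w22, w16]
      refine ⟨hst.step_ok hI hD0 (by rwa [← hρ]) fun f hf => ?_, hext, fun f hf => ?_, Or.inl rfl⟩
      · rw [hJ, if_pos hf, hρ]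
      · rw [hJ, if_neg (by omega)]

open AExp in
theorem congProg_spec {B : ℤ} (hlim : Limits I A rp L M B)
    (hT : TabMem I A rp cp k k₁ fr pos s) (hd : pivDet I.m A rp ≠ 0)
    (h22 : ∀ f < k, ∀ l < k, s 22 (addr f l) = if f = l then 1 else 0) (h23 : ∀ f : ℕ, s 23 f = 0)
    (h16 : s 16 0 = 0) :
    WP L M congProg s (fun s' =>
      I.IntState A rp k₁ fr (I.intRows rp) (fun f l => s' 22 (addr f l)) (fun f => s' 23 f)
        (s' 16 0 = 0) ∧
      MixedSystem.IsExtended k k₁ (fun f l => s' 22 (addr f l)) (fun f => s' 23 f) ∧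
      (s' 16 0 = 0 ∨ s' 16 0 = 1)) := by
  have hLM := hlim.loop_le_mem
  have hm := hlim.rows_le
  have hle := hT.free.enum.le
  refine .forTo I.m (fun i s' => I.IntState A rp k₁ fr ({r | r < i} ∩ I.intRows rp)
      (fun f l => s' 22 (addr f l)) (fun f => s' 23 f) (s' 16 0 = 0) ∧
      MixedSystem.IsExtended k k₁ (fun f l => s' 22 (addr f l)) (fun f => s' 23 f) ∧
      (s' 16 0 = 0 ∨ s' 16 0 = 1)) hm (by omega) ?_ ?_ ?_ ?_
  · intro s' hs'
    simp [hs' 2 (by decide) (by decide), hT.elim.rows]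
  · have hS : {r | r < 0} ∩ I.intRows rp = ∅ := by simp
    rw [hS]
    simp only [Mem.write_apply]
    simp only [Nat.reduceEqDiff, false_and, if_false]
    refine ⟨.init (abs_pos.mpr hd) (fun f hf l hl => h22 f (by omega) l (by omega))
      (fun f _ => h23 f) h16, ⟨fun f hf l hl _ => h22 f hf l hl, fun f _ _ => h23 f⟩, Or.inl h16⟩
  · rintro i hi s' hs' h10 ⟨hI, hext, h16'⟩
    have hT' : TabMem I A rp cp k k₁ fr pos s' := hT.of_frame fun x hx => by
      rw [hs' x (by rintro rfl; revert hx; decide) (by revert hx x; decide)]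
    have hcond : (AExp.read 8 (var 10) * (var 4 + .const 1 - .read 8 (var 10))).eval s' =
        rp i * (I.p + 1 - rp i) := by
      simp [h10, hT'.elim.rowPiv i hi, hT'.ints]
    refine .ifPos (fun hpos => ?_) (fun hneg => .skip ⟨h10, ?_⟩)
    · rw [hcond] at hpos
      have hmem : i ∈ I.intRows rp := by
        have h1 : 0 < rp i := by
          by_contra h0
          simp [show rp i = 0 by omega] at hpos
        refine ⟨hi, h1, ?_⟩
        have := pos_of_mul_pos_right hpos (by positivity)
        omega
      have hS : {r | r < i + 1} ∩ I.intRows rp = insert i ({r | r < i} ∩ I.intRows rp) := by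
        ext r
        simp only [Set.mem_inter_iff, Set.mem_insert_iff, Set.mem_ofPred_eq, Nat.lt_succ_iff_lt_or_eq]
        constructor
        · rintro ⟨h | h, h'⟩
          · exact Or.inr ⟨h, h'⟩
          · exact Or.inl h
        · rintro (rfl | ⟨h, h'⟩)
          · exact ⟨Or.inr rfl, hmem⟩
          · exact ⟨Or.inl h, h'⟩
      refine (congRow_spec hlim hT' hi h10 hd hI).mono ?_
      rintro t hf ⟨h1, h2, h3, h4⟩
      refine ⟨by rw [hf 10 (by decide), h10], ?_⟩
      simp only [Mem.write_apply]
      simp only [Nat.reduceEqDiff, false_and, if_false]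
      refine ⟨by rw [hS]; exact h1, ⟨fun f hf l hl hfl => ?_, fun f hf hfk => ?_⟩, ?_⟩
      · rw [h2 f l hfl]
        exact hext.mat f hf l hl hfl
      · rw [h3 f hfk]
        exact hext.vec f hf hfk
      · rcases h4 with h4 | h4
        · rwa [h4]
        · exact Or.inr h4
    · rw [hcond] at hneg
      have hmem : i ∉ I.intRows rp := by
        rintro ⟨-, h1, h2⟩
        have : 0 < (rp i : ℤ) * (I.p + 1 - rp i) := mul_pos (by omega) (by omega)
        omega
      have hS : {r | r < i + 1} ∩ I.intRows rp = {r | r < i} ∩ I.intRows rp := by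
        ext r
        simp only [Set.mem_inter_iff, Set.mem_ofPred_eq, Nat.lt_succ_iff_lt_or_eq]
        refine ⟨fun ⟨h, h'⟩ => ⟨h.resolve_right ?_, h'⟩, fun ⟨h, h'⟩ => ⟨Or.inl h, h'⟩⟩
        rintro rfl
        exact hmem h'
      simp only [Mem.write_apply]
      simp only [Nat.reduceEqDiff, false_and, if_false]
      rw [hS]
      exact ⟨hI, hext, h16'⟩
  · rintro s' - - h
    have hS : {r | r < I.m} ∩ I.intRows rp = I.intRows rp :=
      Set.inter_eq_right.mpr fun r hr => hr.1
    rwa [hS] at h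

end RAM

/-! ### Writing the output -/

theorem encodeRat_div {a b : ℤ} (hb : 0 < b) :
    encodeRat ((a : ℚ) / b) = [a / Int.gcd b a, b / Int.gcd b a] := by
  rw [encodeRat, ← Rat.divInt_eq_div, Rat.num_divInt, Rat.den_divInt, if_neg hb.ne',
    Int.sign_eq_one_of_pos hb, one_mul]
  push_cast
  rw [abs_of_pos hb]

theorem List.ofFn_coe {α : Type*} (n : ℕ) (f : ℕ → α) :
    List.ofFn (fun i : Fin n => f i) = (List.range n).map f := by
  rw [List.ofFn_eq_map, ← List.map_coe_finRange_eq_range, List.map_map]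
  rfl

theorem List.length_flatMap_range {α : Type*} {c : ℕ} (n : ℕ) (f : ℕ → List α)
    (hf : ∀ i, (f i).length = c) : ((List.range n).flatMap f).length = n * c := by
  simp [List.length_flatMap, hf]

theorem encodeVec_coe (n : ℕ) (f : ℕ → ℚ) :
    encodeVec (fun i : Fin n => f i) = (List.range n).flatMap fun i => encodeRat (f i) := by
  rw [encodeVec, List.ofFn_coe, List.flatMap_map]

theorem encodeMat_coe (n k : ℕ) (f : ℕ → ℕ → ℚ) :
    encodeMat (Matrix.of fun (i : Fin n) (j : Fin k) => f i j) =
      (List.range n).flatMap fun i => (List.range k).flatMap fun j => encodeRat (f i j) := by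
  have h := List.ofFn_coe n (fun i (j : Fin k) => f i j)
  rw [encodeMat]
  refine (congrArg (List.flatMap encodeVec) h).trans ?_
  rw [List.flatMap_map]
  simp only [encodeVec_coe]

namespace RAM

variable {L : ℕ} {M : ℤ} {s : Mem}

theorem HoldsOutput.congr {s' : Mem} {l : List ℤ} (h : HoldsOutput s l) (h0 : s' 0 = s 0)
    (h1 : s' 1 = s 1) : HoldsOutput s' l := by
  rwa [HoldsOutput, h0, h1]

open AExp Prog in
/-- Append the value of `e` to the output. -/
def emit (e : AExp) : Prog := .seq (.assign 0 (var 1) e) (set 1 (var 1 + .const 1))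

open AExp in
theorem emit_spec {e : AExp} {l : List ℤ} (h : HoldsOutput s l) (hl : (l.length : ℤ) + 1 ≤ M)
    (he : |e.eval s| ≤ M) : WP L M (emit e) s (fun s' => HoldsOutput s' (l ++ [e.eval s])) := by
  refine .seq (.assign he (.assign ?_ ⟨?_, fun i hi => ?_⟩))
  · simp [Mem.write_apply, h.1, abs_le]
    omega
  · simp [Mem.write_apply, h.1]
  · rw [List.length_append, List.length_singleton] at hi
    simp only [Mem.write_apply, eval_read, eval_const, h.1]
    simp only [zero_ne_one, false_and, if_false, true_and,
      Nat.cast_inj]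
    by_cases hil : i = l.length
    · subst hil
      simp
    · rw [if_neg hil, h.2 i (by omega), List.getD_append _ _ _ _ (by omega)]

open AExp Prog in
/-- Append the quotient of the contents of the arrays `37` and `38` in lowest terms. -/
def emitRat : Prog :=
  .seq (.ifPos (.const 0 - var 38)
    (.seq (set 37 (.const 0 - var 37)) (set 38 (.const 0 - var 38))) .skip) <|
  .seq (set 27 (var 38)) <| .seq (set 28 (modE (var 37) (var 38))) <|
  .seq xgcd <| .seq (emit (var 37 / var 27)) (emit (var 38 / var 27))

open AExp in
-- After making the denominator positive, the numerator is reduced modulo it before the Euclidean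
-- algorithm. So the number of rounds depends on `B` only, though the numerator may be as large as
-- `M`. The modulus in array `21` merely has to be positive, as the coefficients computed along with
-- the gcd are discarded.
theorem emitRat_spec {a b B : ℤ} {l : List ℤ} (h : HoldsOutput s l) (hl : (l.length : ℤ) + 2 ≤ M)
    (h21 : 0 < s 21 0) (ha : s 37 0 = a) (hb : s 38 0 = b) (hb0 : b ≠ 0) (hbB : |b| ≤ B)
    (hL : 2 * (B * B) < 2 ^ L) :
    WP L M emitRat s (fun s' => HoldsOutput s' (l ++ encodeRat ((a : ℚ) / b))) := by
  refine .of_bdd fun hbd => ?_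
  have haM : |a| ≤ M := ha ▸ hbd 37 0
  have hbM : |b| ≤ M := hb ▸ hbd 38 0
  refine .seq (WP.mono (Q := fun s' => ∃ a' b' : ℤ, 0 < b' ∧ |a'| = |a| ∧ b' = |b| ∧
      (a : ℚ) / b = (a' : ℚ) / b' ∧ s' 37 0 = a' ∧ s' 38 0 = b') (.ifPos (fun hpos => ?_)
        (fun hneg => .skip ⟨a, b, ?_⟩)) ?_)
  · simp only [eval_sub, eval_const, eval_read, hb] at hpos
    refine .seq (.assign (by simpa [ha] using haM) (.assign ?_ ⟨-a, -b, by omega, abs_neg a,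
      (abs_of_neg (by omega)).symm, by push_cast; rw [neg_div_neg_eq], ?_, ?_⟩))
    · simpa [Mem.write_apply, hb] using hbM
    · simp [Mem.write_apply, ha]
    · simp [Mem.write_apply, hb]
  · simp only [eval_sub, eval_const, eval_read, hb] at hneg
    have h0 : 0 < b := by omega
    exact ⟨h0, rfl, (abs_of_pos h0).symm, rfl, ha, hb⟩
  rintro s₁ hs₁ ⟨a', b', hb', haa, hbb, hq, e37, e38⟩
  have e21 : s₁ 21 0 = s 21 0 := by rw [hs₁ 21 (by decide)]
  have hr0 : 0 ≤ a' % b' := Int.emod_nonneg _ hb'.ne'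
  have hrb : a' % b' < b' := Int.emod_lt_of_pos _ hb'
  refine .seq (.assign (by simp [e38, abs_le]; omega) ?_)
  refine .seq (.assign (by simp [Mem.write_apply, e37, e38, abs_le]; omega) ?_)
  refine .seq ((xgcd_spec (g := b') (c := a' % b') (D := s 21 0) ?_ ?_ ?_ hb' hr0 h21 ?_).mono ?_)
  · simp [Mem.write_apply, e38]
  · simp [Mem.write_apply, e37, e38]
  · simp [Mem.write_apply, e21]
  · refine lt_of_le_of_lt ?_ hL
    have := mul_le_mul (hbb.le.trans hbB) (hrb.le.trans (hbb.le.trans hbB)) hr0 (by omega)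
    omega
  rintro s₂ hs₂ ⟨h27, -⟩
  rw [Int.gcd_comm, Int.gcd_emod, Int.gcd_comm] at h27
  have f37 : s₂ 37 0 = a' := by rw [hs₂ 37 (by decide)]; simp [Mem.write_apply, e37]
  have f38 : s₂ 38 0 = b' := by rw [hs₂ 38 (by decide)]; simp [Mem.write_apply, e38]
  have hout : HoldsOutput s₂ l := by
    refine h.congr ?_ ?_
    · rw [hs₂ 0 (by decide)]
      simp [Mem.write_ne, hs₁ 0 (by decide)]
    · rw [hs₂ 1 (by decide)]
      simp [Mem.write_ne, hs₁ 1 (by decide)]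
  have hdiv : ∀ x y : ℤ, |x / y| ≤ |x| := fun x y => by
    rw [Int.abs_eq_natAbs, Int.abs_eq_natAbs]
    exact_mod_cast Int.natAbs_ediv_le_natAbs x y
  refine .seq ((emit_spec hout (by omega) ?_).mono ?_)
  · simp only [eval_div, eval_read, eval_const, f37]
    exact (hdiv _ _).trans (haa.le.trans haM)
  · intro s₃ hs₃ hout₃
    have g : ∀ x, x ≠ 0 → x ≠ 1 → s₃ x = s₂ x := fun x h0 h1 =>
      hs₃ x (by simp [emit, Prog.mods, h0, h1])
    refine (emit_spec hout₃ (by rw [List.length_append]; simp; omega) ?_).mono ?_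
    · simp only [eval_div, eval_read, eval_const, g 38 (by decide) (by decide), f38]
      refine (hdiv _ _).trans ?_
      rw [abs_of_pos hb', hbb]
      exact hbM
    · intro s₄ _ hout₄
      rw [hq, encodeRat_div hb']
      simp only [eval_div, eval_read, eval_const, g 38 (by decide) (by decide),
        g 27 (by decide) (by decide), f37, f38, h27] at hout₄
      simpa using hout₄

variable {I : MixedSystem} {A : ℕ → ℕ → ℤ} {rp cp fr pos : ℕ → ℕ} {k k₁ : ℕ}

open AExp Prog in
/-- Append the value of the variable `j` (content of array `11`) in a solution to the output. -/
def entryProg (x : AExp) (ρ : ℤ) : Prog :=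
  .seq (.ifPos (.read 9 (var 11))
    (.seq (dotProg (var 17) (.read 9 (var 11) - .const 1) x) <|
      .seq (set 37 (.const ρ * read₂ 6 (.read 9 (var 11) - .const 1) (var 3) - var 26))
        (set 38 (var 7)))
    (.seq (set 39 (.read 20 (var 11))) <| .seq (set 37 x) (set 38 (.const 1)))) emitRat

open AExp in
-- A pivot variable is a scalar product over the determinant. For a free variable, array `39` is set
-- to its position by hand, so that the same expression `x` yields its value, with denominator `1`.
theorem entryProg_spec {x : AExp} {ρ B : ℤ} {X : ℕ → ℤ} {j : ℕ} {l : List ℤ}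
    (hlim : Limits I A rp L M B) (hT : TabMem I A rp cp k k₁ fr pos s)
    (hE : ElimState I.m I.n A rp cp 0 0) (h11 : s 11 0 = j) (hj : j < I.n)
    (hx : ∀ f < k, ∀ s' : Mem, (∀ y, y ≠ 26 → y ≠ 39 → s' y = s y) → s' 39 0 = f → x.eval s' = X f)
    (hX : ∀ f < k, |X f| ≤ B) (hρ : |ρ| ≤ 1) (h : HoldsOutput s l) (hl : (l.length : ℤ) + 2 ≤ M) :
    WP L M (entryProg x ρ) s (fun s' => HoldsOutput s' (l ++
      encodeRat (I.solve A rp cp k fr pos (fun f => (X f : ℚ)) ρ j))) := by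
  have hkn := hT.k_le
  have hnL := hlim.cols_le
  have hLM := hlim.loop_le_mem
  have hBM := hlim.bound_le_mem
  have hB := hlim.one_le
  have hmul := hlim.mul_le_mem (k := k) (by omega)
  have hd := hE.det_ne
  have h21 : 0 < s 21 0 := by
    rw [hT.modulus]
    exact abs_pos.mpr hd
  have e9 : (AExp.read 9 (var 11)).eval s = cp j := by simp [h11, hT.elim.colPiv j hj]
  refine .seq (WP.mono (Q := fun s' => s' 21 = s 21 ∧ s' 0 = s 0 ∧ s' 1 = s 1 ∧
    ∃ a b : ℤ, s' 37 0 = a ∧ s' 38 0 = b ∧ b ≠ 0 ∧ |b| ≤ B ∧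
    I.solve A rp cp k fr pos (fun f => (X f : ℚ)) ρ j = (a : ℚ) / b)
    (.ifPos (fun hpos => ?_) (fun hneg => ?_)) ?_)
  · rw [e9] at hpos
    have hc : cp j ≠ 0 := by omega
    obtain ⟨hi, hrp⟩ := hE.cp_eq hj hc
    have hbd : ∀ f < k, |red I.m A rp (cp j - 1) (fr f) * X f| ≤ B * B := by
      intro f hf
      rw [abs_mul]
      exact mul_le_mul (hlim.red_le _ _ (hT.free.enum.fr_lt f hf).le) (hX f hf) (abs_nonneg _)
        (by omega)
    have hrow : ∀ s' : Mem, s' 9 = s 9 → s' 11 = s 11 →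
        (AExp.read 9 (var 11) - AExp.const 1).eval s' = ((cp j - 1 : ℕ) : ℤ) := by
      intro s' h9 h11'
      rw [eval_sub, eval_const, AExp.eval_read, h9]
      simp only [eval_read, eval_const] at e9
      simp only [eval_read, eval_const, h11', e9]
      omega
    refine .seq ((dotProg_spec (k := k) (i := cp j - 1) (fr := fr)
      (a := fun f => red I.m A rp (cp j - 1) (fr f)) (X := X) (C := B * B) (by omega) (by omega)
      (by omega) ?_ ?_ hx hT.free.col ?_ hbd).mono ?_)
    · intro s' hs'
      rw [eval_read, eval_const, hs' 17 (by decide) (by decide), hT.free.num]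
    · intro s' hs'
      exact hrow s' (hs' 9 (by decide) (by decide)) (hs' 11 (by decide) (by decide))
    · exact fun f hf => hT.elim.tab _ hi _ (hT.free.enum.fr_lt f hf).le
    intro s₁ hs₁ h26
    have g : ∀ y, y ≠ 26 → y ≠ 39 → s₁ y = s y := by
      intro y h1 h2
      refine hs₁ y ?_
      simp only [dotProg, Prog.forTo, Prog.mods, List.mem_append, List.mem_singleton]
      tauto
    have hdot : |dotK k (fun f => red I.m A rp (cp j - 1) (fr f)) X| ≤ k * (B * B) := by
      refine (Finset.abs_sum_le_sum_abs _ _).trans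
        ((Finset.sum_le_card_nsmul _ _ (B * B) fun f hf => ?_).trans ?_)
      · exact hbd f (Finset.mem_range.mp hf)
      · rw [Finset.card_range, nsmul_eq_mul]
    have hval : (AExp.const ρ * read₂ 6 (.read 9 (var 11) - .const 1) (var 3) - var 26).eval s₁ =
        ρ * red I.m A rp (cp j - 1) I.n -
          dotK k (fun f => red I.m A rp (cp j - 1) (fr f)) X := by
      rw [eval_sub, eval_mul, eval_const, eval_read₂ (hrow s₁ (g 9 (by decide) (by decide))
        (g 11 (by decide) (by decide))) (b := I.n), g 6 (by decide) (by decide),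
        hT.elim.tab _ hi _ le_rfl, eval_read, eval_const, h26]
      rw [eval_read, eval_const, g 3 (by decide) (by decide), hT.elim.cols]
    have h7 : s₁ 7 0 = pivDet I.m A rp := by rw [g 7 (by decide) (by decide), hT.elim.det]
    refine .seq (.assign ?_ ?_)
    · rw [hval]
      have h1 := hlim.red_le (cp j - 1) I.n le_rfl
      have h2 := abs_sub (ρ * red I.m A rp (cp j - 1) I.n)
        (dotK k (fun f => red I.m A rp (cp j - 1) (fr f)) X)
      have h3 : |ρ * red I.m A rp (cp j - 1) I.n| ≤ 1 * B := by
        rw [abs_mul]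
        exact mul_le_mul hρ h1 (abs_nonneg _) (by omega)
      omega
    · rw [hval]
      refine .assign ?_ ⟨?_, ?_, ?_, _, _, rfl, rfl, ?_, ?_, ?_⟩
      · simpa [Mem.write_apply, h7] using hlim.det_le.trans hBM
      · simp [Mem.write_ne, g 21]
      · simp [Mem.write_ne, g 0]
      · simp [Mem.write_ne, g 1]
      · simpa [Mem.write_apply, h7] using hd
      · simpa [Mem.write_apply, h7] using hlim.det_le
      · rw [MixedSystem.solve, complete, if_neg hc]
        simp [Mem.write_apply, h7, dotK]
  · rw [e9] at hneg
    have hc : cp j = 0 := by omega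
    have hp := hT.free.enum.pos_lt j hj hc
    have e20 : (AExp.read 20 (var 11)).eval s = pos j := by simp [h11, hT.free.inv j hj hc]
    refine .seq (.assign (by rw [e20, abs_le]; omega) ?_)
    have hxe : x.eval (s.write 39 0 (pos j)) = X (pos j) :=
      hx _ hp _ (fun y _ h2 => Mem.write_ne _ _ _ h2) (by simp [Mem.write_apply])
    rw [e20, eval_const]
    refine .seq (.assign (by rw [hxe]; exact (hX _ hp).trans hBM) ?_)
    rw [hxe]
    refine .assign (by simp; omega) ⟨?_, ?_, ?_, _, _, rfl, rfl, ?_, ?_, ?_⟩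
    · simp [Mem.write_ne]
    · simp [Mem.write_ne]
    · simp [Mem.write_ne]
    · simp [Mem.write_apply]
    · simpa [Mem.write_apply] using hB
    · rw [MixedSystem.solve, complete, if_pos hc]
      simp [Mem.write_apply]
  rintro s₁ - ⟨e21, e0, e1, a, b, ha, hb, hb0, hbB, hq⟩
  rw [hq]
  exact emitRat_spec (h.congr e0 e1) hl (by rwa [e21]) ha hb hb0 hbB hlim.loop_le

end RAM

/-! ### Output of the parametrization. -/

namespace RAM

variable {L : ℕ} {M : ℤ} {s : Mem} {I : MixedSystem} {A : ℕ → ℕ → ℤ} {rp cp fr pos : ℕ → ℕ}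
  {k k₁ : ℕ}

open AExp Prog in
/-- Write the solution of the system to the output. -/
def solutionProg : Prog :=
  .seq (set 1 (.const 0)) <| .seq (emit (.const 1)) <| .seq (emit (var 17)) <|
  .seq (.forTo 11 (var 3) (entryProg (.read 23 (var 39)) 1)) <|
  .forTo 11 (var 3) <| .forTo 13 (var 17) (entryProg (read₂ 22 (var 39) (var 13)) 0)

open AExp Prog in
/-- Write the output. -/
def outProg : Prog :=
  -- The flags report an unsolvable congruence and an inconsistent equation, respectively.
  .ifPos (var 16 + var 36) (.seq (set 1 (.const 0)) (emit (.const 0))) solutionProg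

theorem holdsOutput_write_nil (s : Mem) : HoldsOutput (s.write 1 0 0) [] :=
  ⟨by simp [Mem.write_apply], fun i hi => by simp at hi⟩

open AExp in
-- The output overwrites the input in array `0`, which is no longer needed. Its length is itself
-- kept in the memory, whence the condition `hM`.
theorem solutionProg_spec {B : ℤ} (hlim : Limits I A rp L M B)
    (hT : TabMem I A rp cp k k₁ fr pos s) (hE : ElimState I.m I.n A rp cp 0 0)
    (hN : ∀ f < k, ∀ l < k, |s 22 (addr f l)| ≤ B) (hz : ∀ f < k, |s 23 f| ≤ B)
    (hM : (2 + I.n * 2 + I.n * (k * 2) : ℕ) ≤ M) :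
    WP L M solutionProg s (fun s' => HoldsOutput s' ([1, (k : ℤ)] ++
      ((List.range I.n).flatMap fun j =>
        encodeRat (I.solve A rp cp k fr pos (fun f => (s 23 f : ℚ)) (1 : ℤ) j)) ++
      (List.range I.n).flatMap fun j => (List.range k).flatMap fun l =>
        encodeRat (I.solve A rp cp k fr pos (fun f => (s 22 (addr f l) : ℚ)) (0 : ℤ) j))) := by
  have hkn := hT.k_le
  have hnL := hlim.cols_le
  have hLM := hlim.loop_le_mem
  have hlen₁ : ∀ j : ℕ, ((List.range j).flatMap fun j =>
      encodeRat (I.solve A rp cp k fr pos (fun f => (s 23 f : ℚ)) (1 : ℤ) j)).length = j * 2 :=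
    fun j => List.length_flatMap_range _ _ fun _ => rfl
  have hlen₂ : ∀ j l : ℕ, ((List.range l).flatMap fun l => encodeRat
      (I.solve A rp cp k fr pos (fun f => (s 22 (addr f l) : ℚ)) (0 : ℤ) j)).length = l * 2 :=
    fun j l => List.length_flatMap_range _ _ fun _ => rfl
  have hlen₃ : ∀ j : ℕ, ((List.range j).flatMap fun j => (List.range k).flatMap fun l => encodeRat
      (I.solve A rp cp k fr pos (fun f => (s 22 (addr f l) : ℚ)) (0 : ℤ) j)).length = j * (k * 2) :=
    fun j => List.length_flatMap_range _ _ fun _ => hlen₂ _ _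
  refine .seq (.assign (by simp; omega) (.seq ((emit_spec (holdsOutput_write_nil s)
    (by simp; omega) (by simp; omega)).mono ?_)))
  intro s₁ hs₁ h₁
  have f₁ : ∀ x, x ≠ 0 → x ≠ 1 → s₁ x = s x := fun x h0 h1 => by
    rw [hs₁ x (by simp [emit, Prog.mods, h0, h1])]
    exact Mem.write_ne _ _ _ h1
  have e17 : (var 17).eval s₁ = k := by
    simp [f₁ 17, hT.free.num]
  refine .seq ((emit_spec h₁ (by simp; omega) (by rw [e17, abs_le]; omega)).mono ?_)
  rw [e17]
  intro s₂ hs₂ h₂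
  have f₂ : ∀ x, x ≠ 0 → x ≠ 1 → s₂ x = s x := fun x h0 h1 => by
    rw [hs₂ x (by simp [emit, Prog.mods, h0, h1]), f₁ x h0 h1]
  have h₂' : HoldsOutput s₂ [1, (k : ℤ)] := h₂
  have hT₂ : TabMem I A rp cp k k₁ fr pos s₂ := hT.of_frame fun x hx =>
    f₂ x (by rintro rfl; revert hx; decide) (by rintro rfl; revert hx; decide)
  refine .seq (.forTo I.n (fun j s' => HoldsOutput s' ([1, (k : ℤ)] ++
      (List.range j).flatMap fun j =>
        encodeRat (I.solve A rp cp k fr pos (fun f => (s 23 f : ℚ)) (1 : ℤ) j)))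
      hnL (by omega) ?_ ?_ ?_ ?_)
  · intro s' hs'
    simp [hs' 3 (by decide) (by decide), hT₂.elim.cols]
  · simpa using h₂'.congr (Mem.write_ne _ _ _ (by decide)) (Mem.write_ne _ _ _ (by decide))
  · intro j hj s' hs' h11 hI
    have hT' : TabMem I A rp cp k k₁ fr pos s' := hT₂.of_frame fun x hx => by
      rw [hs' x (by rintro rfl; revert hx; decide) (by revert hx x; decide)]
    have e23 : s' 23 = s 23 := by
      rw [hs' 23 (by decide) (by decide), f₂ 23 (by decide) (by decide)]
    refine (entryProg_spec (X := fun f => s 23 f) hlim hT' hE h11 hj ?_ hz (by simp) hI ?_).mono ?_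
    · intro f _ t ht h39
      simp [h39, ht 23, e23]
    · rw [List.length_append, hlen₁]
      simp only [List.length_cons, List.length_nil]
      have : 2 + I.n * 2 ≤ 2 + I.n * 2 + I.n * (k * 2) := by omega
      omega
    · intro t ht h
      refine ⟨by rw [ht 11 (by decide), h11], ?_⟩
      rw [List.range_succ, List.flatMap_append, ← List.append_assoc, List.flatMap_singleton]
      exact h.congr (Mem.write_ne _ _ _ (by decide)) (Mem.write_ne _ _ _ (by decide))
  intro s₃ hs₃ _ h₃
  have f₃ : ∀ x, x ≠ 0 → x ≠ 1 → x ≠ 11 → x ∉ (entryProg (.read 23 (var 39)) 1).mods →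
      s₃ x = s x := fun x h0 h1 h2 h3 => by
    rw [hs₃ x h2 h3, f₂ x h0 h1]
  have hT₃ : TabMem I A rp cp k k₁ fr pos s₃ := hT₂.of_frame fun x hx => by
    rw [hs₃ x (by rintro rfl; revert hx; decide) (by revert hx x; decide)]
  refine .forTo I.n (fun j s' => HoldsOutput s' ([1, (k : ℤ)] ++
      ((List.range I.n).flatMap fun j =>
        encodeRat (I.solve A rp cp k fr pos (fun f => (s 23 f : ℚ)) (1 : ℤ) j)) ++
      (List.range j).flatMap fun j => (List.range k).flatMap fun l =>
        encodeRat (I.solve A rp cp k fr pos (fun f => (s 22 (addr f l) : ℚ)) (0 : ℤ) j)))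
      hnL (by omega) ?_ ?_ ?_ ?_
  · intro s' hs'
    simp [hs' 3 (by decide) (by decide), hT₃.elim.cols]
  · simpa using h₃.congr (Mem.write_ne _ _ _ (by decide)) (Mem.write_ne _ _ _ (by decide))
  · intro j hj s' hs' h11 hI
    have hT' : TabMem I A rp cp k k₁ fr pos s' := hT₃.of_frame fun x hx => by
      rw [hs' x (by rintro rfl; revert hx; decide) (by revert hx x; decide)]
    have e22 : s' 22 = s 22 := by
      rw [hs' 22 (by decide) (by decide), f₃ 22 (by decide) (by decide) (by decide) (by decide)]
    refine .forTo k (fun l s' => s' 11 0 = j ∧ HoldsOutput s' ([1, (k : ℤ)] ++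
      ((List.range I.n).flatMap fun j =>
        encodeRat (I.solve A rp cp k fr pos (fun f => (s 23 f : ℚ)) (1 : ℤ) j)) ++
      ((List.range j).flatMap fun j => (List.range k).flatMap fun l =>
        encodeRat (I.solve A rp cp k fr pos (fun f => (s 22 (addr f l) : ℚ)) (0 : ℤ) j)) ++
      (List.range l).flatMap fun l =>
        encodeRat (I.solve A rp cp k fr pos (fun f => (s 22 (addr f l) : ℚ)) (0 : ℤ) j)))
      (by omega) (by omega) ?_ ?_ ?_ ?_
    · intro t ht
      simp [ht 17 (by decide) (by decide), hT'.free.num]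
    · refine ⟨by simp [Mem.write_apply, h11], ?_⟩
      simpa using hI.congr (Mem.write_ne _ _ _ (by decide)) (Mem.write_ne _ _ _ (by decide))
    · rintro l hl t ht h13 ⟨h11', hI'⟩
      have hT'' : TabMem I A rp cp k k₁ fr pos t := hT'.of_frame fun x hx => by
        rw [ht x (by rintro rfl; revert hx; decide) (by revert hx x; decide)]
      have e22' : t 22 = s 22 := by rw [ht 22 (by decide) (by decide), e22]
      refine (entryProg_spec (X := fun f => s 22 (addr f l)) hlim hT'' hE h11' hj ?_
        (fun f hf => hN f hf l hl) (by simp) hI' ?_).mono ?_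
      · intro f _ u hu h39
        rw [eval_read₂ (a := f) (b := l), hu 22 (by decide) (by decide), e22']
        · simpa using h39
        · simp [hu 13, h13]
      · rw [List.length_append, List.length_append, List.length_append, hlen₁, hlen₂, hlen₃]
        simp only [List.length_cons, List.length_nil]
        have h1 : (j + 1) * (k * 2) ≤ I.n * (k * 2) := Nat.mul_le_mul_right _ hj
        rw [add_mul, one_mul] at h1
        omega
      · intro u hu h
        refine ⟨by rw [hu 13 (by decide), h13], ?_, ?_⟩
        · rw [Mem.write_ne _ _ _ (by decide), hu 11 (by decide), h11']
        rw [List.range_succ (n := l), List.flatMap_append, ← List.append_assoc,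
          List.flatMap_singleton]
        exact h.congr (Mem.write_ne _ _ _ (by decide)) (Mem.write_ne _ _ _ (by decide))
    · rintro t - - ⟨h11', h⟩
      refine ⟨h11', ?_⟩
      rw [List.range_succ (n := j), List.flatMap_append, ← List.append_assoc,
        List.flatMap_singleton]
      exact h.congr (Mem.write_ne _ _ _ (by decide)) (Mem.write_ne _ _ _ (by decide))
  · exact fun s' _ _ h => h

theorem encodeOption_solMap (hk : k = I.n') (N : ℕ → ℕ → ℤ) (z : ℕ → ℤ) :
    RatAffineMap.encodeOption (some (I.solMap A rp cp k fr pos N z)) = [1, (k : ℤ)] ++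
      ((List.range I.n).flatMap fun j =>
        encodeRat (I.solve A rp cp k fr pos (fun f => (z f : ℚ)) (1 : ℤ) j)) ++
      (List.range I.n).flatMap fun j => (List.range k).flatMap fun l =>
        encodeRat (I.solve A rp cp k fr pos (fun f => (N f l : ℚ)) (0 : ℤ) j) := by
  subst hk
  rw [RatAffineMap.encodeOption, MixedSystem.solMap, Int.cast_one, Int.cast_zero]
  dsimp only
  rw [encodeVec_coe I.n fun j => I.solve A rp cp I.n' fr pos (fun f => (z f : ℚ)) 1 j,
    encodeMat_coe I.n I.n' fun j l => I.solve A rp cp I.n' fr pos (fun f => (N f l : ℚ)) 0 j]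

end RAM

/-! ### The complete algorithm -/

namespace MixedSystem

variable (I : MixedSystem)

/-- Bound for the entries of the tableaux. -/
def tabBound : ℕ := 2 ^ (3 * (I.size * I.size))

/-- Bound for the number of steps of a loop. -/
def loopBound : ℕ := 2 + 2 * I.size + 6 * (I.size * I.size)

/-- Bound for the numbers in the memory. -/
def memBound : ℕ := (I.loopBound + 1) * (I.tabBound * I.tabBound)

/-- Of the exponent `3 * size²`, one third accounts for `m! ≤ m ^ m` and two thirds for the power of
the bound on the scaled coefficients. -/
theorem factorial_mul_pow_le :
    (I.m.factorial : ℤ) * (2 ^ I.size * 2 ^ I.size) ^ I.m ≤ I.tabBound := by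
  have hm := I.m_le_size
  have h1 : I.m.factorial ≤ 2 ^ (I.size * I.size) := by
    refine (Nat.factorial_le_pow _).trans
      ((pow_le_pow_left₀ (b := 2 ^ I.size) (Nat.zero_le _) ?_ _).trans ?_)
    · exact hm.trans Nat.lt_two_pow_self.le
    · rw [← pow_mul]
      exact Nat.pow_le_pow_right two_pos (Nat.mul_le_mul_left _ hm)
  have h2 : ((2 : ℕ) ^ I.size * 2 ^ I.size) ^ I.m ≤ 2 ^ (2 * (I.size * I.size)) := by
    rw [← pow_add, ← pow_mul]
    refine Nat.pow_le_pow_right two_pos ?_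
    rw [← two_mul, mul_assoc]
    exact Nat.mul_le_mul_left _ (Nat.mul_le_mul_left _ hm)
  have h3 := Nat.mul_le_mul h1 h2
  rw [← pow_add (2 : ℕ) (I.size * I.size),
    show I.size * I.size + 2 * (I.size * I.size) = 3 * (I.size * I.size) by ring] at h3
  exact_mod_cast h3

theorem abs_red_intCoeff_le {rp : ℕ → ℕ} (hrp : ∀ i < I.m, rp i ≤ I.n) (i : ℕ) {l : ℕ}
    (hl : l ≤ I.n) : |red I.m I.intCoeff rp i l| ≤ I.tabBound :=
  (abs_red_le (one_le_mul_of_one_le_of_one_le (one_le_pow₀ one_le_two) (one_le_pow₀ one_le_two))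
    (fun _ hi _ _ => I.abs_intCoeff_le hi) hrp hl).trans I.factorial_mul_pow_le

theorem abs_pivDet_intCoeff_le {rp : ℕ → ℕ} (hrp : ∀ i < I.m, rp i ≤ I.n) :
    |pivDet I.m I.intCoeff rp| ≤ I.tabBound :=
  (abs_pivDet_le (one_le_mul_of_one_le_of_one_le (one_le_pow₀ one_le_two)
    (one_le_pow₀ one_le_two)) (fun _ hi _ _ => I.abs_intCoeff_le hi) hrp).trans
    I.factorial_mul_pow_le

theorem size_le_sq : I.size ≤ I.size * I.size := Nat.le_mul_self _

/-- The leading terms `2 + 6 * size²` of `loopBound` are dictated by the Euclidean algorithm on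
numbers up to `tabBound`. Together with the linear term they also exceed the dimensions and the
output length. -/
theorem limits {rp : ℕ → ℕ} (hrp : ∀ i < I.m, rp i ≤ I.n) :
    RAM.Limits I I.intCoeff rp I.loopBound I.memBound I.tabBound where
  red_le i _ hl := I.abs_red_intCoeff_le hrp i hl
  det_le := I.abs_pivDet_intCoeff_le hrp
  one_le := by exact_mod_cast Nat.one_le_two_pow
  rows_le := by
    have := I.m_le_size
    rw [loopBound]
    omega
  cols_le := by
    have := I.n_le_size
    rw [loopBound]
    omega
  loop_le := by
    have : 2 * (I.tabBound * I.tabBound) < 2 ^ I.loopBound := by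
      rw [tabBound, ← pow_add, ← pow_succ', loopBound]
      exact Nat.pow_lt_pow_right one_lt_two (by omega)
    exact_mod_cast this
  mem_le := by
    rw [memBound]
    push_cast
    exact le_rfl

theorem two_pow_mul_two_pow_le : 2 ^ I.size * 2 ^ I.size ≤ I.memBound := by
  refine le_trans ?_ (Nat.le_mul_of_pos_left _ (Nat.succ_pos _))
  have h : 2 ^ I.size ≤ I.tabBound :=
    Nat.pow_le_pow_right two_pos (by have := I.size_le_sq; omega)
  exact Nat.mul_le_mul h h

theorem loopBound_lt_memBound : I.loopBound + 1 ≤ I.memBound :=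
  Nat.le_mul_of_pos_right _ (by simp [tabBound])

/-- The memory bound is exponential in the size, but its length is only quadratic. -/
theorem bits_memBound_le : RAM.bits I.memBound ≤ 4 + 2 * I.size + 12 * (I.size * I.size) := by
  rw [show 4 + 2 * I.size + 12 * (I.size * I.size) =
    I.loopBound + 1 + 2 * (3 * (I.size * I.size)) + 1 by rw [loopBound]; ring, RAM.bits_le_iff,
    Int.natAbs_natCast, memBound, tabBound, pow_add _ (I.loopBound + 1),
    two_mul (3 * (I.size * I.size)), pow_add _ (3 * (I.size * I.size))]
  exact Nat.mul_lt_mul_of_pos_right Nat.lt_two_pow_self (by positivity)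

theorem abs_encode_le {e : ℤ} (he : e ∈ I.encode) : |e| ≤ I.memBound := by
  have h1 : (2 : ℕ) ^ I.size ≤ I.memBound :=
    (Nat.le_mul_of_pos_left _ (by positivity)).trans I.two_pow_mul_two_pow_le
  have h2 : I.size ≤ I.memBound := Nat.lt_two_pow_self.le.trans h1
  have hm := I.m_le_size
  have hn := I.n_le_size
  have hp := I.p_le
  rw [encode_eq] at he
  simp only [List.mem_cons, List.mem_flatMap] at he
  rcases he with rfl | rfl | rfl | ⟨q, hq, he⟩
  · rw [Nat.abs_cast]
    omega
  · rw [Nat.abs_cast]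
    omega
  · rw [Nat.abs_cast]
    omega
  · obtain ⟨t, ht, rfl⟩ := List.mem_iff_getElem.mp hq
    have ht' : t < I.m * I.n + I.m := by rwa [length_rats] at ht
    have hr : I.ratAt t = I.rats[t] := by rw [ratAt, List.getD_eq_getElem _ _ ht]
    rw [← hr] at he
    simp only [encodeRat, List.mem_cons, List.not_mem_nil, or_false] at he
    rcases he with rfl | rfl
    · exact (I.abs_num_le ht').trans (by exact_mod_cast h1)
    · rw [Nat.abs_cast]
      have := (Nat.le_of_dvd I.denProd_pos (I.den_dvd ht')).trans (I.prod_den_le le_rfl)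
      omega

theorem bdd_inputMem : (RAM.inputMem I.encode).Bdd I.memBound := by
  intro x i
  rw [RAM.inputMem]
  split_ifs
  · rw [List.getD_eq_getElem?_getD]
    by_cases h : i.toNat < I.encode.length
    · rw [List.getElem?_eq_getElem h]
      exact I.abs_encode_le (List.getElem_mem h)
    · rw [List.getElem?_eq_none (not_lt.mp h)]
      simp
  · rw [encode_eq]
    simp only [List.length_cons, length_flatMap_encodeRat, length_rats, Nat.abs_cast]
    have h1 := I.mul_le_size
    have h2 := I.loopBound_lt_memBound
    rw [loopBound] at h2
    omega
  · simp

/-- Correctness of the answer of the algorithm. -/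
def IsAnswer (I : MixedSystem) : Option (RatAffineMap I.n I.n') → Prop
  | none => I.mixedSet = ∅
  | some T => (∀ j : Fin I.n, (j : ℕ) < I.p → ∃ z : ℤ, T.xbar j = (z : ℚ)) ∧
      T.M.rank = I.n' ∧ I.affineSet = Set.range T.toFun ∧
      I.mixedSet = T.toFun '' mixedInt I.n' I.p'

end MixedSystem

/-! ### Correctness and running time of the complete program. -/

namespace RAM

variable {s : Mem} {I : MixedSystem} {rp cp fr pos : ℕ → ℕ} {k k₁ : ℕ}

/-- Compute the tableau. -/
def tabProg : Prog :=
  .seq readProg <| .seq elimProg <| .seq checkProg <| .seq freeProg <|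
    .seq modulusProg identityProg

/-- The complete program. -/
def mainProg : Prog := .seq tabProg (.seq congProg outProg)

theorem inputMem_of_two_le {l : List ℤ} {x : ℕ} (hx : 2 ≤ x) (i : ℤ) : inputMem l x i = 0 := by
  rw [inputMem, if_neg (by omega), if_neg (by omega)]

theorem tabProg_spec (I : MixedSystem) :
    WP I.loopBound I.memBound tabProg (inputMem I.encode) (fun s => ∃ rp cp k k₁ fr pos,
      TabMem I I.intCoeff rp cp k k₁ fr pos s ∧ ElimState I.m I.n I.intCoeff rp cp 0 0 ∧
      (∀ f < k, ∀ l < k, s 22 (addr f l) = if f = l then 1 else 0) ∧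
      ((s 36 0 = 0 ∧ ∀ i < I.m, rp i = 0 → red I.m I.intCoeff rp i I.n = 0) ∨
      (s 36 0 = 1 ∧ ∃ i < I.m, rp i = 0 ∧ red I.m I.intCoeff rp i I.n ≠ 0))) := by
  have hsz := I.size_le_sq
  have hm := I.m_le_size
  have hn := I.n_le_size
  have hmn := I.mul_le_size
  have hmL : I.m ≤ I.loopBound := by rw [MixedSystem.loopBound]; omega
  have hnL : I.n + 1 ≤ I.loopBound := by rw [MixedSystem.loopBound]; omega
  have hLM : (I.loopBound : ℤ) + 1 ≤ I.memBound := by exact_mod_cast I.loopBound_lt_memBound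
  have hT : (I.tabBound : ℤ) ≤ I.memBound :=
    (I.limits (rp := fun _ => 0) fun _ _ => Nat.zero_le _).bound_le_mem
  refine .seq ((readProg_spec (by rw [MixedSystem.loopBound]; omega) (by omega)
    (by exact_mod_cast I.two_pow_mul_two_pow_le)).mono ?_)
  rintro s₁ hs₁ ⟨h2, h3, h4, h7, h6⟩
  -- Arrays that have not been written to still contain zeros; these serve as initial values for the
  -- pivots, the counters, the flags and the basis.
  have z₁ : ∀ x, 2 ≤ x → x ∉ readProg.mods → ∀ i, s₁ x i = 0 := fun x h h' i => by
    rw [hs₁ x h', inputMem_of_two_le h]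
  refine .seq ((elimProg_spec (A := I.intCoeff) hnL hmL (by omega) (by omega)
    (fun rp hrp i l hl => (I.abs_red_intCoeff_le hrp i hl).trans hT) ⟨h2, h3, ?_, ?_, ?_, ?_⟩).mono ?_)
  · intro i hi l hl
    rw [red_zero hi, h6 i hi l hl]
  · rw [h7, pivDet_zero]
  · intro i _
    rw [z₁ 8 (by decide) (by decide), Nat.cast_zero]
  · intro i _
    rw [z₁ 9 (by decide) (by decide), Nat.cast_zero]
  rintro s₂ hs₂ ⟨rp, cp, hmem, hE⟩
  have z₂ : ∀ x, 2 ≤ x → x ∉ readProg.mods → x ∉ elimProg.mods → ∀ i, s₂ x i = 0 :=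
    fun x h h' h'' i => by rw [hs₂ x h'', z₁ x h h']
  have e4 : s₂ 4 0 = I.p := by rw [hs₂ 4 (by decide), h4]
  refine .seq ((checkProg_spec hmL (by omega) (by omega) hmem
    (z₂ 36 (by decide) (by decide) (by decide) 0)).mono ?_)
  intro s₃ hs₃ hcheck
  have hmem₃ : ElimMem I.m I.n I.intCoeff rp cp s₃ := hmem.of_frame fun x hx =>
    hs₃ x (by revert hx x; decide)
  have z₃ : ∀ x, 2 ≤ x → x ∉ readProg.mods → x ∉ elimProg.mods → x ∉ checkProg.mods →
      ∀ i, s₃ x i = 0 := fun x h h' h'' h3 i => by rw [hs₃ x h3, z₂ x h h' h'']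
  have e4₃ : s₃ 4 0 = I.p := by rw [hs₃ 4 (by decide), e4]
  refine .seq ((freeProg_spec (by omega) (by omega) hmem₃.cols e4₃ hmem₃.colPiv
    (z₃ 17 (by decide) (by decide) (by decide) (by decide) 0)
    (z₃ 18 (by decide) (by decide) (by decide) (by decide) 0)).mono ?_)
  rintro s₄ hs₄ ⟨k, k₁, fr, pos, hfree⟩
  have hmem₄ : ElimMem I.m I.n I.intCoeff rp cp s₄ := hmem₃.of_frame fun x hx =>
    hs₄ x (by revert hx x; decide)
  have e4₄ : s₄ 4 0 = I.p := by rw [hs₄ 4 (by decide), e4₃]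
  refine .seq (modulusProg_spec.mono ?_)
  intro s₅ hs₅ h21
  rw [hmem₄.det] at h21
  have hT₅ : TabMem I I.intCoeff rp cp k k₁ fr pos s₅ := by
    refine ⟨hmem₄.of_frame fun x hx => hs₅ x (by revert hx x; decide), ⟨hfree.enum, ?_, ?_, ?_, ?_⟩,
      by rw [hs₅ 4 (by decide), e4₄], h21⟩
    · rw [hs₅ 17 (by decide), hfree.num]
    · rw [hs₅ 18 (by decide), hfree.numInt]
    · rw [hs₅ 19 (by decide)]
      exact hfree.col
    · rw [hs₅ 20 (by decide)]
      exact hfree.inv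
  have hk := hT₅.k_le
  refine (identityProg_spec (k := k) (by omega) (by omega) (by omega) hT₅.free.num ?_).mono ?_
  · intro f l
    rw [hs₅ 22 (by decide), hs₄ 22 (by decide),
      z₃ 22 (by decide) (by decide) (by decide) (by decide)]
  intro s₆ hs₆ h22
  refine ⟨rp, cp, k, k₁, fr, pos, hT₅.of_frame fun x hx => hs₆ x (by revert hx x; decide), hE, h22,
    ?_⟩
  rwa [hs₆ 36 (by decide), hs₅ 36 (by decide), hs₄ 36 (by decide)]

open AExp in
theorem mainProg_spec (I : MixedSystem) :
    WP I.loopBound I.memBound mainProg (inputMem I.encode)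
      (fun s => ∃ o, I.IsAnswer o ∧ HoldsOutput s (RatAffineMap.encodeOption o)) := by
  have hLM : (I.loopBound : ℤ) + 1 ≤ I.memBound := by exact_mod_cast I.loopBound_lt_memBound
  refine .seq ((tabProg_spec I).mono ?_)
  rintro s₁ hs₁ ⟨rp, cp, k, k₁, fr, pos, hT, hE, h22, h36⟩
  have hlim := I.limits hE.rp_le
  have hz : ∀ x, 2 ≤ x → x ∉ tabProg.mods → ∀ i, s₁ x i = 0 := fun x h h' i => by
    rw [hs₁ x h', inputMem_of_two_le h]
  have htab : I.Tableau I.intCoeff I.denProd rp cp k k₁ fr pos := ⟨I.isScaled, hE, hT.free.enum⟩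
  refine .seq ((congProg_spec hlim hT hE.det_ne h22
    (fun f => hz 23 (by decide) (by decide) f) (hz 16 (by decide) (by decide) 0)).mono ?_)
  rintro s₂ hs₂ ⟨hst, hext, h16⟩
  have e36 : s₂ 36 0 = s₁ 36 0 := by rw [hs₂ 36 (by decide)]
  have hT₂ : TabMem I I.intCoeff rp cp k k₁ fr pos s₂ := hT.of_frame fun x hx =>
    hs₂ x (by revert hx x; decide)
  rw [← e36] at h36
  refine .ifPos (fun hpos => ?_) fun hneg => ?_
  · simp only [eval_add, eval_read, eval_const] at hpos
    refine .seq (.assign (by simp) ((emit_spec (holdsOutput_write_nil _) (by simp; omega)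
      (by simp)).mono fun s' _ h => ⟨none, htab.mixedSet_empty hst ?_, h⟩))
    rcases h36 with h36 | h36
    · exact Or.inr (by omega)
    · exact Or.inl h36.2
  · simp only [eval_add, eval_read, eval_const] at hneg
    have hok : s₂ 16 0 = 0 := by omega
    have hcons : ∀ i < I.m, rp i = 0 → red I.m I.intCoeff rp i I.n = 0 := by
      rcases h36 with h36 | h36
      · exact h36.2
      · omega
    have hD := abs_pos.mpr hE.det_ne
    have hk := hT.k_le
    refine (solutionProg_spec hlim hT₂ hE ?_ ?_ ?_).mono fun s' _ h =>
      ⟨some (I.solMap I.intCoeff rp cp k fr pos (fun f l => s₂ 22 (addr f l)) fun f => s₂ 23 f),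
        ⟨htab.xbar_int hst hext hok hcons, htab.rank_solMap hst hext,
          htab.affineSet_eq hst hext hcons, htab.mixedSet_eq hst hext hok hcons⟩, ?_⟩
    · intro f hf l hl
      by_cases hfl : k₁ ≤ f ∨ k₁ ≤ l
      · rw [hext.mat f hf l hl hfl]
        have := hlim.one_le
        split_ifs
        · simpa using this
        · simp
      · rw [not_or, not_le, not_le] at hfl
        refine le_trans ?_ hlim.det_le
        by_cases h : f = l
        · subst h
          have h1 := hst.basis f hfl.1
          rw [abs_of_pos h1.pos]
          exact h1.diag_le hD fun z w => congLat_modEq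
        · exact hst.N_bdd f hfl.1 l hfl.2 h
    · intro f hf
      by_cases hfk : k₁ ≤ f
      · rw [hext.vec f hf hfk, abs_zero]
        exact zero_le_one.trans hlim.one_le
      · exact (hst.z_bdd f (not_le.mp hfk)).trans hlim.det_le
    · have h1 := I.n_le_size
      have h2 : I.n * (k * 2) ≤ I.size * (I.size * 2) :=
        Nat.mul_le_mul h1 (Nat.mul_le_mul_right _ (hk.trans h1))
      have h3 : 2 + I.n * 2 + I.n * (k * 2) ≤ I.loopBound := by
        rw [MixedSystem.loopBound]
        rw [← mul_assoc I.size] at h2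
        omega
      omega
    · rwa [encodeOption_solMap htab.eq_n']

/-- The time bound of a program is polynomial in the bounds for loops and numbers. -/
theorem Prog.exists_time_eq (L b : Polynomial ℕ) (c : Prog) :
    ∃ P : Polynomial ℕ, ∀ x, c.time (L.eval x) (b.eval x) = P.eval x := by
  induction c with
  | skip => exact ⟨1, fun x => by simp [time]⟩
  | assign y i e =>
    exact ⟨.C (1 + i.ck + e.ck + i.sz + e.sz) * b ^ 2, fun x => by
      rw [time, Polynomial.eval_mul, Polynomial.eval_pow, Polynomial.eval_C]⟩
  | seq c₁ c₂ ih₁ ih₂ =>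
    obtain ⟨P₁, h₁⟩ := ih₁
    obtain ⟨P₂, h₂⟩ := ih₂
    exact ⟨P₁ + P₂, fun x => by rw [time, h₁, h₂, Polynomial.eval_add]⟩
  | ifPos e c₁ c₂ ih₁ ih₂ =>
    obtain ⟨P₁, h₁⟩ := ih₁
    obtain ⟨P₂, h₂⟩ := ih₂
    exact ⟨.C (1 + e.ck) * b ^ 2 + P₁ + P₂, fun x => by
      rw [time, h₁, h₂, Polynomial.eval_add, Polynomial.eval_add, Polynomial.eval_mul,
        Polynomial.eval_pow, Polynomial.eval_C]⟩
  | whilePos e c ih =>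
    obtain ⟨P, h⟩ := ih
    exact ⟨(L + 1) * (.C (1 + e.ck) * b ^ 2) + L * P, fun x => by
      rw [time, h, Polynomial.eval_add, Polynomial.eval_mul, Polynomial.eval_mul,
        Polynomial.eval_mul, Polynomial.eval_pow, Polynomial.eval_C, Polynomial.eval_add,
        Polynomial.eval_one]⟩

theorem Prog.time_mono (L : ℕ) {b b' : ℕ} (h : b ≤ b') (c : Prog) : c.time L b ≤ c.time L b' := by
  induction c with
  | skip => exact le_rfl
  | assign y i e =>
    simp only [time]
    gcongr
  | seq c₁ c₂ ih₁ ih₂ => exact Nat.add_le_add ih₁ ih₂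
  | ifPos e c₁ c₂ ih₁ ih₂ =>
    simp only [time]
    gcongr
  | whilePos e c ih =>
    simp only [time]
    gcongr

/-- The loop bound is itself a polynomial in the size. The length of the memory bound is only
estimated by one, so monotonicity is needed in this argument. -/
theorem exists_time_le : ∃ P : Polynomial ℕ, ∀ I : MixedSystem,
    mainProg.time I.loopBound (bits I.memBound) ≤ P.eval I.size := by
  obtain ⟨P, hP⟩ := mainProg.exists_time_eq (2 + 2 * .X + 6 * (.X * .X))
    (4 + 2 * .X + 12 * (.X * .X))
  refine ⟨P, fun I => ?_⟩
  rw [← hP]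
  simp only [Polynomial.eval_add, Polynomial.eval_mul, Polynomial.eval_X, Polynomial.eval_ofNat]
  exact mainProg.time_mono _ I.bits_memBound_le

end RAM

/-- An answer with data exhibits the point `τ 0` of the mixed integer set. -/
theorem MixedSystem.IsAnswer.eq_none_iff {I : MixedSystem} {o : Option (RatAffineMap I.n I.n')}
    (h : I.IsAnswer o) : o = none ↔ I.mixedSet = ∅ := by
  cases o with
  | none => exact iff_of_true rfl h
  | some T =>
    refine iff_of_false (by simp) ?_
    rw [h.2.2.2, Set.image_eq_empty]
    exact Set.Nonempty.ne_empty ⟨0, fun _ _ => ⟨0, by simp⟩⟩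

theorem mainTheorem8 :
    ∃ f : (I : MixedSystem) → Option (RatAffineMap I.n I.n'),
      RAM.PolyTimeComputable MixedSystem.size MixedSystem.encode
        (fun I => RatAffineMap.encodeOption (f I)) ∧
      ∀ I : MixedSystem,
        (f I = none ↔ I.mixedSet = ∅) ∧
        (∀ T : RatAffineMap I.n I.n', f I = some T →
          (∀ j : Fin I.n, (j : ℕ) < I.p → ∃ z : ℤ, T.xbar j = (z : ℚ)) ∧
          T.M.rank = I.n' ∧
          I.affineSet = Set.range T.toFun ∧
          I.mixedSet = T.toFun '' mixedInt I.n' I.p') ∧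
        (I.affineSet.Nonempty →
          ∀ (d : Fin I.n → ℝ) (β : ℝ), d ≠ 0 →
            (∀ j : Fin I.n, I.p ≤ (j : ℕ) → d j = 0) →
            (∀ x ∈ I.affineSet, ∑ j, d j * x j = β) →
            (I.p' : ℤ) ≤ (I.p : ℤ) - 1) := by
  have key : ∀ I : MixedSystem, ∃ o, I.IsAnswer o ∧ ∃ s t,
      RAM.Runs RAM.mainProg (RAM.inputMem I.encode) s t ∧
      RAM.HoldsOutput s (RatAffineMap.encodeOption o) ∧
      t ≤ RAM.mainProg.time I.loopBound (RAM.bits I.memBound) := by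
    intro I
    obtain ⟨s, t, hr, ht, -, o, ho, hs⟩ := RAM.mainProg_spec I I.bdd_inputMem
    exact ⟨o, ho, s, t, hr, hs, ht⟩
  -- The function is obtained by choice, but the chosen answer is the one whose encoding the fixed
  -- program `mainProg` writes, so it is computed by that program.
  choose f hf hrun using key
  obtain ⟨P, hP⟩ := RAM.exists_time_le
  refine ⟨f, ⟨RAM.mainProg, P, fun I => ?_⟩, fun I => ⟨(hf I).eq_none_iff, fun T hT => ?_,
    fun hA d β hd hd0 hβ => I.p'_le hA d β hd hd0 hβ⟩⟩
  · obtain ⟨s, t, hr, hs, ht⟩ := hrun I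
    exact ⟨s, t, hr, hs, ht.trans (hP I)⟩
  · have h := hf I
    rwa [hT] at h
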